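/- All matroids are labelled: $\mathbb M_n$ denotes the set of matroids with ground set $[n]=\{1,\dots,n\}$, and a property $P$ holds for asymptotically almost all matroids if $|\{M\in\mathbb M_n: M\text{ has property }P\}|/|\mathbb M_n|\to 1$ as $n\to\infty$. Write $\log$ for the base-2 logarithm. For a matroid $M\in\mathbb M_n$ of rank $r$, let $W(M)$ be the set of circuit-hyperplanes of $M$ (the subsets of $[n]$ that are both a circuit and a hyperplane), let $U(M)$ be the set of $r$-element subsets of $[n]$ that are neither bases nor circuit-hyperplanes of $M$, and put $u(M):=|U(M)|/\binom{n}{r}$. A matroid of rank $r$ is paving if all its circuits have cardinality at least $r$, and sparse paving if both it and its dual are paving; let $s(n)$ be the number of sparse paving matroids in $\mathbb M_n$ (of any rank). Define $$\zeta(n):=57\,\frac{\log(n)^2}{n^2}\binom{n}{\lfloor n/2\rfloor},\qquad \Upsilon(n):=5\log(n)\,\zeta(n),\qquad \upsilon(n):=\frac{\Upsilon(n)+2\log(n+1)}{\log s(n)}.$$ **Theorem.** Asymptotically almost all matroids $M$ on $n$ elements satisfy $u(M)\le\upsilon(n)$. Moreover, $\upsilon(n)=O\!\left(\frac{\log(n)^3}{n}\right)$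 as $n\to\infty$. -/

import Mathlib

open Filter Topology Asymptotics

/-- The set `𝕄ₙ` of (labelled) matroids whose ground set is the standard `n`-element set,
here `Fin n`. -/
def matroidsOn (n : ℕ) : Set (Matroid (Fin n)) := {M | M.E = Set.univ}

/-- There are finitely many matroids on `n` labelled elements, so that the cardinalities below are
genuine. -/
theorem matroidsOn_finite (n : ℕ) : (matroidsOn n).Finite := by
  have hinj : Function.Injective
      (fun M : Matroid (Fin n) => (M.E, {B : Set (Fin n) | M.IsBase B})) := by
    intro M N h
    have h1 : M.E = N.E := congrArg Prod.fst h
    have h2 : {B : Set (Fin n) | M.IsBase B} = {B | N.IsBase B} := congrArg Prod.snd h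
    exact Matroid.ext_isBase h1 (fun B _ => Set.ext_iff.1 h2 B)
  have : Finite (Matroid (Fin n)) := Finite.of_injective _ hinj
  exact Set.toFinite _

/-- Asymptotically almost all matroids have property `P`: the fraction of the matroids on `n`
labelled elements that have property `P` tends to `1` as `n → ∞`. -/
def AlmostAllMatroids (P : ∀ n : ℕ, Matroid (Fin n) → Prop) : Prop :=
  Tendsto (fun n : ℕ => (({M ∈ matroidsOn n | P n M}.ncard : ℝ) / ((matroidsOn n).ncard : ℝ)))
    atTop (𝓝 1)

namespace Matroid

/-- A hyperplane of `M` is a flat of rank `r(M) - 1`. -/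
def IsHyperplaneOf {α : Type*} (M : Matroid α) (H : Set α) : Prop :=
  M.IsFlat H ∧ M.eRk H + 1 = M.eRank

/-- A circuit-hyperplane is a set that is both a circuit and a hyperplane. -/
def IsCircuitHyperplane {α : Type*} (M : Matroid α) (X : Set α) : Prop :=
  M.IsCircuit X ∧ M.IsHyperplaneOf X

/-- The non-bases of `M`: the subsets of the ground set that have cardinality `r(M)` but are not
bases, i.e. the dependent `r`-sets. -/
def nonbases {α : Type*} (M : Matroid α) : Set (Set α) :=
  {X | X ⊆ M.E ∧ X.encard = M.eRank ∧ ¬ M.IsBase X}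

/-- `W(M)`: the set of circuit-hyperplanes of `M`. -/
def circuitHyperplanes {α : Type*} (M : Matroid α) : Set (Set α) :=
  {X | M.IsCircuitHyperplane X}

/-- `U(M)`: the non-bases of `M` that are not circuit-hyperplanes. -/
def bigNonbases {α : Type*} (M : Matroid α) : Set (Set α) :=
  M.nonbases \ M.circuitHyperplanes

/-- `u(M) = |U(M)| / binom(n, r)` for a matroid `M` of rank `r` on `n` elements. -/
noncomputable def bigNonbaseDensity {α : Type*} (M : Matroid α) : ℝ :=
  (M.bigNonbases.ncard : ℝ) / (M.E.ncard.choose M.eRank.toNat : ℝ)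

/-- A matroid is paving if all its circuits have cardinality at least its rank. -/
def IsPaving {α : Type*} (M : Matroid α) : Prop :=
  ∀ C, M.IsCircuit C → M.eRank ≤ C.encard

/-- A matroid is sparse paving if both it and its dual are paving. -/
def IsSparsePaving {α : Type*} (M : Matroid α) : Prop :=
  M.IsPaving ∧ M✶.IsPaving

end Matroid

/-- `s(n)`: the number of sparse paving matroids (of any rank) on `n` labelled elements. -/
noncomputable def numSparsePaving (n : ℕ) : ℕ :=
  {M ∈ matroidsOn n | M.IsSparsePaving}.ncard

/-- `ζ(n) = 57 (log₂ n)² / n² · binom(n, ⌊n/2⌋)`. -/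
noncomputable def zetaBound (n : ℕ) : ℝ :=
  57 * (Real.logb 2 (n : ℝ) ^ 2 / (n : ℝ) ^ 2) * (n.choose (n / 2) : ℝ)

/-- `Υ(n) = 5 log₂(n) ζ(n)`. -/
noncomputable def bigUpsilon (n : ℕ) : ℝ :=
  5 * Real.logb 2 (n : ℝ) * zetaBound n

/-- `υ(n) = (Υ(n) + 2 log₂(n + 1)) / log₂ s(n)`. -/
noncomputable def smallUpsilon (n : ℕ) : ℝ :=
  (bigUpsilon n + 2 * Real.logb 2 ((n : ℝ) + 1)) / Real.logb 2 (numSparsePaving n : ℝ)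

/-! Fix a rank r in the middle half and regard the nonbases of a matroid as a family `K` of vertices
of the Johnson graph. A nonbasis of rank r-1 contains a unique circuit C and spans a hyperplane H,
and exchanging x for y yields a basis exactly when x ∈ C and y ∉ H. `IsSys` extracts what is needed
of this; C and H become `cor` and `spn`, and nonbases of smaller rank are the "deep" ones. A
nonbasis is a circuit-hyperplane exactly if it is isolated in `K`, so U(M) is `big K`. Stable
families of r-sets are precisely the nonbasis families of sparse paving matroids of rank r. It
therefore suffices to show that each m above υ(n)·binom(n,r) is attained as |`big K`| by at most
s(n)·2^(-2n) systems, and to sum over ranks and values of m. Ranks outside the middle half are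
negligible: there binom(n,r) is at most the middle binomial divided by 2n, while log s(n) is at
least the middle binomial divided by n.

The encoding of `K` starts from a container D ⊆ K that holds every member with more than n/64 free
exchanges of either kind. It is a union of about (m log n + binom(n,r))/n² simple blocks, hence
cheap to list (`exists_container`). From D alone one can tell the circuit and the hyperplane of a
low member, so a single low member reveals all others with the same circuit or the same hyperplane.
Representatives R of the resulting classes that avoid D complete the description (`Der`).

Put w = (m/binom(n,r))·log s(n) and q ≈ w/(128 log n). If at most 16q representatives lie in `big
K`, then D and these representatives determine U = `big K`. For fixed U the isolated part of `K` can
be joined to any stable subfamily of U, always giving different stable families. By Shearer's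
inequality U has at least its proportional share of stable subfamilies (`numStable_pow_le`), so a
factor 2^w is saved, whereas the list of representatives costs about w/4 in the exponent.

Otherwise, up to duality, at least 8q representatives are properly contained in their spans. For a
suitable element e, at least q of them can be moved into D by exchanging e for a fixed element of
the span. Any subset of the moves may be carried out: the outcome is always stable (`stable_moved`),
and with D and e it still determines `K`, because the moved members are those that lie in D
(`der_moved_iff`). Each `K` thus yields 2^q distinct codes. Both savings exceed the cost of D, since
w/log n is at least 285 (log n)² binom(n,⌊n/2⌋)/n² and m ≤ wn. -/

namespace Johnson

/-! ### Exchanges, cores and spans in the Johnson graph. -/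

variable {α : Type*} [DecidableEq α]

/-- The set obtained from `X` by exchanging `x` for `y`. -/
def sw (X : Finset α) (x y : α) : Finset α := insert y (X.erase x)

theorem mem_sw {X : Finset α} {x y z : α} : z ∈ sw X x y ↔ z = y ∨ (z ≠ x ∧ z ∈ X) := by
  simp [sw]

theorem sw_card {X : Finset α} {x y : α} (hx : x ∈ X) (hy : y ∉ X) :
    (sw X x y).card = X.card := by
  have h : y ∉ X.erase x := fun h => hy (Finset.mem_of_mem_erase h)
  have := Finset.card_pos.2 ⟨x, hx⟩
  rw [sw, Finset.card_insert_of_notMem h, Finset.card_erase_of_mem hx]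
  omega

theorem sw_sw {X : Finset α} {x y : α} (hx : x ∈ X) (hy : y ∉ X) : sw (sw X x y) y x = X := by
  ext z
  simp only [mem_sw]
  by_cases h1 : z = x
  · simp [h1, hx]
  · by_cases h2 : z = y
    · subst h2; simp [h1, hy]
    · simp [h1, h2]

theorem sw_insert_erase {X : Finset α} {x y : α} (hy : y ∉ X) (hx : x ∈ X) :
    sw X x y = (insert y X).erase x := by
  ext z
  simp only [mem_sw, Finset.mem_erase, Finset.mem_insert]
  by_cases h1 : z = x
  · subst h1; simp only [ne_eq, not_true_eq_false, false_and, or_false, iff_false]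
    rintro rfl; exact hy hx
  · simp [h1]

theorem sw_compl [Fintype α] {X : Finset α} {x y : α} (hx : x ∈ X) (hy : y ∉ X) :
    sw Xᶜ y x = (sw X x y)ᶜ := by
  ext z
  simp only [mem_sw, Finset.mem_compl]
  by_cases h1 : z = x
  · subst h1
    have : z ≠ y := by rintro rfl; exact hy hx
    simp [this]
  · by_cases h2 : z = y
    · subst h2; simp [h1]
    · simp [h1, h2]

/-- Adjacency in the Johnson graph: one set arises from the other by a single exchange. -/
def Adj (X Y : Finset α) : Prop := ∃ x ∈ X, ∃ y, y ∉ X ∧ Y = sw X x y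

theorem Adj.symm {X Y : Finset α} (h : Adj X Y) : Adj Y X := by
  obtain ⟨x, hx, y, hy, rfl⟩ := h
  refine ⟨y, by simp [mem_sw], x, ?_, (sw_sw hx hy).symm⟩
  rw [mem_sw]
  rintro (rfl | h)
  · exact hy hx
  · exact h.1 rfl

theorem Adj.ne {X Y : Finset α} (h : Adj X Y) : X ≠ Y := by
  obtain ⟨x, hx, y, hy, rfl⟩ := h
  intro h
  exact hy (by rw [h]; simp [mem_sw])

theorem adj_compl [Fintype α] {X Y : Finset α} (h : Adj X Y) : Adj Xᶜ Yᶜ := by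
  obtain ⟨x, hx, y, hy, rfl⟩ := h
  exact ⟨y, by simpa using hy, x, by simpa using hx, (sw_compl hx hy).symm⟩

/-- A family of sets is stable if no two members are adjacent in the Johnson graph. -/
def Stable (I : Finset (Finset α)) : Prop := ∀ X ∈ I, ∀ Y ∈ I, ¬ Adj X Y

theorem Stable.mono {I J : Finset (Finset α)} (h : Stable J) (hIJ : I ⊆ J) : Stable I :=
  fun X hX Y hY => h X (hIJ hX) Y (hIJ hY)

variable [Fintype α]

/-- The elements of `X` that may be exchanged for any outside element without leaving `K`. -/
def outs (K : Finset (Finset α)) (X : Finset α) : Finset α :=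
  X.filter (fun x => ∀ y, y ∉ X → sw X x y ∈ K)

/-- The elements outside `X` that may replace any element of `X` without leaving `K`. -/
def ins (K : Finset (Finset α)) (X : Finset α) : Finset α :=
  Xᶜ.filter (fun y => ∀ x, x ∈ X → sw X x y ∈ K)

theorem mem_outs {K : Finset (Finset α)} {X : Finset α} {x : α} :
    x ∈ outs K X ↔ x ∈ X ∧ ∀ y, y ∉ X → sw X x y ∈ K := by simp [outs]

theorem mem_ins {K : Finset (Finset α)} {X : Finset α} {y : α} :
    y ∈ ins K X ↔ y ∉ X ∧ ∀ x, x ∈ X → sw X x y ∈ K := by simp [ins]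

/-- The core of `X`; for the nonbases of a matroid and `X` of corank one, the circuit in `X`. -/
def cor (K : Finset (Finset α)) (X : Finset α) : Finset α := X \ outs K X

/-- The span of `X`; for the nonbases of a matroid and `X` of corank one, the closure of `X`. -/
def spn (K : Finset (Finset α)) (X : Finset α) : Finset α := X ∪ ins K X

theorem cor_subset (K : Finset (Finset α)) (X : Finset α) : cor K X ⊆ X := Finset.sdiff_subset

theorem subset_spn (K : Finset (Finset α)) (X : Finset α) : X ⊆ spn K X :=
  Finset.subset_union_left

theorem outs_subset (K : Finset (Finset α)) (X : Finset α) : outs K X ⊆ X :=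
  Finset.filter_subset _ _

theorem disjoint_ins (K : Finset (Finset α)) (X : Finset α) : Disjoint X (ins K X) := by
  rw [Finset.disjoint_left]
  intro x hx h
  exact (mem_ins.1 h).1 hx

theorem card_cor (K : Finset (Finset α)) (X : Finset α) :
    (cor K X).card + (outs K X).card = X.card := by
  rw [cor, Finset.card_sdiff_add_card_eq_card (outs_subset K X)]

theorem card_spn (K : Finset (Finset α)) (X : Finset α) :
    (spn K X).card = X.card + (ins K X).card :=
  Finset.card_union_of_disjoint (disjoint_ins K X)

theorem mem_cor {K : Finset (Finset α)} {X : Finset α} {x : α} :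
    x ∈ cor K X ↔ x ∈ X ∧ x ∉ outs K X := by simp [cor]

theorem mem_spn {K : Finset (Finset α)} {X : Finset α} {y : α} :
    y ∈ spn K X ↔ y ∈ X ∨ y ∈ ins K X := by simp [spn]

/-- The complementary family. -/
def dual (K : Finset (Finset α)) : Finset (Finset α) := K.image compl

theorem mem_dual {K : Finset (Finset α)} {X : Finset α} : X ∈ dual K ↔ Xᶜ ∈ K := by
  rw [dual, Finset.mem_image]
  constructor
  · rintro ⟨Y, hY, rfl⟩; simpa using hY
  · intro h; exact ⟨Xᶜ, h, by simp⟩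

theorem compl_mem_dual {K : Finset (Finset α)} {X : Finset α} : Xᶜ ∈ dual K ↔ X ∈ K := by
  rw [mem_dual, compl_compl]

theorem dual_dual (K : Finset (Finset α)) : dual (dual K) = K := by
  ext X; rw [mem_dual, mem_dual, compl_compl]

theorem dual_injective : Function.Injective (dual : Finset (Finset α) → Finset (Finset α)) :=
  fun K L h => by rw [← dual_dual K, h, dual_dual]

theorem sw_compl_mem_dual {K : Finset (Finset α)} {X : Finset α} {x y : α} (hx : x ∈ X)
    (hy : y ∉ X) : sw Xᶜ y x ∈ dual K ↔ sw X x y ∈ K := by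
  rw [sw_compl hx hy, compl_mem_dual]

theorem outs_dual (K : Finset (Finset α)) (X : Finset α) : outs (dual K) Xᶜ = ins K X := by
  ext y
  rw [mem_outs, mem_ins, Finset.mem_compl]
  refine and_congr_right fun hy => forall_congr' fun x => ?_
  rw [Finset.mem_compl, not_not]
  exact imp_congr_right fun hx => sw_compl_mem_dual hx hy

theorem ins_dual (K : Finset (Finset α)) (X : Finset α) : ins (dual K) Xᶜ = outs K X := by
  rw [← outs_dual, dual_dual, compl_compl]

theorem cor_dual (K : Finset (Finset α)) (X : Finset α) : cor (dual K) Xᶜ = (spn K X)ᶜ := by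
  rw [cor, outs_dual, spn, Finset.compl_union, Finset.sdiff_eq_inter_compl]

theorem spn_dual (K : Finset (Finset α)) (X : Finset α) : spn (dual K) Xᶜ = (cor K X)ᶜ := by
  rw [← compl_compl (spn _ _), ← cor_dual, dual_dual, compl_compl]

/-- Members of `K` with a neighbour outside `K`. -/
def Nondeep (K : Finset (Finset α)) (X : Finset α) : Prop :=
  X ∈ K ∧ ∃ x ∈ X, ∃ y, y ∉ X ∧ sw X x y ∉ K

theorem Nondeep.dual {K : Finset (Finset α)} {X : Finset α} (h : Nondeep K X) :
    Nondeep (dual K) Xᶜ := by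
  obtain ⟨h, x, hx, y, hy, hxy⟩ := h
  exact ⟨compl_mem_dual.2 h, y, by simpa using hy, x, by simpa using hx,
    by rwa [sw_compl_mem_dual hx hy]⟩

theorem nondeep_dual_iff {K : Finset (Finset α)} {X : Finset α} :
    Nondeep (Johnson.dual K) Xᶜ ↔ Nondeep K X := by
  refine ⟨fun h => ?_, fun h => h.dual⟩
  have := h.dual
  rwa [dual_dual, compl_compl] at this

/-! ### Abstract nonbasis systems and their duality. -/

/-- The properties of the family of nonbases of a rank-`r` matroid that are used below. -/
structure IsSys (r : ℕ) (K : Finset (Finset α)) : Prop where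
  card_eq : ∀ X ∈ K, X.card = r
  mem_or : ∀ X ∈ K, ∀ x ∈ X, ∀ y, y ∉ X → sw X x y ∈ K → x ∈ outs K X ∨ y ∈ ins K X
  of_cor_subset : ∀ X, Nondeep K X → ∀ Y : Finset α, Y.card = r → cor K X ⊆ Y → Y ∈ K
  of_subset_spn : ∀ X, Nondeep K X → ∀ Y : Finset α, Y.card = r → Y ⊆ spn K X → Y ∈ K

namespace IsSys

variable {r : ℕ} {K : Finset (Finset α)} {X Y : Finset α}

/-- Complementation interchanges `outs` with `ins`, hence cores with complements of spans. Facts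
about cores and about spans can therefore be transferred to each other. -/
theorem dual (h : IsSys r K) : IsSys (Fintype.card α - r) (Johnson.dual K) where
  card_eq X hX := by
    have := h.card_eq _ (mem_dual.1 hX)
    rw [Finset.card_compl] at this
    have := Finset.card_le_univ X
    omega
  mem_or X hX y hy x hx hxy := by
    rw [← compl_compl X, outs_dual, ins_dual]
    have hx' : x ∈ Xᶜ := by simpa using hx
    have hy' : y ∉ Xᶜ := by simpa using hy
    have := h.mem_or _ (mem_dual.1 hX) x hx' y hy' (by
      rwa [← sw_compl_mem_dual hx' hy', compl_compl])
    exact this.symm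
  of_cor_subset X hX Y hY hXY := by
    rw [mem_dual]
    have hX' : Nondeep K Xᶜ := by rwa [← nondeep_dual_iff, compl_compl]
    have h0 := h.card_eq _ hX'.1
    have h1 := Finset.card_le_univ Y
    have h2 := Finset.card_le_univ Xᶜ
    refine h.of_subset_spn _ hX' _ (by rw [Finset.card_compl]; omega) ?_
    rw [← compl_compl X, cor_dual] at hXY
    intro y hy
    by_contra hy'
    exact Finset.mem_compl.1 hy (hXY (Finset.mem_compl.2 hy'))
  of_subset_spn X hX Y hY hXY := by
    rw [mem_dual]
    have hX' : Nondeep K Xᶜ := by rwa [← nondeep_dual_iff, compl_compl]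
    have h0 := h.card_eq _ hX'.1
    have h1 := Finset.card_le_univ Y
    have h2 := Finset.card_le_univ Xᶜ
    refine h.of_cor_subset _ hX' _ (by rw [Finset.card_compl]; omega) ?_
    rw [← compl_compl X, spn_dual] at hXY
    intro y hy
    exact Finset.mem_compl.2 fun hy' => Finset.mem_compl.1 (hXY hy') hy

/-- Exchanging an element of `Y` outside `cor K X` preserves the inclusion of `cor K X`, so such an
element is free in `Y`. -/
theorem cor_subset_of (h : IsSys r K) (hX : Nondeep K X) (hYr : Y.card = r)
    (hXY : cor K X ⊆ Y) : cor K Y ⊆ cor K X := by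
  intro y hy
  rw [mem_cor] at hy
  by_contra hyX
  refine hy.2 (mem_outs.2 ⟨hy.1, fun z hz => ?_⟩)
  refine h.of_cor_subset X hX _ (by rw [sw_card hy.1 hz, hYr]) fun w hw => ?_
  rw [mem_sw]
  exact Or.inr ⟨by rintro rfl; exact hyX hw, hXY hw⟩

/-- The previous inclusion applies in both directions; this is the uniqueness of the circuit in an
r-set of rank r-1. -/
theorem cor_eq (h : IsSys r K) (hX : Nondeep K X) (hY : Nondeep K Y) (hXY : cor K X ⊆ Y) :
    cor K Y = cor K X := by
  have h1 := h.cor_subset_of hX (h.card_eq _ hY.1) hXY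
  exact h1.antisymm
    (h.cor_subset_of hY (h.card_eq _ hX.1) (h1.trans (cor_subset _ _)))

theorem spn_eq (h : IsSys r K) (hX : Nondeep K X) (hY : Nondeep K Y) (hXY : Y ⊆ spn K X) :
    spn K Y = spn K X := by
  have := h.dual.cor_eq hX.dual hY.dual (by
    rw [cor_dual]; exact Finset.compl_subset_compl.2 hXY)
  rw [cor_dual, cor_dual] at this
  exact compl_injective this

theorem card_outs_eq (h : IsSys r K) (hX : X ∈ K) (hY : Y ∈ K) (hXY : cor K Y = cor K X) :
    (outs K Y).card = (outs K X).card := by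
  have h1 := card_cor K X
  have h2 := card_cor K Y
  rw [h.card_eq _ hX] at h1
  rw [h.card_eq _ hY, hXY] at h2
  omega

theorem card_ins_eq (h : IsSys r K) (hX : X ∈ K) (hY : Y ∈ K) (hXY : spn K Y = spn K X) :
    (ins K Y).card = (ins K X).card := by
  have h1 := card_spn K X
  have h2 := card_spn K Y
  rw [h.card_eq _ hX] at h1
  rw [h.card_eq _ hY, hXY] at h2
  omega

/-- The contrapositive of `mem_or`: core against complement of the span is exactly the rectangle of
exchanges that leave `K`. -/
theorem sw_notMem (h : IsSys r K) (hX : X ∈ K) {x y : α} (hx : x ∈ cor K X)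
    (hy : y ∉ spn K X) : sw X x y ∉ K := by
  rw [mem_cor] at hx
  rw [mem_spn, not_or] at hy
  intro hK
  rcases h.mem_or X hX x hx.1 y hy.1 hK with h1 | h1
  · exact hx.2 h1
  · exact hy.2 h1

theorem exists_cor_spn (hX : Nondeep K X) : (∃ x, x ∈ cor K X) ∧ ∃ y, y ∉ spn K X := by
  obtain ⟨hX, x, hx, y, hy, hxy⟩ := hX
  refine ⟨⟨x, mem_cor.2 ⟨hx, fun h => hxy ((mem_outs.1 h).2 y hy)⟩⟩, y, ?_⟩
  rw [mem_spn, not_or]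
  exact ⟨hy, fun h => hxy ((mem_ins.1 h).2 x hx)⟩

theorem nondeep_of (h : IsSys r K) (hX : X ∈ K) {x y : α} (hx : x ∈ cor K X)
    (hy : y ∉ spn K X) : Nondeep K X :=
  ⟨hX, x, cor_subset _ _ hx, y, fun hy' => hy (subset_spn _ _ hy'), h.sw_notMem hX hx hy⟩

/-- Exchanging an element of the core for an element of the span keeps the span. -/
theorem nondeep_sw_ins (h : IsSys r K) (hX : Nondeep K X) {x y : α} (hx : x ∈ cor K X)
    (hy : y ∈ ins K X) : Nondeep K (sw X x y) := by
  have hxX := cor_subset _ _ hx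
  have hyX := (mem_ins.1 hy).1
  obtain ⟨-, z, hz⟩ := exists_cor_spn hX
  have hzX : z ∉ X := fun h' => hz (subset_spn _ _ h')
  have hzy : z ≠ y := by rintro rfl; exact hz (mem_spn.2 (Or.inr hy))
  refine ⟨(mem_ins.1 hy).2 x hxX, y, by simp [mem_sw], z, ?_, ?_⟩
  · simp [mem_sw, hzy, hzX]
  -- Replacing y in turn by an element z outside the span amounts to exchanging x for z, which
  -- leaves `K`.
  · have : sw (sw X x y) y z = sw X x z := by
      ext w
      simp only [mem_sw]
      by_cases hw : w = y
      · subst hw; simp [hyX]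
      · simp [hw]
    rw [this]
    exact h.sw_notMem hX.1 hx hz

theorem spn_sw_ins (h : IsSys r K) (hX : Nondeep K X) {x y : α} (hx : x ∈ cor K X)
    (hy : y ∈ ins K X) : spn K (sw X x y) = spn K X := by
  refine h.spn_eq hX (h.nondeep_sw_ins hX hx hy) fun z hz => ?_
  rw [mem_spn]
  rcases mem_sw.1 hz with rfl | hz
  · exact Or.inr hy
  · exact Or.inl hz.2

end IsSys

/-- The members of `K` that have few exchanges of either kind. -/
def Low (K : Finset (Finset α)) (X : Finset α) : Prop :=
  X ∈ K ∧ 64 * (outs K X).card ≤ Fintype.card α ∧ 64 * (ins K X).card ≤ Fintype.card α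

theorem low_dual {K : Finset (Finset α)} {X : Finset α} : Low (dual K) Xᶜ ↔ Low K X := by
  rw [Low, Low, outs_dual, ins_dual, compl_mem_dual]
  tauto

/-- The rank is in the middle half. -/
def Mid (α : Type*) [Fintype α] (r : ℕ) : Prop :=
  Fintype.card α ≤ 4 * r ∧ 4 * r ≤ 3 * Fintype.card α ∧ 0 < Fintype.card α

theorem Mid.dual {β : Type*} [Fintype β] {r : ℕ} (h : Mid β r) :
    Mid β (Fintype.card β - r) := by
  obtain ⟨h1, h2, h3⟩ := h
  refine ⟨?_, ?_, h3⟩ <;> omega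

/-- Inside and outside `X` there are at least n/4 elements, of which at most n/64 are free; so the
core is nonempty and the span is proper. -/
theorem IsSys.nondeep_of_low {r : ℕ} {K : Finset (Finset α)} {X : Finset α} (h : IsSys r K)
    (hr : Mid α r) (hX : Low K X) : Nondeep K X := by
  obtain ⟨h1, h2, h3⟩ := hr
  obtain ⟨hX, h4, h5⟩ := hX
  have h6 := card_cor K X
  rw [h.card_eq _ hX] at h6
  have h7 := card_spn K X
  rw [h.card_eq _ hX] at h7
  obtain ⟨x, hx⟩ := Finset.card_pos.1 (show 0 < (cor K X).card by omega)
  have : ∃ y, y ∉ spn K X := by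
    by_contra! hc
    rw [Finset.eq_univ_iff_forall.2 hc, Finset.card_univ] at h7
    omega
  obtain ⟨y, hy⟩ := this
  exact h.nondeep_of hX hx hy

end Johnson

/-! ### Containers and derivation from a container. -/

namespace Johnson

variable {α : Type*} [DecidableEq α] [Fintype α]

/-- The number of elements of `X` whose exchange for `y` leads into `D`. -/
def colDeg (D : Finset (Finset α)) (X : Finset α) (y : α) : ℕ :=
  (X.filter (fun x => sw X x y ∈ D)).card

/-- The number of outside elements whose exchange for `x ∈ X` leads into `D`. -/
def rowDeg (D : Finset (Finset α)) (X : Finset α) (x : α) : ℕ :=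
  (Xᶜ.filter (fun y => sw X x y ∈ D)).card

/-- The number of exchanges that lead from `X` into `D`. -/
def deg (D : Finset (Finset α)) (X : Finset α) : ℕ :=
  ((X ×ˢ Xᶜ).filter (fun p => sw X p.1 p.2 ∈ D)).card

theorem rowDeg_dual {D : Finset (Finset α)} {X : Finset α} {y : α} (hy : y ∉ X) :
    rowDeg (dual D) Xᶜ y = colDeg D X y := by
  rw [rowDeg, colDeg, compl_compl]
  congr 1
  refine Finset.filter_congr fun x hx => ?_
  exact sw_compl_mem_dual hx hy

theorem colDeg_dual {D : Finset (Finset α)} {X : Finset α} {x : α} (hx : x ∈ X) :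
    colDeg (dual D) Xᶜ x = rowDeg D X x := by
  rw [← rowDeg_dual (by simpa using hx), dual_dual, compl_compl]

theorem deg_dual (D : Finset (Finset α)) (X : Finset α) : deg (dual D) Xᶜ = deg D X := by
  rw [deg, deg, compl_compl]
  refine Finset.card_bij' (fun p _ => p.swap) (fun p _ => p.swap) ?_ ?_ ?_ ?_
  · rintro ⟨y, x⟩ h
    simp only [Finset.mem_filter, Finset.mem_product, Finset.mem_compl, Prod.swap_prod_mk] at h ⊢
    exact ⟨⟨h.1.2, h.1.1⟩, (sw_compl_mem_dual h.1.2 h.1.1).1 h.2⟩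
  · rintro ⟨x, y⟩ h
    simp only [Finset.mem_filter, Finset.mem_product, Finset.mem_compl, Prod.swap_prod_mk] at h ⊢
    exact ⟨⟨h.1.2, h.1.1⟩, (sw_compl_mem_dual h.1.1 h.1.2).2 h.2⟩
  · simp
  · simp

/-- A subfamily `D` of `K` that contains everything but low members and lets one recognise the
deep members and the exchanges of low members. -/
structure IsContainer (r : ℕ) (K D : Finset (Finset α)) : Prop where
  subset : D ⊆ K
  mem_of_not_low : ∀ X ∈ K, ¬ Low K X → X ∈ D
  le_deg : ∀ X ∈ K, ¬ Nondeep K X → Fintype.card α ^ 2 ≤ 32 * deg D X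
  le_colDeg : ∀ X, Low K X → ∀ y ∈ ins K X, 3 * r ≤ 4 * colDeg D X y
  le_rowDeg : ∀ X, Low K X → ∀ x ∈ outs K X, 3 * (Fintype.card α - r) ≤ 4 * rowDeg D X x

theorem IsContainer.dual {r : ℕ} {K D : Finset (Finset α)} (h : IsContainer r K D)
    (hr : r ≤ Fintype.card α) : IsContainer (Fintype.card α - r) (dual K) (dual D) where
  subset := Finset.image_subset_image h.subset
  mem_of_not_low X hX hlow := by
    rw [mem_dual] at hX ⊢
    exact h.mem_of_not_low _ hX (by rwa [← low_dual, compl_compl])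
  le_deg X hX hdeep := by
    rw [← compl_compl X, deg_dual]
    rw [mem_dual] at hX
    exact h.le_deg _ hX (by rwa [← nondeep_dual_iff, compl_compl])
  le_colDeg X hX y hy := by
    rw [← compl_compl X] at hX hy ⊢
    rw [ins_dual] at hy
    rw [colDeg_dual (outs_subset _ _ hy)]
    exact h.le_rowDeg _ (low_dual.1 hX) y hy
  le_rowDeg X hX y hy := by
    rw [← compl_compl X] at hX hy ⊢
    rw [outs_dual] at hy
    rw [rowDeg_dual (mem_ins.1 hy).1, Nat.sub_sub_self hr]
    exact h.le_colDeg _ (low_dual.1 hX) y hy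

/-- The span of `X` as estimated from `D`. -/
def spnEst (r : ℕ) (D : Finset (Finset α)) (X : Finset α) : Finset α :=
  X ∪ Xᶜ.filter (fun y => r ≤ 2 * colDeg D X y)

/-- The core of `X` as estimated from `D`. -/
def corEst (r : ℕ) (D : Finset (Finset α)) (X : Finset α) : Finset α :=
  X \ X.filter (fun x => Fintype.card α - r ≤ 2 * rowDeg D X x)

/-- The sets that can be derived from `D`, from `J`, and from the convention that a member `v` of
both stands for the subsets of `insert e v`. -/
inductive Der (r : ℕ) (D J : Finset (Finset α)) (e : α) : Finset α → Prop
  | of_mem_left {X : Finset α} (h : X ∈ D) : Der r D J e X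
  | of_mem_right {X : Finset α} (h : X ∈ J) : Der r D J e X
  | lift {v : Finset α} (x : α) (hJ : v ∈ J) (hD : v ∈ D) (hx : x ∈ insert e v) :
      Der r D J e ((insert e v).erase x)
  | up {X Y : Finset α} (hX : Der r D J e X) (hd : 32 * deg D X < Fintype.card α ^ 2)
      (hY : Y.card = r) (hXY : corEst r D X ⊆ Y) : Der r D J e Y
  | down {X Y : Finset α} (hX : Der r D J e X) (hd : 32 * deg D X < Fintype.card α ^ 2)
      (hY : Y.card = r) (hXY : Y ⊆ spnEst r D X) : Der r D J e Y

namespace IsContainer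

variable {r : ℕ} {K D : Finset (Finset α)}

/-- If y were not in `ins K X`, `mem_or` would put at least r/2 ≥ n/8 elements into `outs K X`. All
their exchanges, at least (n/8)(n/4) in number, would lead into `D`, against the degree bound. -/
theorem mem_ins_of_le (hD : IsContainer r K D) (hK : IsSys r K) (hr : Mid α r) {X : Finset α}
    (hX : X ∈ K) (hd : 32 * deg D X < Fintype.card α ^ 2) {y : α} (hy : y ∉ X)
    (hc : r ≤ 2 * colDeg D X y) : y ∈ ins K X := by
  by_contra hyi
  have hnd : Nondeep K X := by
    by_contra h
    exact absurd (hD.le_deg X hX h) (not_le.2 hd)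
  have h1 : colDeg D X y ≤ (outs K X).card := by
    refine Finset.card_le_card fun x hx => ?_
    rw [Finset.mem_filter] at hx
    exact (hK.mem_or X hX x hx.1 y hy (hD.subset hx.2)).resolve_right hyi
  obtain ⟨h2, h3, h4⟩ := hr
  have h5 : outs K X ×ˢ Xᶜ ⊆ (X ×ˢ Xᶜ).filter (fun p => sw X p.1 p.2 ∈ D) := by
    rintro ⟨x, z⟩ hxz
    obtain ⟨hxo, hz⟩ : x ∈ outs K X ∧ z ∉ X := by simpa using hxz
    have hx := mem_outs.1 hxo
    have hK' := hx.2 z hz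
    simp only [Finset.mem_filter, Finset.mem_product, Finset.mem_compl]
    -- The core does not grow under this exchange, so the new set still has at least n/8 free
    -- elements and is not low.
    refine ⟨⟨hx.1, hz⟩, hD.mem_of_not_low _ hK' fun hl => ?_⟩
    have hsub : cor K X ⊆ sw X x z := fun w hw => by
      rw [mem_cor] at hw
      exact mem_sw.2 (Or.inr ⟨by rintro rfl; exact hw.2 hxo, hw.1⟩)
    have h6 := Finset.card_le_card (hK.cor_subset_of hnd (hK.card_eq _ hK') hsub)
    have h7 := card_cor K X
    have h8 := card_cor K (sw X x z)
    rw [hK.card_eq _ hX] at h7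
    rw [hK.card_eq _ hK'] at h8
    have := hl.2.1
    omega
  have h6 := Finset.card_le_card h5
  rw [Finset.card_product, Finset.card_compl, hK.card_eq _ hX] at h6
  have h7 : Fintype.card α ≤ 8 * (outs K X).card := by omega
  have h8 : Fintype.card α ≤ 4 * (Fintype.card α - r) := by omega
  have h9 := Nat.mul_le_mul h7 h8
  rw [deg] at hd
  nlinarith

theorem spnEst_subset (hD : IsContainer r K D) (hK : IsSys r K) (hr : Mid α r) {X : Finset α}
    (hX : X ∈ K) (hd : 32 * deg D X < Fintype.card α ^ 2) : spnEst r D X ⊆ spn K X := by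
  refine Finset.union_subset_union_right fun y hy => ?_
  rw [Finset.mem_filter, Finset.mem_compl] at hy
  exact hD.mem_ins_of_le hK hr hX hd hy.1 hy.2

theorem corEst_dual (X : Finset α) :
    spnEst (Fintype.card α - r) (Johnson.dual D) Xᶜ = (corEst r D X)ᶜ := by
  ext x
  simp only [spnEst, corEst, Finset.mem_union, Finset.mem_compl, Finset.mem_sdiff,
    Finset.mem_filter, not_and, compl_compl]
  by_cases hx : x ∈ X
  · simp [hx, colDeg_dual]
  · simp [hx]

theorem subset_corEst (hD : IsContainer r K D) (hK : IsSys r K) (hr : Mid α r) {X : Finset α}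
    (hX : X ∈ K) (hd : 32 * deg D X < Fintype.card α ^ 2) : cor K X ⊆ corEst r D X := by
  have hrn : r ≤ Fintype.card α := by obtain ⟨h2, h3, h4⟩ := hr; omega
  have := (hD.dual hrn).spnEst_subset hK.dual hr.dual (compl_mem_dual.2 hX)
    (by rwa [deg_dual])
  rw [corEst_dual, spn_dual] at this
  exact Finset.compl_subset_compl.1 this

/-- Everything that is derived from genuine members of `K` is in `K`. -/
theorem mem_of_der (hD : IsContainer r K D) (hK : IsSys r K) (hr : Mid α r)
    {J : Finset (Finset α)} {e : α} (hJ : J ⊆ K)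
    (hJD : ∀ v ∈ J, v ∈ D → ∀ x ∈ insert e v, (insert e v).erase x ∈ K) {X : Finset α}
    (h : Der r D J e X) : X ∈ K := by
  induction h with
  | of_mem_left h => exact hD.subset h
  | of_mem_right h => exact hJ h
  | lift x h1 h2 hx => exact hJD _ h1 h2 x hx
  | up hX hd hY hXY ih =>
    have hnd := not_not.1 fun h => absurd (hD.le_deg _ ih h) (not_le.2 hd)
    exact hK.of_cor_subset _ hnd _ hY ((hD.subset_corEst hK hr ih hd).trans hXY)
  | down hX hd hY hXY ih =>
    have hnd := not_not.1 fun h => absurd (hD.le_deg _ ih h) (not_le.2 hd)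
    exact hK.of_subset_spn _ hnd _ hY (hXY.trans (hD.spnEst_subset hK hr ih hd))

/-- Each exchange into `D` uses an element of `outs` or of `ins`, which allows at most
(n/64)((n-r)+r) = n²/64 of them, half the threshold. -/
theorem deg_lt_of_low (hD : IsContainer r K D) (hK : IsSys r K) (hr : Mid α r) {X : Finset α}
    (hX : Low K X) : 32 * deg D X < Fintype.card α ^ 2 := by
  obtain ⟨h1, h2, h3⟩ := hr
  obtain ⟨hX, h4, h5⟩ := hX
  have h6 : (X ×ˢ Xᶜ).filter (fun p => sw X p.1 p.2 ∈ D) ⊆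
      (outs K X ×ˢ Xᶜ) ∪ (X ×ˢ ins K X) := by
    rintro ⟨x, y⟩ h
    simp only [Finset.mem_filter, Finset.mem_product, Finset.mem_compl, Finset.mem_union] at h ⊢
    rcases hK.mem_or X hX x h.1.1 y h.1.2 (hD.subset h.2) with h' | h'
    · exact Or.inl ⟨h', h.1.2⟩
    · exact Or.inr ⟨h.1.1, h'⟩
  have h7 := (Finset.card_le_card h6).trans (Finset.card_union_le _ _)
  rw [Finset.card_product, Finset.card_product, Finset.card_compl, hK.card_eq _ hX] at h7
  rw [deg]
  have h8 : (outs K X).card * (Fintype.card α - r) * 64 ≤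
      Fintype.card α * (Fintype.card α - r) := by nlinarith
  have h9 : r * (ins K X).card * 64 ≤ Fintype.card α * r := by nlinarith
  have h10 : Fintype.card α * (Fintype.card α - r) + Fintype.card α * r = Fintype.card α ^ 2 := by
    rw [← mul_add, pow_two]; congr 1; omega
  have : 0 < Fintype.card α ^ 2 := by positivity
  omega

/-- Columns of elements of `ins` are three quarters full, above the threshold one half. Together
with `spnEst_subset` the estimate is exact on low members. -/
theorem spn_subset_spnEst (hD : IsContainer r K D) {X : Finset α} (hX : Low K X) :
    spn K X ⊆ spnEst r D X := by
  refine Finset.union_subset_union_right fun y hy => ?_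
  have := hD.le_colDeg X hX y hy
  rw [Finset.mem_filter, Finset.mem_compl]
  exact ⟨(mem_ins.1 hy).1, by omega⟩

theorem corEst_subset_cor (hD : IsContainer r K D) {X : Finset α} (hX : Low K X) :
    corEst r D X ⊆ cor K X := by
  refine Finset.sdiff_subset_sdiff subset_rfl fun x hx => ?_
  have := hD.le_rowDeg X hX x hx
  rw [Finset.mem_filter]
  exact ⟨outs_subset _ _ hx, by omega⟩

end IsContainer

/-! ### Linkage classes and their representatives. -/

/-- Low members that share their span or their core. -/
def Link (K : Finset (Finset α)) (X Y : Finset α) : Prop :=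
  Low K X ∧ Low K Y ∧ ((spn K X = spn K Y ∧ (ins K X).Nonempty) ∨
    (cor K X = cor K Y ∧ (outs K X).Nonempty))

/-- The equivalence relation generated by `Link`. -/
abbrev Linked (K : Finset (Finset α)) : Finset α → Finset α → Prop := Relation.EqvGen (Link K)

theorem link_dual {K : Finset (Finset α)} {X Y : Finset α} (h : Link K X Y) :
    Link (dual K) Xᶜ Yᶜ := by
  obtain ⟨h1, h2, h3⟩ := h
  refine ⟨low_dual.2 h1, low_dual.2 h2, ?_⟩
  rw [spn_dual, spn_dual, cor_dual, cor_dual, ins_dual, outs_dual]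
  rcases h3 with ⟨h3, h4⟩ | ⟨h3, h4⟩
  · exact Or.inr ⟨by rw [h3], h4⟩
  · exact Or.inl ⟨by rw [h3], h4⟩

theorem linked_dual {K : Finset (Finset α)} {X Y : Finset α} (h : Linked K X Y) :
    Linked (dual K) Xᶜ Yᶜ := by
  induction h with
  | rel _ _ h => exact .rel _ _ (link_dual h)
  | refl _ => exact .refl _
  | symm _ _ _ ih => exact .symm _ _ ih
  | trans _ _ _ _ _ ih1 ih2 => exact .trans _ _ _ ih1 ih2

theorem linked_dual_iff {K : Finset (Finset α)} {X Y : Finset α} :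
    Linked (dual K) Xᶜ Yᶜ ↔ Linked K X Y := by
  refine ⟨fun h => ?_, linked_dual⟩
  have := linked_dual h
  rwa [dual_dual, compl_compl, compl_compl] at this

theorem Linked.iff_of {K : Finset (Finset α)} {P : Finset α → Prop}
    (hP : ∀ X Y, Link K X Y → (P X ↔ P Y)) {X Y : Finset α} (h : Linked K X Y) : P X ↔ P Y := by
  induction h with
  | rel _ _ h => exact hP _ _ h
  | refl _ => exact Iff.rfl
  | symm _ _ _ ih => exact ih.symm
  | trans _ _ _ _ _ ih1 ih2 => exact ih1.trans ih2

/-- The members of `K` that have a neighbour in `K`. -/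
def big (K : Finset (Finset α)) : Finset (Finset α) :=
  K.filter (fun X => (outs K X).Nonempty ∨ (ins K X).Nonempty)

theorem mem_big {K : Finset (Finset α)} {X : Finset α} :
    X ∈ big K ↔ X ∈ K ∧ ((outs K X).Nonempty ∨ (ins K X).Nonempty) := by
  simp [big]

/-- By `mem_or` a single neighbour already forces a free element; conversely, middle rank guarantees
a partner to exchange a free element with. -/
theorem IsSys.mem_big_iff {r : ℕ} {K : Finset (Finset α)} (hK : IsSys r K) (hr : Mid α r)
    {X : Finset α} : X ∈ big K ↔ X ∈ K ∧ ∃ Y ∈ K, Adj X Y := by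
  rw [mem_big]
  refine and_congr_right fun hX => ?_
  obtain ⟨h1, h2, h3⟩ := hr
  have hc := hK.card_eq X hX
  constructor
  · rintro (⟨x, hx⟩ | ⟨y, hy⟩)
    · obtain ⟨y, hy⟩ : ∃ y, y ∉ X := by
        by_contra! h
        rw [Finset.eq_univ_iff_forall.2 h, Finset.card_univ] at hc
        omega
      rw [mem_outs] at hx
      exact ⟨_, hx.2 y hy, x, hx.1, y, hy, rfl⟩
    · obtain ⟨x, hx⟩ := Finset.card_pos.1 (show 0 < X.card by omega)
      rw [mem_ins] at hy
      exact ⟨_, hy.2 x hx, x, hx, y, hy.1, rfl⟩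
  · rintro ⟨Y, hY, x, hx, y, hy, rfl⟩
    rcases hK.mem_or X hX x hx y hy hY with h | h
    · exact Or.inl ⟨x, h⟩
    · exact Or.inr ⟨y, h⟩

theorem IsSys.link_mem_big {r : ℕ} {K : Finset (Finset α)} (hK : IsSys r K) {X Y : Finset α}
    (h : Link K X Y) : X ∈ big K ∧ Y ∈ big K := by
  obtain ⟨h1, h2, h3⟩ := h
  rw [mem_big, mem_big]
  refine ⟨⟨h1.1, ?_⟩, h2.1, ?_⟩
  · exact h3.elim (fun h => Or.inr h.2) fun h => Or.inl h.2
  · rcases h3 with ⟨h, h'⟩ | ⟨h, h'⟩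
    · rw [← Finset.card_pos, ← hK.card_ins_eq h1.1 h2.1 h.symm, Finset.card_pos] at h'
      exact Or.inr h'
    · rw [← Finset.card_pos, ← hK.card_outs_eq h1.1 h2.1 h.symm, Finset.card_pos] at h'
      exact Or.inl h'

/-- Representatives of the linkage classes of low sets that avoid `D`. -/
structure IsReps (K D R : Finset (Finset α)) : Prop where
  low : ∀ X ∈ R, Low K X
  free : ∀ X ∈ R, ∀ Y, Linked K X Y → Y ∉ D
  sep : ∀ X ∈ R, ∀ Y ∈ R, Linked K X Y → X = Y
  cover : ∀ X, Low K X → (∃ Y ∈ R, Linked K X Y) ∨ ∃ Y ∈ D, Linked K X Y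

theorem IsReps.dual {K D R : Finset (Finset α)} (h : IsReps K D R) :
    IsReps (dual K) (dual D) (dual R) where
  low X hX := by
    rw [← compl_compl X, low_dual]; exact h.low _ (mem_dual.1 hX)
  free X hX Y hXY := by
    rw [mem_dual]
    exact h.free _ (mem_dual.1 hX) _ (by rwa [← linked_dual_iff, compl_compl, compl_compl])
  sep X hX Y hY hXY := compl_injective <| h.sep _ (mem_dual.1 hX) _ (mem_dual.1 hY)
    (by rwa [← linked_dual_iff, compl_compl, compl_compl])
  cover X hX := by
    rw [← compl_compl X, low_dual] at hX
    rcases h.cover _ hX with ⟨Y, hY, hXY⟩ | ⟨Y, hY, hXY⟩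
    · refine Or.inl ⟨Yᶜ, compl_mem_dual.2 hY, ?_⟩
      rwa [← linked_dual_iff, compl_compl] at hXY
    · refine Or.inr ⟨Yᶜ, compl_mem_dual.2 hY, ?_⟩
      rwa [← linked_dual_iff, compl_compl] at hXY

theorem exists_isReps (K D : Finset (Finset α)) : ∃ R, IsReps K D R := by
  classical
  let s : Setoid (Finset α) := Relation.EqvGen.setoid (Link K)
  have hout : ∀ X, Linked K X (Quotient.mk s X).out := fun X =>
    Setoid.symm (Quotient.mk_out (s := s) X)
  refine ⟨Finset.univ.filter fun X => Low K X ∧ (∀ Y, Linked K X Y → Y ∉ D) ∧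
    (Quotient.mk s X).out = X, ?_, ?_, ?_, ?_⟩
  · intro X hX; exact (Finset.mem_filter.1 hX).2.1
  · intro X hX; exact (Finset.mem_filter.1 hX).2.2.1
  · intro X hX Y hY hXY
    rw [← (Finset.mem_filter.1 hX).2.2.2, ← (Finset.mem_filter.1 hY).2.2.2]
    congr 1
    exact Quotient.sound (s := s) hXY
  · intro X hX
    by_cases hf : ∃ Y ∈ D, Linked K X Y
    · exact Or.inr hf
    · refine Or.inl ⟨_, ?_, hout X⟩
      push Not at hf
      rw [Finset.mem_filter]
      refine ⟨Finset.mem_univ _, ?_, fun Y hY hYD => hf Y hYD (.trans _ _ _ (hout X) hY), ?_⟩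
      -- Lowness is constant on classes because `Link` relates low sets only.
      · exact (Linked.iff_of (fun X Y h => iff_of_true h.1 h.2.1) (hout X)).1 hX
      · rw [Quotient.out_eq]

section Complete

variable {r : ℕ} {K D J : Finset (Finset α)} {e : α}

/-- For a low set the estimates err in no harmful direction: `down` reaches everything inside the
true span and `up` everything above the true core. -/
theorem der_of_link (hK : IsSys r K) (hr : Mid α r) (hD : IsContainer r K D) {X Y : Finset α}
    (h : Link K X Y) : Der r D J e X ↔ Der r D J e Y := by
  have key : ∀ {X Y : Finset α}, Low K X → Low K Y → (spn K X = spn K Y ∨ cor K X = cor K Y) →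
      Der r D J e X → Der r D J e Y := by
    intro X Y h1 h2 h3 hX
    rcases h3 with h3 | h3
    · refine .down hX (hD.deg_lt_of_low hK hr h1) (hK.card_eq _ h2.1) ?_
      exact ((subset_spn K Y).trans h3.symm.subset).trans (hD.spn_subset_spnEst h1)
    · refine .up hX (hD.deg_lt_of_low hK hr h1) (hK.card_eq _ h2.1) ?_
      exact (hD.corEst_subset_cor h1).trans (h3.subset.trans (cor_subset K Y))
  obtain ⟨h1, h2, h3⟩ := h
  have h4 := h3.imp And.left And.left
  exact ⟨key h1 h2 h4, key h2 h1 (h4.imp Eq.symm Eq.symm)⟩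

theorem der_of_mem (hK : IsSys r K) (hr : Mid α r) (hD : IsContainer r K D)
    {R : Finset (Finset α)} (hR : IsReps K D R) {X : Finset α} (hX : X ∈ K)
    (h : ∀ Y ∈ R, Linked K X Y → Der r D J e Y) : Der r D J e X := by
  by_cases hl : Low K X
  · rcases hR.cover X hl with ⟨Y, hY, hXY⟩ | ⟨Y, hY, hXY⟩
    · exact (Linked.iff_of (fun _ _ => der_of_link hK hr hD) hXY).2 (h Y hY hXY)
    · exact (Linked.iff_of (fun _ _ => der_of_link hK hr hD) hXY).2 (.of_mem_left hY)
  · exact .of_mem_left (hD.mem_of_not_low X hX hl)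

/-- The container and the representatives in `big K` determine `big K`. -/
theorem mem_big_iff_der (hK : IsSys r K) (hr : Mid α r) (hD : IsContainer r K D)
    {R : Finset (Finset α)} (hR : IsReps K D R) (e : α) {X : Finset α} :
    X ∈ big K ↔ Der r D (R ∩ big K) e X ∧ ∃ Y, Der r D (R ∩ big K) e Y ∧ Adj X Y := by
  have hs : ∀ {X}, Der r D (R ∩ big K) e X → X ∈ K := by
    intro X hX
    refine hD.mem_of_der hK hr (fun Y hY => (hR.low Y (Finset.mem_inter.1 hY).1).1) ?_ hX
    -- The rule `lift` is void here, since representatives avoid `D`.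
    intro v hv hvD
    exact absurd hvD (hR.free v (Finset.mem_inter.1 hv).1 v (.refl _))
  have hc : ∀ {X}, X ∈ big K → Der r D (R ∩ big K) e X := by
    intro X hX
    refine der_of_mem hK hr hD hR (mem_big.1 hX).1 fun Y hY hXY => ?_
    refine .of_mem_right (Finset.mem_inter.2 ⟨hY, ?_⟩)
    exact (Linked.iff_of (fun _ _ h => iff_of_true (hK.link_mem_big h).1
      (hK.link_mem_big h).2) hXY).1 hX
  -- Nothing keeps isolated members of `K` out of `D`, so being derived is not enough and a derived
  -- neighbour is required.
  constructor
  · intro hX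
    obtain ⟨hXK, Y, hY, hXY⟩ := (hK.mem_big_iff hr).1 hX
    exact ⟨hc hX, Y, hc ((hK.mem_big_iff hr).2 ⟨hY, X, hXK, hXY.symm⟩), hXY⟩
  · rintro ⟨hX, Y, hY, hXY⟩
    exact (hK.mem_big_iff hr).2 ⟨hs hX, Y, hs hY, hXY⟩

end Complete

end Johnson

/-! ### Moving representatives into the container. -/

namespace Johnson

variable {α : Type*} [DecidableEq α] [Fintype α]

/-- The representatives for which exchanging `e` for the chosen element of the span leads
into `D`. -/
def active (K D R : Finset (Finset α)) (f : Finset α → α) (e : α) : Finset (Finset α) :=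
  R.filter (fun X => f X ∈ ins K X ∧ e ∈ cor K X ∧ sw X e (f X) ∈ D)

theorem mem_active {K D R : Finset (Finset α)} {f : Finset α → α} {e : α} {X : Finset α} :
    X ∈ active K D R f e ↔ X ∈ R ∧ f X ∈ ins K X ∧ e ∈ cor K X ∧ sw X e (f X) ∈ D := by
  simp [active]

/-- The representatives, with those in `S` moved into `D`. -/
def moved (R S : Finset (Finset α)) (f : Finset α → α) (e : α) : Finset (Finset α) :=
  (R \ S) ∪ S.image (fun X => sw X e (f X))

section Moves

variable {r : ℕ} {K D R : Finset (Finset α)} {f : Finset α → α} {e : α}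

theorem linked_of_spn (hR : IsReps K D R) {X Y : Finset α} (hX : X ∈ R)
    (hY : Y ∈ R) (hi : (ins K X).Nonempty) (h : spn K X = spn K Y) : X = Y :=
  hR.sep X hX Y hY (.rel _ _ ⟨hR.low X hX, hR.low Y hY, Or.inl ⟨h, hi⟩⟩)

/-- The moved set has the span of `X`. If it were low it would be linked to `X`, whose class avoids
`D`; as `ins` keeps its size, it must be `outs` that is too large. -/
theorem card_lt_outs_of_active (hK : IsSys r K) (hr : Mid α r) (hR : IsReps K D R)
    {X : Finset α} (hX : X ∈ active K D R f e) :
    Fintype.card α < 64 * (outs K (sw X e (f X))).card := by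
  obtain ⟨hXR, hy, he, hD⟩ := mem_active.1 hX
  have hl := hR.low X hXR
  have hnd := hK.nondeep_of_low hr hl
  have h1 := hK.nondeep_sw_ins hnd he hy
  have h2 := hK.spn_sw_ins hnd he hy
  by_contra hc
  refine hR.free X hXR _ (.rel _ _ ⟨hl, ⟨h1.1, not_lt.1 hc, ?_⟩, Or.inl ⟨h2.symm, _, hy⟩⟩) hD
  rw [hK.card_ins_eq hl.1 h1.1 h2]
  exact hl.2.2

/-- An exchange inside `K` preserves the core or the span. The former is excluded because the moved
set has many free elements and `Y` few, the latter because `X` and `Y` would be linked. -/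
theorem not_adj_of_active (hK : IsSys r K) (hr : Mid α r) (hR : IsReps K D R)
    {X Y : Finset α} (hX : X ∈ active K D R f e) (hY : Y ∈ R) (hXY : X ≠ Y) :
    ¬ Adj (sw X e (f X)) Y := by
  obtain ⟨hXR, hy, he, hD⟩ := mem_active.1 hX
  have hl := hR.low X hXR
  have hnd := hK.nondeep_of_low hr hl
  have h1 := hK.nondeep_sw_ins hnd he hy
  have h2 := hK.spn_sw_ins hnd he hy
  have h3 := card_lt_outs_of_active hK hr hR hX
  have hlY := hR.low Y hY
  have hndY := hK.nondeep_of_low hr hlY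
  rintro ⟨p, hp, q, hq, hYv⟩
  have hYK : sw (sw X e (f X)) p q ∈ K := hYv ▸ hlY.1
  rcases hK.mem_or _ h1.1 p hp q hq hYK with h4 | h4
  · have h5 : cor K (sw X e (f X)) ⊆ Y := fun w hw => by
      rw [mem_cor] at hw
      rw [hYv, mem_sw]
      exact Or.inr ⟨by rintro rfl; exact hw.2 h4, hw.1⟩
    have h6 := hK.card_outs_eq h1.1 hlY.1 (hK.cor_eq h1 hndY h5)
    have := hlY.2.1
    omega
  · have h5 : Y ⊆ spn K (sw X e (f X)) := fun w hw => by
      rw [hYv, mem_sw] at hw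
      rw [mem_spn]
      rcases hw with rfl | hw
      · exact Or.inr h4
      · exact Or.inl hw.2
    have h6 := hK.spn_eq h1 hndY h5
    exact hXY (linked_of_spn hR hXR hY ⟨_, hy⟩ (by rw [h6, h2]))

/-- Write y, y' for the inserted elements and T = X+y, T' = X'+y'. As both moves remove the same e,
adjacency means that T' arises from T by exchanging some p ≠ e for some q ≠ e. The r-set Q = T-p
lies in both spans, which differ, so Q is deep. Then Q-y'+p has the span of `X` and the core of
`X'`; it is low and links the two representatives, a contradiction. -/
theorem not_adj_active (hK : IsSys r K) (hr : Mid α r) (hR : IsReps K D R)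
    {X X' : Finset α} (hX : X ∈ active K D R f e) (hX' : X' ∈ active K D R f e) :
    ¬ Adj (sw X e (f X)) (sw X' e (f X')) := by
  rcases eq_or_ne X X' with rfl | hXX
  · exact fun h => h.ne rfl
  obtain ⟨hXR, hy, he, hD⟩ := mem_active.1 hX
  obtain ⟨hXR', hy', he', hD'⟩ := mem_active.1 hX'
  have hl := hR.low X hXR
  have hl' := hR.low X' hXR'
  have hnd := hK.nondeep_of_low hr hl
  have hnd' := hK.nondeep_of_low hr hl'
  have h1 := hK.nondeep_sw_ins hnd he hy
  have h2 := hK.spn_sw_ins hnd he hy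
  have h1' := hK.nondeep_sw_ins hnd' he' hy'
  have h2' := hK.spn_sw_ins hnd' he' hy'
  have hne : spn K X ≠ spn K X' := fun h => hXX (linked_of_spn hR hXR hXR' ⟨_, hy⟩ h)
  generalize hyd : f X = y at *
  generalize hyd' : f X' = y' at *
  have heX := cor_subset _ _ he
  have heX' := cor_subset _ _ he'
  have hyX := (mem_ins.1 hy).1
  have hyX' := (mem_ins.1 hy').1
  rintro ⟨p, hp, q, hq, hv⟩
  have hq' : q ∈ sw X' e y' := by rw [hv]; simp [mem_sw]
  have hvK : sw (sw X e y) p q ∈ K := hv ▸ h1'.1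
  have hsp : insert y X ⊆ spn K X := by
    intro w hw
    rw [mem_spn]
    rcases Finset.mem_insert.1 hw with rfl | hw
    · exact Or.inr hy
    · exact Or.inl hw
  have hsp' : insert y' X' ⊆ spn K X' := by
    intro w hw
    rw [mem_spn]
    rcases Finset.mem_insert.1 hw with rfl | hw
    · exact Or.inr hy'
    · exact Or.inl hw
  have hpX : p ∈ insert y X ∧ p ≠ e := by
    rw [mem_sw] at hp
    rw [Finset.mem_insert]
    rcases hp with rfl | hp
    · exact ⟨Or.inl rfl, by rintro rfl; exact hyX heX⟩
    · exact ⟨Or.inr hp.2, hp.1⟩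
  have hqX' : q ∈ insert y' X' ∧ q ≠ e := by
    rw [mem_sw] at hq'
    rw [Finset.mem_insert]
    rcases hq' with rfl | hq'
    · exact ⟨Or.inl rfl, by rintro rfl; exact hyX' heX'⟩
    · exact ⟨Or.inr hq'.2, hq'.1⟩
  have hqX : q ∉ insert y X := by
    intro h
    apply hq
    rw [Finset.mem_insert] at h
    rw [mem_sw]
    exact h.imp id fun h => ⟨hqX'.2, h⟩
  have hTT : ∀ w, w ∈ insert y' X' ↔ w = q ∨ (w ≠ p ∧ w ∈ insert y X) := by
    intro w
    have := congrArg (w ∈ ·) hv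
    simp only [mem_sw, eq_iff_iff] at this
    simp only [Finset.mem_insert]
    by_cases hwe : w = e
    · subst hwe
      simp [heX, heX', hpX.2.symm]
    · simp only [hwe, ne_eq, not_false_eq_true, true_and] at this
      exact this
  set T := insert y X with hT
  set T' := insert y' X' with hT'
  have hXr := hK.card_eq _ hnd.1
  have hTr : (T.erase p).card = r := by
    rw [Finset.card_erase_of_mem hpX.1, hT, Finset.card_insert_of_notMem hyX, hXr]; rfl
  have hRT' : T.erase p ⊆ T' := fun w hw => by
    rw [Finset.mem_erase] at hw
    exact (hTT w).2 (Or.inr hw)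
  have hpT' : p ∉ T' := by
    rw [hTT]; rintro (rfl | h)
    · exact hqX hpX.1
    · exact h.1 rfl
  set Q := T.erase p with hQ
  have hQK : Q ∈ K :=
    hK.of_subset_spn X hnd Q hTr ((Finset.erase_subset _ _).trans hsp)
  have hQdeep : ¬ Nondeep K Q := by
    intro h
    have h3 := hK.spn_eq hnd h ((Finset.erase_subset _ _).trans hsp)
    have h4 := hK.spn_eq hnd' h (hRT'.trans hsp')
    exact hne (h3.symm.trans h4)
  have hQsw : ∀ a ∈ Q, ∀ b, b ∉ Q → sw Q a b ∈ K := by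
    intro a ha b hb
    by_contra h
    exact hQdeep ⟨hQK, a, ha, b, hb, h⟩
  -- Otherwise `Q` would be `X`, which is nondeep.
  have hyp : y ≠ p := by
    rintro rfl
    apply hQdeep
    rwa [hQ, hT, Finset.erase_insert hyX]
  have hyq : y' ≠ q := by
    rintro rfl
    apply hQdeep
    have : X' = Q := by
      ext w
      have := hTT w
      rw [hT', Finset.mem_insert] at this
      rw [hQ, Finset.mem_erase]
      by_cases hw : w = y'
      · subst hw
        simp only [hyX', hqX, and_false]
      · simpa [hw] using this
    rwa [← this]
  have hyQ : y ∈ Q := Finset.mem_erase.2 ⟨hyp, Finset.mem_insert_self _ _⟩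
  have hyQ' : y' ∈ Q :=
    Finset.mem_erase.2 (((hTT y').1 (Finset.mem_insert_self _ _)).resolve_left hyq)
  have hpQ : p ∉ Q := by simp [hQ]
  have hqQ : q ∉ Q := fun h => hqX (Finset.mem_of_mem_erase h)
  have hqp : q ≠ p := by rintro rfl; exact hqX hpX.1
  have hXeq : ∀ w, w ∈ X ↔ w = p ∨ (w ≠ y ∧ w ∈ Q) := by
    intro w
    rw [hQ, Finset.mem_erase, hT, Finset.mem_insert]
    by_cases hwp : w = p
    · subst hwp
      simpa [hyp.symm, hT] using hpX.1
    · by_cases hwy : w = y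
      · subst hwy; simp [hwp, hyX]
      · simp [hwp, hwy]
  have hXeq' : ∀ w, w ∈ X' ↔ w = q ∨ (w ≠ y' ∧ w ∈ Q) := by
    intro w
    have h3 := hTT w
    rw [hT', Finset.mem_insert] at h3
    rw [hQ, Finset.mem_erase]
    by_cases hwy : w = y'
    · subst hwy; simp [hyX', hyq]
    · simpa [hwy] using h3
  -- Exchanging q in `X'` gives either `Q` or a neighbour of the deep set `Q`.
  have hqo : q ∈ outs K X' := by
    rw [mem_outs]
    refine ⟨(hXeq' q).2 (Or.inl rfl), fun z hz => ?_⟩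
    rw [hXeq', not_or, not_and] at hz
    by_cases hzy : z = y'
    · have : sw X' q z = Q := by
        ext w
        rw [mem_sw, hXeq', hzy]
        by_cases hw : w = y'
        · simp [hw, hyQ']
        · by_cases hw' : w = q
          · simp [hw', hqQ, hyq.symm]
          · simp [hw, hw']
      rwa [this]
    · have : sw X' q z = sw Q y' z := by
        ext w
        rw [mem_sw, mem_sw, hXeq']
        by_cases hw' : w = q
        · simp [hw', hqQ]
        · simp [hw']
      rw [this]
      exact hQsw y' hyQ' z (hz.2 hzy)
  have hpspn : p ∉ spn K X' := by
    intro h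
    have : X ⊆ spn K X' := fun w hw => by
      rcases (hXeq w).1 hw with rfl | hw
      · exact h
      · exact hsp' (hRT' hw.2)
    exact hne (hK.spn_eq hnd' hnd this)
  have hZK : sw Q y' p ∈ K := hQsw y' hyQ' p hpQ
  have hcsub : cor K X' ⊆ sw Q y' p := by
    intro w hw
    rw [mem_cor, hXeq'] at hw
    rw [mem_sw]
    rcases hw.1 with rfl | h
    · exact absurd hqo hw.2
    · exact Or.inr h
  obtain ⟨⟨w, hw⟩, -⟩ := IsSys.exists_cor_spn hnd'
  have hZnd : Nondeep K (sw Q y' p) := by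
    refine ⟨hZK, w, hcsub hw, q, ?_, ?_⟩
    · simp [mem_sw, hqp, hqQ]
    · have : sw (sw Q y' p) w q = sw X' w p := by
        have hwp : w ≠ p := by rintro rfl; exact hpspn (subset_spn _ _ (cor_subset _ _ hw))
        have hwq : w ≠ q := by rintro rfl; exact (mem_cor.1 hw).2 hqo
        ext z
        simp only [mem_sw, hXeq']
        by_cases hzq : z = q
        · subst hzq; simp [hwq.symm]
        · by_cases hzp : z = p
          · subst hzp; simp [hwp.symm]
          · simp [hzq, hzp]
      rw [this]
      exact hK.sw_notMem hnd'.1 hw hpspn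
  have hs := hK.spn_eq hnd hZnd (fun z hz => by
    rw [mem_sw] at hz
    rcases hz with rfl | hz
    · exact hsp hpX.1
    · exact hsp (Finset.mem_of_mem_erase hz.2))
  have hc := hK.cor_eq hnd' hZnd hcsub
  -- One count is inherited from `X'` through the common core, the other from `X` through the common
  -- span.
  have hZl : Low K (sw Q y' p) := by
    refine ⟨hZK, ?_, ?_⟩
    · rw [hK.card_outs_eq hnd'.1 hZK hc]; exact hl'.2.1
    · rw [hK.card_ins_eq hnd.1 hZK hs]; exact hl.2.2
  refine hXX (hR.sep X hXR X' hXR' (.trans _ (sw Q y' p) _ (.rel _ _ ?_) (.symm _ _ (.rel _ _ ?_))))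
  · exact ⟨hl, hZl, Or.inl ⟨hs.symm, y, hy⟩⟩
  · exact ⟨hl', hZl, Or.inr ⟨hc.symm, q, hqo⟩⟩

theorem not_adj_reps (hK : IsSys r K) (hr : Mid α r) (hR : IsReps K D R)
    {X Y : Finset α} (hX : X ∈ R) (hY : Y ∈ R) : ¬ Adj X Y := by
  intro h
  refine h.ne (hR.sep X hX Y hY (.rel _ _ ?_))
  have hl := hR.low X hX
  have hl' := hR.low Y hY
  have hnd := hK.nondeep_of_low hr hl
  have hnd' := hK.nondeep_of_low hr hl'
  refine ⟨hl, hl', ?_⟩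
  obtain ⟨x, hx, y, hy, rfl⟩ := h
  rcases hK.mem_or X hl.1 x hx y hy hl'.1 with h | h
  · refine Or.inr ⟨(hK.cor_eq hnd hnd' fun w hw => ?_).symm, x, h⟩
    rw [mem_cor] at hw
    exact mem_sw.2 (Or.inr ⟨by rintro rfl; exact hw.2 h, hw.1⟩)
  · refine Or.inl ⟨(hK.spn_eq hnd hnd' fun w hw => ?_).symm, y, h⟩
    rw [mem_spn]
    rcases mem_sw.1 hw with rfl | hw
    · exact Or.inr h
    · exact Or.inl hw.2

theorem stable_moved (hK : IsSys r K) (hr : Mid α r) (hR : IsReps K D R)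
    {S : Finset (Finset α)} (hS : S ⊆ active K D R f e) : Stable (moved R S f e) := by
  intro X hX Y hY
  rw [moved, Finset.mem_union, Finset.mem_sdiff, Finset.mem_image] at hX hY
  rcases hX with hX | ⟨X, hX, rfl⟩ <;> rcases hY with hY | ⟨Y, hY, rfl⟩
  · exact not_adj_reps hK hr hR hX.1 hY.1
  · refine fun h => not_adj_of_active hK hr hR (hS hY) hX.1 ?_ h.symm
    rintro rfl; exact hX.2 hY
  · refine not_adj_of_active hK hr hR (hS hX) hY.1 ?_
    rintro rfl; exact hY.2 hX
  · exact not_adj_active hK hr hR (hS hX) (hS hY)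

/-- Membership in `D` marks the moved sets, because untouched representatives avoid `D`. This makes
the moves readable from the outcome. -/
theorem moved_inter (hR : IsReps K D R) {S : Finset (Finset α)} (hS : S ⊆ active K D R f e) :
    moved R S f e ∩ D = S.image (fun X => sw X e (f X)) := by
  ext X
  simp only [moved, Finset.mem_inter, Finset.mem_union, Finset.mem_sdiff, Finset.mem_image]
  constructor
  · rintro ⟨h | h, hD⟩
    · exact absurd hD (hR.free X h.1 X (.refl _))
    · exact h
  · rintro ⟨Y, hY, rfl⟩
    exact ⟨Or.inr ⟨Y, hY, rfl⟩, (mem_active.1 (hS hY)).2.2.2⟩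

/-- A move keeps the span, and representatives with nonempty `ins` are determined by their spans. -/
theorem injOn_move (hK : IsSys r K) (hr : Mid α r) (hR : IsReps K D R) :
    Set.InjOn (fun X => sw X e (f X)) (active K D R f e : Set (Finset α)) := by
  intro X hX Y hY hXY
  obtain ⟨hXR, hy, he, -⟩ := mem_active.1 hX
  obtain ⟨hYR, hy', he', -⟩ := mem_active.1 hY
  have h1 := hK.spn_sw_ins (hK.nondeep_of_low hr (hR.low X hXR)) he hy
  have h2 := hK.spn_sw_ins (hK.nondeep_of_low hr (hR.low Y hYR)) he' hy'
  refine linked_of_spn hR hXR hYR ⟨_, hy⟩ ?_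
  rw [← h1, ← h2]
  exact congrArg (spn K) hXY

theorem moved_injective (hK : IsSys r K) (hr : Mid α r) (hR : IsReps K D R)
    {S S' : Finset (Finset α)} (hS : S ⊆ active K D R f e) (hS' : S' ⊆ active K D R f e)
    (h : moved R S f e = moved R S' f e) : S = S' := by
  have h1 : S.image (fun X => sw X e (f X)) = S'.image (fun X => sw X e (f X)) := by
    rw [← moved_inter hR hS, ← moved_inter hR hS', h]
  refine Finset.coe_injective ((injOn_move hK hr hR).image_eq_image_iff
    (Finset.coe_subset.2 hS) (Finset.coe_subset.2 hS') |>.1 ?_)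
  rw [← Finset.coe_image, ← Finset.coe_image, h1]

/-- Any of the moved systems of representatives determines the family. -/
theorem der_moved_iff (hK : IsSys r K) (hr : Mid α r) (hD : IsContainer r K D)
    (hR : IsReps K D R) {S : Finset (Finset α)} (hS : S ⊆ active K D R f e) (X : Finset α) :
    Der r D (moved R S f e) e X ↔ X ∈ K := by
  have hins : ∀ Y ∈ S, insert e (sw Y e (f Y)) = insert (f Y) Y := by
    intro Y hY
    obtain ⟨-, hy, he, -⟩ := mem_active.1 (hS hY)
    have := cor_subset _ _ he
    ext w
    simp only [Finset.mem_insert, mem_sw]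
    by_cases hw : w = e
    · simp [hw, this]
    · simp [hw]
  constructor
  · refine fun h => hD.mem_of_der hK hr ?_ ?_ h
    · intro Y hY
      rw [moved, Finset.mem_union, Finset.mem_sdiff, Finset.mem_image] at hY
      rcases hY with hY | ⟨Y, hY, rfl⟩
      · exact (hR.low Y hY.1).1
      · exact hD.subset (mem_active.1 (hS hY)).2.2.2
    · intro v hv hvD x hx
      have : v ∈ S.image (fun X => sw X e (f X)) := by
        rw [← moved_inter hR hS]; exact Finset.mem_inter.2 ⟨hv, hvD⟩
      obtain ⟨Y, hY, rfl⟩ := Finset.mem_image.1 this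
      obtain ⟨hYR, hy, he, -⟩ := mem_active.1 (hS hY)
      rw [hins Y hY] at hx ⊢
      have hl := (hR.low Y hYR).1
      rcases Finset.mem_insert.1 hx with rfl | hx
      · rwa [Finset.erase_insert (mem_ins.1 hy).1]
      · rw [← sw_insert_erase (mem_ins.1 hy).1 hx]
        exact (mem_ins.1 hy).2 x hx
  · intro hX
    refine der_of_mem hK hr hD hR hX fun Y hY _ => ?_
    by_cases hYS : Y ∈ S
    · have h1 : sw Y e (f Y) ∈ moved R S f e :=
        Finset.mem_union_right _ (Finset.mem_image_of_mem _ hYS)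
      obtain ⟨hYR, hy, he, hvD⟩ := mem_active.1 (hS hYS)
      -- Adding e to the moved set restores `Y` together with `f Y`; deleting `f Y` recovers `Y`.
      have := Der.lift (r := r) (e := e) (f Y) h1 hvD
        (by rw [hins Y hYS]; exact Finset.mem_insert_self _ _)
      rwa [hins Y hYS, Finset.erase_insert (mem_ins.1 hy).1] at this
    · exact .of_mem_right (Finset.mem_union_left _ (Finset.mem_sdiff.2 ⟨hY, hYS⟩))

/-- Some element `e` makes at least an eighth of the candidates active. -/
theorem exists_card_active (hr : Mid α r) (hD : IsContainer r K D)
    (hR : IsReps K D R) (hf : ∀ X ∈ R, (ins K X).Nonempty → f X ∈ ins K X) :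
    ∃ e, (R.filter (fun X => (ins K X).Nonempty)).card ≤ 8 * (active K D R f e).card := by
  have hn : 0 < Fintype.card α := hr.2.2
  have : Nonempty α := Fintype.card_pos_iff.1 hn
  by_contra! hc
  set R' := R.filter (fun X => (ins K X).Nonempty) with hR'
  have h1 : ∑ e : α, 8 * (active K D R f e).card < ∑ e : α, R'.card :=
    Finset.sum_lt_sum_of_nonempty Finset.univ_nonempty fun e _ => hc e
  have h2 : ∑ e : α, (active K D R f e).card =
      ∑ X ∈ R', ((cor K X).filter (fun e => sw X e (f X) ∈ D)).card := by
    rw [← Finset.card_sigma, ← Finset.card_sigma]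
    refine Finset.card_bij' (fun p _ => ⟨p.2, p.1⟩) (fun p _ => ⟨p.2, p.1⟩) ?_ ?_ ?_ ?_
    · rintro ⟨e, X⟩ h
      simp only [Finset.mem_sigma, Finset.mem_univ, true_and, mem_active, Finset.mem_filter,
        hR'] at h ⊢
      exact ⟨⟨h.1, _, h.2.1⟩, h.2.2⟩
    · rintro ⟨X, e⟩ h
      simp only [Finset.mem_sigma, Finset.mem_univ, true_and, mem_active, Finset.mem_filter,
        hR'] at h ⊢
      exact ⟨h.1.1, hf X h.1.1 h.1.2, h.2⟩
    · simp
    · simp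
  -- The column of `f X` has at least 3r/4 ≥ 3n/16 entries in `D`, of which at most n/64 come from
  -- outside the core; at least n/8 remain. Averaging over e then gives the claim.
  have h3 : ∀ X ∈ R', Fintype.card α ≤
      8 * ((cor K X).filter (fun e => sw X e (f X) ∈ D)).card := by
    intro X hX
    rw [hR', Finset.mem_filter] at hX
    have hl := hR.low X hX.1
    have h4 := hD.le_colDeg X hl _ (hf X hX.1 hX.2)
    have h5 : X.filter (fun x => sw X x (f X) ∈ D) ⊆
        (cor K X).filter (fun e => sw X e (f X) ∈ D) ∪ outs K X := by
      intro x hx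
      rw [Finset.mem_filter] at hx
      rw [Finset.mem_union, Finset.mem_filter, mem_cor]
      tauto
    have h6 := (Finset.card_le_card h5).trans (Finset.card_union_le _ _)
    have h7 := hl.2.1
    have h8 := hr.1
    rw [colDeg] at h4
    omega
  have h4 := Finset.sum_le_sum h3
  rw [← Finset.mul_sum, h2, Finset.mul_sum] at h1
  rw [Finset.sum_const, Finset.card_univ, smul_eq_mul] at h1
  rw [Finset.sum_const, smul_eq_mul] at h4
  rw [← Finset.mul_sum] at h4 h1
  nlinarith

end Moves

end Johnson

/-! ### Greedy domination. -/

namespace Johnson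

/-- Greedy domination: few members of `B` dominate all but a small part of `A`. -/
theorem exists_dominating {β γ : Type*} [DecidableEq γ] (rel : β → γ → Prop)
    [∀ a, DecidablePred (rel a)] (A : Finset β) (B : Finset γ) {d : ℕ} (hd : 0 < d)
    (h : ∀ a ∈ A, d ≤ (B.filter (rel a)).card) (k : ℕ) :
    ∃ S ⊆ B, S.card ≤ k ∧ (A.filter (fun a => ∀ b ∈ S, ¬ rel a b)).card * B.card ^ k ≤
      A.card * (B.card - d) ^ k := by
  induction k with
  | zero => exact ⟨∅, by simp, by simp, by simp⟩
  | succ k ih =>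
    obtain ⟨S, hSB, hSk, hS⟩ := ih
    set A' := A.filter (fun a => ∀ b ∈ S, ¬ rel a b) with hA'
    rcases A'.eq_empty_or_nonempty with hE | ⟨a, ha⟩
    · refine ⟨S, hSB, by omega, ?_⟩
      rw [← hA', hE]; simp
    have hdB : d ≤ B.card := (h a (Finset.mem_filter.1 ha).1).trans
      (Finset.card_le_card (Finset.filter_subset _ _))
    have hsum : ∑ b ∈ B, (A'.filter (fun a => rel a b)).card =
        ∑ a ∈ A', (B.filter (rel a)).card := by
      simp only [Finset.card_filter]
      exact Finset.sum_comm
    have hle : A'.card * d ≤ ∑ b ∈ B, (A'.filter (fun a => rel a b)).card := by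
      rw [hsum, ← smul_eq_mul]
      exact Finset.card_nsmul_le_sum _ _ _ fun a ha => h a (Finset.mem_filter.1 ha).1
    -- By averaging, some b dominates at least the fraction d/|B| of what is still undominated.
    obtain ⟨b, hb, hbd⟩ :
        ∃ b ∈ B, A'.card * d ≤ B.card * (A'.filter (fun a => rel a b)).card := by
      by_contra! hc
      have hBn : B.Nonempty := Finset.card_pos.1 (by omega)
      have h1 : ∑ b ∈ B, B.card * (A'.filter (fun a => rel a b)).card <
          ∑ b ∈ B, A'.card * d :=
        Finset.sum_lt_sum_of_nonempty hBn fun b hb => hc b hb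
      rw [← Finset.mul_sum, Finset.sum_const, smul_eq_mul] at h1
      exact absurd (Nat.lt_of_mul_lt_mul_left h1) (not_lt.2 hle)
    refine ⟨insert b S, Finset.insert_subset hb hSB,
      (Finset.card_insert_le _ _).trans (by omega), ?_⟩
    have h2 : A.filter (fun a => ∀ b' ∈ insert b S, ¬ rel a b') =
        A'.filter (fun a => ¬ rel a b) := by
      ext a
      simp only [hA', Finset.mem_filter, Finset.mem_insert, forall_eq_or_imp]
      tauto
    rw [h2]
    have h3 := Finset.card_filter_add_card_filter_not (s := A') (fun a => rel a b)
    obtain ⟨c, hc⟩ := Nat.exists_eq_add_of_le hdB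
    have h4 : (A'.filter (fun a => ¬ rel a b)).card * B.card ≤ A'.card * (B.card - d) := by
      rw [hc, Nat.add_sub_cancel_left, ← hc]
      nlinarith
    calc _ = ((A'.filter (fun a => ¬ rel a b)).card * B.card) * B.card ^ k := by ring
      _ ≤ A'.card * (B.card - d) * B.card ^ k := by gcongr
      _ = (A'.card * B.card ^ k) * (B.card - d) := by ring
      _ ≤ (A.card * (B.card - d) ^ k) * (B.card - d) := by gcongr
      _ = _ := by ring

/-- A dominating set of logarithmic quality. -/
theorem exists_dominating_real {β : Type*} [DecidableEq β] (rel : β → β → Prop)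
    [∀ a, DecidablePred (rel a)] (A B : Finset β) (hAB : A ⊆ B) (n : ℕ) (hn : 0 < n)
    (h : ∀ a ∈ A, n ^ 2 ≤ 256 * (B.filter (rel a)).card) :
    ∃ S ⊆ B, (∀ a ∈ A, a ∈ S ∨ ∃ b ∈ S, rel a b) ∧
      (S.card : ℝ) * n ^ 2 ≤ 512 * B.card * Real.log n + n ^ 2 + B.card := by
  classical
  have hn' : (0 : ℝ) < (n : ℝ) := by exact_mod_cast hn
  have hn1 : (1 : ℝ) ≤ (n : ℝ) := by exact_mod_cast hn
  have hlog : 0 ≤ Real.log n := Real.log_nonneg hn1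
  obtain ⟨d, hd1, hd2⟩ : ∃ d : ℕ, n ^ 2 ≤ 256 * d ∧ 256 * d < n ^ 2 + 256 :=
    ⟨(n ^ 2 + 255) / 256, by omega, by omega⟩
  have hd : 0 < d := by
    have : 0 < n ^ 2 := by positivity
    omega
  -- As d ≥ n²/256, this many rounds give (1-d/|B|)^k ≤ exp(-2 log n) = n⁻². The at most |A|/n²
  -- leftover elements are simply added.
  set k := ⌈512 * (B.card : ℝ) * Real.log n / n ^ 2⌉₊ with hk
  obtain ⟨S, hSB, hSk, hS⟩ := exists_dominating rel A B hd
    (fun a ha => by have := h a ha; omega) k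
  set A' := A.filter (fun a => ∀ b ∈ S, ¬ rel a b) with hA'
  have hk1 : (k : ℝ) * n ^ 2 ≤ 512 * B.card * Real.log n + n ^ 2 := by
    have h0 : (0 : ℝ) ≤ 512 * (B.card : ℝ) * Real.log n / n ^ 2 := by positivity
    have h1 : (k : ℝ) ≤ 512 * (B.card : ℝ) * Real.log n / n ^ 2 + 1 :=
      (Nat.ceil_lt_add_one h0).le
    calc (k : ℝ) * n ^ 2 ≤ (512 * (B.card : ℝ) * Real.log n / n ^ 2 + 1) * n ^ 2 := by gcongr
      _ = _ := by field_simp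
  have hA1 : (A'.card : ℝ) * n ^ 2 ≤ B.card := by
    rcases A'.eq_empty_or_nonempty with hE | ⟨a, ha⟩
    · rw [hE]; simp
    have hdB : d ≤ B.card := by
      have h1 := h a (Finset.mem_filter.1 ha).1
      have h2 := Finset.card_le_card (Finset.filter_subset (rel a) B)
      omega
    have hB : (0 : ℝ) < B.card := by exact_mod_cast lt_of_lt_of_le hd hdB
    have h1 : (A'.card : ℝ) * (B.card : ℝ) ^ k ≤ A.card * ((B.card : ℝ) - d) ^ k := by
      have : ((A'.card * B.card ^ k : ℕ) : ℝ) ≤ ((A.card * (B.card - d) ^ k : ℕ) : ℝ) :=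
        Nat.cast_le.2 hS
      push_cast [Nat.cast_sub hdB] at this
      exact this
    have h2 : ((B.card : ℝ) - d) ^ k ≤ (B.card : ℝ) ^ k * Real.exp (-(d / B.card)) ^ k := by
      rw [← mul_pow]
      refine pow_le_pow_left₀ (sub_nonneg.2 (by exact_mod_cast hdB)) ?_ _
      have := Real.add_one_le_exp (-((d : ℝ) / B.card))
      calc (B.card : ℝ) - d = B.card * (-((d : ℝ) / B.card) + 1) := by field_simp; ring
        _ ≤ _ := by gcongr
    have h3 : Real.exp (-((d : ℝ) / B.card)) ^ k ≤ ((n : ℝ) ^ 2)⁻¹ := by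
      have h4 : ((n : ℝ) ^ 2)⁻¹ = Real.exp (-(2 * Real.log n)) := by
        rw [Real.exp_neg, two_mul, Real.exp_add, Real.exp_log hn', pow_two]
      rw [← Real.exp_nat_mul, h4, Real.exp_le_exp, mul_neg, neg_le_neg_iff, ← mul_div_assoc,
        le_div_iff₀ hB]
      have h5 : 512 * (B.card : ℝ) * Real.log n / n ^ 2 ≤ k := Nat.le_ceil _
      have h6 : (n : ℝ) ^ 2 / 256 ≤ d := by
        rw [div_le_iff₀ (by norm_num)]
        have : ((n ^ 2 : ℕ) : ℝ) ≤ ((256 * d : ℕ) : ℝ) := Nat.cast_le.2 hd1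
        push_cast at this
        linarith
      calc 2 * Real.log n * B.card
          = 512 * (B.card : ℝ) * Real.log n / n ^ 2 * ((n : ℝ) ^ 2 / 256) := by
            field_simp; ring
        _ ≤ k * d := by gcongr
    have h4 : (A'.card : ℝ) ≤ A.card * ((n : ℝ) ^ 2)⁻¹ := by
      have hBk : (0 : ℝ) < (B.card : ℝ) ^ k := by positivity
      refine le_of_mul_le_mul_right ?_ hBk
      calc _ ≤ _ := h1
        _ ≤ A.card * ((B.card : ℝ) ^ k * ((n : ℝ) ^ 2)⁻¹) := by
          gcongr
          exact h2.trans (by gcongr)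
        _ = _ := by ring
    calc (A'.card : ℝ) * (n : ℝ) ^ 2 ≤ A.card * ((n : ℝ) ^ 2)⁻¹ * (n : ℝ) ^ 2 := by gcongr
      _ = (A.card : ℝ) := by field_simp
      _ ≤ _ := by exact_mod_cast Finset.card_le_card hAB
  refine ⟨S ∪ A', Finset.union_subset hSB ((Finset.filter_subset _ _).trans hAB), ?_, ?_⟩
  · intro a ha
    by_cases hb : ∃ b ∈ S, rel a b
    · obtain ⟨b, hb, hab⟩ := hb
      exact Or.inr ⟨b, Finset.mem_union_left _ hb, hab⟩
    · push Not at hb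
      exact Or.inl (Finset.mem_union_right _ (Finset.mem_filter.2 ⟨ha, hb⟩))
  · have h1 : ((S ∪ A').card : ℝ) ≤ k + A'.card := by
      exact_mod_cast (Finset.card_union_le _ _).trans (by omega)
    calc ((S ∪ A').card : ℝ) * (n : ℝ) ^ 2 ≤ (k + A'.card) * (n : ℝ) ^ 2 := by gcongr
      _ = (k : ℝ) * (n : ℝ) ^ 2 + A'.card * (n : ℝ) ^ 2 := by ring
      _ ≤ _ := by linarith

/-! ### Building blocks, and covering the non-low and the deep members. -/

variable {α : Type*} [DecidableEq α] [Fintype α]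

open Classical in
/-- The building blocks of containers: up-sets, down-sets, and balls. -/
noncomputable def simple (r : ℕ) (p : Fin 3 × Finset α) : Finset (Finset α) :=
  Finset.univ.filter fun Y => Y.card = r ∧ ((p.1 = 0 ∧ p.2 ⊆ Y) ∨ (p.1 = 1 ∧ Y ⊆ p.2) ∨
    (p.1 = 2 ∧ (Y = p.2 ∨ Adj p.2 Y)))

theorem mem_simple {r : ℕ} {p : Fin 3 × Finset α} {Y : Finset α} :
    Y ∈ simple r p ↔ Y.card = r ∧ ((p.1 = 0 ∧ p.2 ⊆ Y) ∨ (p.1 = 1 ∧ Y ⊆ p.2) ∨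
      (p.1 = 2 ∧ (Y = p.2 ∨ Adj p.2 Y))) := by simp [simple]

/-- `D` is a union of at most `k` building blocks. -/
def IsUnion (r k : ℕ) (D : Finset (Finset α)) : Prop :=
  ∃ Z : Finset (Fin 3 × Finset α), Z.card ≤ k ∧ Z.biUnion (simple r) = D

theorem IsUnion.mono {r k l : ℕ} {D : Finset (Finset α)} (h : IsUnion r k D) (hkl : k ≤ l) :
    IsUnion r l D := by
  obtain ⟨Z, h1, h2⟩ := h
  exact ⟨Z, h1.trans hkl, h2⟩

theorem IsUnion.union {r k l : ℕ} {D E : Finset (Finset α)} (h : IsUnion r k D)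
    (h' : IsUnion r l E) : IsUnion r (k + l) (D ∪ E) := by
  obtain ⟨Z, h1, rfl⟩ := h
  obtain ⟨Z', h1', rfl⟩ := h'
  exact ⟨Z ∪ Z', (Finset.card_union_le _ _).trans (by omega), by rw [Finset.union_biUnion]⟩

theorem isUnion_biUnion {β : Type*} [DecidableEq β] {r k : ℕ} (S : Finset β)
    (D : β → Finset (Finset α)) (h : ∀ b ∈ S, IsUnion r k (D b)) :
    IsUnion r (S.card * k) (S.biUnion D) := by
  induction S using Finset.induction_on with
  | empty => exact ⟨∅, by simp, by simp⟩
  | insert b S hb ih =>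
    rw [Finset.biUnion_insert, Finset.card_insert_of_notMem hb, add_mul, one_mul, add_comm]
    exact (h b (Finset.mem_insert_self _ _)).union
      (ih fun b hb => h b (Finset.mem_insert_of_mem hb))

theorem isUnion_simple (r : ℕ) (p : Fin 3 × Finset α) : IsUnion r 1 (simple r p) :=
  ⟨{p}, by simp, by simp⟩

theorem simple_compl {r : ℕ} (hr : r ≤ Fintype.card α) (t : Fin 3) (F : Finset α) :
    simple (Fintype.card α - r) (Equiv.swap 0 1 t, Fᶜ) = dual (simple r (t, F)) := by
  ext Y
  rw [mem_dual, mem_simple, mem_simple]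
  have h1 : Y.card = Fintype.card α - r ↔ Yᶜ.card = r := by
    rw [Finset.card_compl]
    have := Finset.card_le_univ Y
    omega
  have h2 : Fᶜ ⊆ Y ↔ Yᶜ ⊆ F := by
    rw [← Finset.compl_subset_compl, compl_compl]
  have h3 : Y ⊆ Fᶜ ↔ F ⊆ Yᶜ := by
    rw [← Finset.compl_subset_compl, compl_compl]
  have h4 : Y = Fᶜ ↔ Yᶜ = F := by
    constructor
    · rintro rfl; simp
    · rintro rfl; simp
  have h5 : Adj Fᶜ Y ↔ Adj F Yᶜ := by
    constructor
    · intro h; simpa using adj_compl h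
    · intro h; simpa using adj_compl h
  rw [h1]
  refine and_congr_right fun _ => ?_
  have h6 : Equiv.swap (0 : Fin 3) 1 2 = 2 := by decide
  fin_cases t <;> simp [h2, h3, h4, h5, h6]

theorem IsUnion.dual {r k : ℕ} (hr : r ≤ Fintype.card α) {D : Finset (Finset α)}
    (h : IsUnion r k D) : IsUnion (Fintype.card α - r) k (dual D) := by
  obtain ⟨Z, h1, rfl⟩ := h
  refine ⟨Z.image fun p => (Equiv.swap 0 1 p.1, p.2ᶜ), Finset.card_image_le.trans h1, ?_⟩
  ext Y
  rw [mem_dual]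
  simp only [Finset.mem_biUnion, Finset.mem_image]
  constructor
  · rintro ⟨_, ⟨p, hp, rfl⟩, h⟩
    rw [simple_compl hr, mem_dual] at h
    exact ⟨p, hp, h⟩
  · rintro ⟨p, hp, h⟩
    exact ⟨_, ⟨p, hp, rfl⟩, by rwa [simple_compl hr, mem_dual]⟩

theorem sw_injOn (X : Finset α) :
    Set.InjOn (fun p : α × α => sw X p.1 p.2) (X ×ˢ Xᶜ : Finset (α × α)) := by
  rintro ⟨x, y⟩ h ⟨x', y'⟩ h' heq
  simp only [Finset.coe_product, Set.mem_prod, Finset.mem_coe, Finset.mem_compl] at h h'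
  have heq : sw X x y = sw X x' y' := heq
  have h1 : y ∈ sw X x' y' := by rw [← heq]; simp [mem_sw]
  have h2 : x ∉ sw X x' y' := by
    rw [← heq, mem_sw]; rintro (rfl | h3)
    · exact h.2 h.1
    · exact h3.1 rfl
  rw [mem_sw] at h1 h2
  rw [not_or, not_and] at h2
  have h3 : y = y' := h1.resolve_right fun h4 => h.2 h4.2
  have h4 : x = x' := by
    by_contra h5
    exact h2.2 h5 h.1
  rw [h3, h4]

namespace IsSys

variable {r : ℕ} {K : Finset (Finset α)}

/-- Every member of `K` has a cover of its neighbourhood in `K` by two building blocks. -/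
theorem exists_cover (hK : IsSys r K) {X : Finset α} (hX : X ∈ K) :
    ∃ D, IsUnion r 2 D ∧ D ⊆ K ∧ X ∈ D ∧ ∀ Y ∈ K, Adj X Y → Y ∈ D := by
  have hXr := hK.card_eq X hX
  by_cases hnd : Nondeep K X
  · refine ⟨_, (isUnion_simple r (0, cor K X)).union (isUnion_simple r (1, spn K X)),
      ?_, ?_, ?_⟩
    · intro Y hY
      simp only [Finset.mem_union, mem_simple] at hY
      rcases hY with ⟨h1, h2⟩ | ⟨h1, h2⟩
      · exact hK.of_cor_subset X hnd Y h1 (by simpa using h2)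
      · exact hK.of_subset_spn X hnd Y h1 (by simpa using h2)
    · simp [mem_simple, hXr, cor_subset]
    · rintro _ hY ⟨x, hx, y, hy, rfl⟩
      have hYr := hK.card_eq _ hY
      rw [Finset.mem_union, mem_simple, mem_simple]
      rcases hK.mem_or X hX x hx y hy hY with h | h
      · refine Or.inl ⟨hYr, Or.inl ⟨rfl, fun w hw => ?_⟩⟩
        rw [mem_cor] at hw
        exact mem_sw.2 (Or.inr ⟨by rintro rfl; exact hw.2 h, hw.1⟩)
      · refine Or.inr ⟨hYr, Or.inr (Or.inl ⟨rfl, fun w hw => ?_⟩)⟩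
        rw [mem_spn]
        rcases mem_sw.1 hw with rfl | hw
        · exact Or.inr h
        · exact Or.inl hw.2
  · refine ⟨_, (isUnion_simple r (2, X)).mono (by omega), ?_, ?_, ?_⟩
    · intro Y hY
      rw [mem_simple] at hY
      obtain ⟨h1, h2⟩ := hY
      have h3 : Y = X ∨ Adj X Y := by simpa using h2
      rcases h3 with rfl | ⟨x, hx, y, hy, rfl⟩
      · exact hX
      · by_contra h
        exact hnd ⟨hX, x, hx, y, hy, h⟩
    · simp [mem_simple, hXr]
    · intro Y hY hXY
      rw [mem_simple]
      exact ⟨hK.card_eq Y hY, by simp [hXY]⟩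

/-- Different exchanges give different neighbours, and each neighbour in `K` is non-isolated on
account of `X`. -/
theorem deg_le_card_filter (hK : IsSys r K) {X : Finset α} (hX : X ∈ K) (P : Finset (α × α))
    (hP : ∀ p ∈ P, p.1 ∈ X ∧ p.2 ∉ X ∧ sw X p.1 p.2 ∈ K) [DecidablePred (Adj X)]
    (hr : Mid α r) : P.card ≤ ((big K).filter (Adj X)).card := by
  refine Finset.card_le_card_of_injOn (fun p => sw X p.1 p.2) ?_ ((sw_injOn X).mono ?_)
  · intro p hp
    obtain ⟨h1, h2, h3⟩ := hP p hp
    have h4 : Adj X (sw X p.1 p.2) := ⟨_, h1, _, h2, rfl⟩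
    rw [Finset.mem_coe, Finset.mem_filter]
    exact ⟨(hK.mem_big_iff hr).2 ⟨h3, X, hX, h4.symm⟩, h4⟩
  · intro p hp
    obtain ⟨h1, h2, h3⟩ := hP p hp
    simp [h1, h2]

theorem mem_big_of_not_low {X : Finset α} (hX : X ∈ K) (h : ¬ Low K X) : X ∈ big K := by
  rw [mem_big]
  refine ⟨hX, ?_⟩
  by_contra hc
  rw [not_or, Finset.not_nonempty_iff_eq_empty, Finset.not_nonempty_iff_eq_empty] at hc
  exact h ⟨hX, by simp [hc.1], by simp [hc.2]⟩

/-- A non-low member has more than n/64 free elements of one kind, each with at least n/4 partners,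
hence n²/256 neighbours in `big K`. So a small part of `big K` dominates the non-low members, and
`exists_cover` needs two blocks per dominating member. -/
theorem exists_union_not_low (hK : IsSys r K) (hr : Mid α r) :
    ∃ D k, IsUnion r k D ∧ D ⊆ K ∧ (∀ X ∈ K, ¬ Low K X → X ∈ D) ∧
      (k : ℝ) * Fintype.card α ^ 2 ≤ 1024 * (big K).card * Real.log (Fintype.card α) +
        2 * Fintype.card α ^ 2 + 2 * (big K).card := by
  classical
  obtain ⟨S, hSB, hS, hc⟩ := exists_dominating_real (Adj (α := α))
    (K.filter fun X => ¬ Low K X) (big K)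
    (fun X hX => mem_big_of_not_low (Finset.mem_filter.1 hX).1 (Finset.mem_filter.1 hX).2)
    (Fintype.card α) hr.2.2 (by
      intro X hX
      obtain ⟨hX, hl⟩ := Finset.mem_filter.1 hX
      have hXr := hK.card_eq X hX
      obtain ⟨h1, h2, h3⟩ := id hr
      rw [Low, not_and, not_and_or, not_le, not_le] at hl
      rcases hl hX with h | h
      · have h4 := hK.deg_le_card_filter hX (outs K X ×ˢ Xᶜ) (fun p hp => by
          rw [Finset.mem_product, Finset.mem_compl, mem_outs] at hp
          exact ⟨hp.1.1, hp.2, hp.1.2 _ hp.2⟩) hr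
        rw [Finset.card_product, Finset.card_compl, hXr] at h4
        have h5 : Fintype.card α ≤ 4 * (Fintype.card α - r) := by omega
        nlinarith [Nat.mul_le_mul h.le h5]
      · have h4 := hK.deg_le_card_filter hX (X ×ˢ ins K X) (fun p hp => by
          rw [Finset.mem_product, mem_ins] at hp
          exact ⟨hp.1, hp.2.1, hp.2.2 _ hp.1⟩) hr
        rw [Finset.card_product, hXr] at h4
        nlinarith [Nat.mul_le_mul h.le h1])
  have hcov : ∀ X : Finset α, ∃ D, X ∈ K → IsUnion r 2 D ∧ D ⊆ K ∧ X ∈ D ∧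
      ∀ Y ∈ K, Adj X Y → Y ∈ D := by
    intro X
    by_cases hX : X ∈ K
    · obtain ⟨D, hD⟩ := hK.exists_cover hX
      exact ⟨D, fun _ => hD⟩
    · exact ⟨∅, fun h => absurd h hX⟩
  choose D hD using hcov
  have hSK : ∀ X ∈ S, X ∈ K := fun X hX => (mem_big.1 (hSB hX)).1
  refine ⟨S.biUnion D, S.card * 2, isUnion_biUnion S D fun X hX => (hD X (hSK X hX)).1, ?_, ?_, ?_⟩
  · exact Finset.biUnion_subset.2 fun X hX => (hD X (hSK X hX)).2.1
  · intro X hX hl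
    rw [Finset.mem_biUnion]
    rcases hS X (Finset.mem_filter.2 ⟨hX, hl⟩) with h | ⟨Y, hY, hXY⟩
    · exact ⟨X, h, (hD X hX).2.2.1⟩
    · exact ⟨Y, hY, (hD Y (hSK Y hY)).2.2.2 X hX hXY.symm⟩
  · push_cast
    linarith

/-- Take a largest set of deep members whose neighbourhoods cover at least n²/8 sets per member. By
maximality any deep set has at most n²/8 neighbours not yet covered, out of r(n-r) ≥ 3n²/16, so at
least n²/16 of them lie in the union of balls. -/
theorem exists_union_deep (hK : IsSys r K) (hr : Mid α r) :
    ∃ D k, IsUnion r k D ∧ D ⊆ K ∧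
      (∀ X ∈ K, ¬ Nondeep K X → Fintype.card α ^ 2 ≤ 32 * deg D X) ∧
      k * Fintype.card α ^ 2 ≤ 8 * (big K).card := by
  classical
  set n := Fintype.card α with hn
  let nb : Finset α → Finset (Finset α) := fun X => Finset.univ.filter (Adj X)
  let deep := K.filter fun X => ¬ Nondeep K X
  let good := deep.powerset.filter fun S => S.card * n ^ 2 ≤ 8 * (S.biUnion nb).card
  have hgood : good.Nonempty := ⟨∅, by simp [good]⟩
  obtain ⟨S, hS, hmax⟩ := good.exists_max_image Finset.card hgood
  simp only [good, Finset.mem_filter, Finset.mem_powerset] at hS hmax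
  obtain ⟨hSd, hSc⟩ := hS
  have hmem : ∀ {X Y}, X ∈ K → ¬ Nondeep K X → Adj X Y → Y ∈ K := by
    rintro X _ hX h ⟨x, hx, y, hy, rfl⟩
    by_contra h'
    exact h ⟨hX, x, hx, y, hy, h'⟩
  have hSK : ∀ X ∈ S, X ∈ K ∧ ¬ Nondeep K X := fun X hX => Finset.mem_filter.1 (hSd hX)
  have hnbS : ∀ Y ∈ S.biUnion nb, Y ∈ big K := by
    intro Y hY
    obtain ⟨X, hX, hXY⟩ := Finset.mem_biUnion.1 hY
    have hXY : Adj X Y := (Finset.mem_filter.1 hXY).2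
    obtain ⟨h1, h2⟩ := hSK X hX
    exact (hK.mem_big_iff hr).2 ⟨hmem h1 h2 hXY, X, h1, hXY.symm⟩
  refine ⟨S.biUnion fun X => simple r (2, X), S.card * 1,
    isUnion_biUnion S _ fun X _ => isUnion_simple r _, ?_, ?_, ?_⟩
  · refine Finset.biUnion_subset.2 fun X hX Y hY => ?_
    rw [mem_simple] at hY
    have h3 : Y = X ∨ Adj X Y := by simpa using hY.2
    rcases h3 with rfl | h3
    · exact (hSK Y hX).1
    · exact hmem (hSK X hX).1 (hSK X hX).2 h3
  · intro X hX hd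
    have hXr := hK.card_eq X hX
    have hsub : nb X ∩ S.biUnion nb ⊆ nb X ∩ S.biUnion fun X => simple r (2, X) := by
      refine Finset.inter_subset_inter subset_rfl fun Y hY => ?_
      have hYr := hK.card_eq Y (mem_big.1 (hnbS Y hY)).1
      obtain ⟨X', hX', hXY⟩ := Finset.mem_biUnion.1 hY
      refine Finset.mem_biUnion.2 ⟨X', hX', ?_⟩
      rw [mem_simple]
      exact ⟨hYr, by simp [(Finset.mem_filter.1 hXY).2]⟩
    have hdeg : (nb X ∩ S.biUnion fun X => simple r (2, X)).card ≤
        deg (S.biUnion fun X => simple r (2, X)) X := by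
      rw [deg]
      refine (Finset.card_le_card ?_).trans
        (Finset.card_image_le (f := fun p : α × α => sw X p.1 p.2))
      intro Y hY
      obtain ⟨h1, h2⟩ := Finset.mem_inter.1 hY
      obtain ⟨x, hx, y, hy, rfl⟩ := (Finset.mem_filter.1 h1).2
      refine Finset.mem_image.2 ⟨(x, y), ?_, rfl⟩
      rw [Finset.mem_filter, Finset.mem_product, Finset.mem_compl]
      exact ⟨⟨hx, hy⟩, h2⟩
    have hnb : r * (n - r) = (nb X).card := by
      have : nb X = (X ×ˢ Xᶜ).image fun p : α × α => sw X p.1 p.2 := by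
        ext Y
        simp only [nb, Finset.mem_filter, Finset.mem_univ, true_and, Finset.mem_image,
          Finset.mem_product, Finset.mem_compl, Prod.exists]
        constructor
        · rintro ⟨x, hx, y, hy, rfl⟩; exact ⟨x, y, ⟨hx, hy⟩, rfl⟩
        · rintro ⟨x, y, ⟨hx, hy⟩, rfl⟩; exact ⟨x, hx, y, hy, rfl⟩
      rw [this, Finset.card_image_of_injOn (sw_injOn X), Finset.card_product, Finset.card_compl,
        hXr]
    have h6 := Finset.card_le_card hsub
    have h7 := Finset.card_sdiff_add_card_inter (nb X) (S.biUnion nb)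
    obtain ⟨h1, h2, h3⟩ := hr
    rw [← hn] at h1 h2
    have h8 : 3 * n ^ 2 ≤ 16 * (r * (n - r)) := by
      obtain ⟨c, hc⟩ := Nat.exists_eq_add_of_le (show r ≤ n by omega)
      rw [hc, Nat.add_sub_cancel_left]
      rw [hc] at h1 h2
      have h9 : c ≤ 3 * r := by omega
      have h10 : r ≤ 3 * c := by omega
      nlinarith [Nat.mul_le_mul h9 h10, mul_nonneg (Nat.zero_le r) (Nat.zero_le c),
        mul_self_nonneg ((r : ℤ) - c)]
    have h9 : 8 * (nb X \ S.biUnion nb).card ≤ n ^ 2 := by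
      by_cases hXS : X ∈ S
      · rw [Finset.sdiff_eq_empty_iff_subset.2 (Finset.subset_biUnion_of_mem nb hXS)]
        simp
      by_contra! hc
      have := hmax (insert X S) ⟨Finset.insert_subset (Finset.mem_filter.2 ⟨hX, hd⟩) hSd, by
        rw [Finset.card_insert_of_notMem hXS, Finset.biUnion_insert, Finset.card_union]
        have := Finset.card_sdiff_add_card (nb X) (S.biUnion nb)
        rw [Finset.card_union] at this
        rw [← this]
        nlinarith⟩
      rw [Finset.card_insert_of_notMem hXS] at this
      omega
    omega
  · rw [mul_one]
    exact hSc.trans (Nat.mul_le_mul_left _ (Finset.card_le_card hnbS))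

end IsSys

end Johnson

/-! ### Spans with many low sets, and existence of containers. -/

namespace Johnson

variable {α : Type*} [DecidableEq α] [Fintype α]

open Classical in
/-- The members of `K` that are not low. -/
noncomputable def nonlow (K : Finset (Finset α)) : Finset (Finset α) :=
  K.filter fun Y => ¬ Low K Y

theorem mem_nonlow {K : Finset (Finset α)} {Y : Finset α} :
    Y ∈ nonlow K ↔ Y ∈ K ∧ ¬ Low K Y := by simp [nonlow]

open Classical in
/-- The triples `(x, x', z)` such that `insert y X` without `x` is low with `x'` in its core, and
`z` is outside the common span. -/
noncomputable def triples (K : Finset (Finset α)) (X : Finset α) (y : α) : Finset (α × α × α) :=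
  Finset.univ.filter fun t => t.1 ∈ X ∧ Low K (sw X t.1 y) ∧ t.2.1 ∈ cor K (sw X t.1 y) ∧
    t.2.2 ∉ spn K X

theorem mem_triples {K : Finset (Finset α)} {X : Finset α} {y : α} {t : α × α × α} :
    t ∈ triples K X y ↔ t.1 ∈ X ∧ Low K (sw X t.1 y) ∧ t.2.1 ∈ cor K (sw X t.1 y) ∧
      t.2.2 ∉ spn K X := by simp [triples]

/-- The set obtained from a triple, with the inserted element and the order of the removed ones. -/
noncomputable def tripleCode (X : Finset α) (y : α) (t : α × α × α) : Finset α × α × Bool :=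
  (sw (sw X t.1 y) t.2.1 t.2.2, t.2.2,
    decide (Fintype.equivFin α t.1 < Fintype.equivFin α t.2.1))

namespace IsSys

variable {r : ℕ} {K : Finset (Finset α)}

/-- More than r/4 ≥ n/16 choices of x give a low set; its core and the complement of the span each
have at least n/8 elements. Hence 1024 = 16·8·8. -/
theorem card_triples (hK : IsSys r K) (hr : Mid α r) {X : Finset α} {y : α} (h1 : Low K X)
    (h2 : y ∈ ins K X) (h4 : 4 * colDeg (nonlow K) X y < 3 * r) :
    Fintype.card α ^ 3 ≤ 1024 * (triples K X y).card := by
  classical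
  set n := Fintype.card α with hn
  have hc := hK.card_eq _ h1.1
  set L := X.filter fun x => Low K (sw X x y) with hL
  have h5 : L.card + colDeg (nonlow K) X y = r := by
    have h6 := Finset.card_filter_add_card_filter_not (s := X) (fun x => Low K (sw X x y))
    rw [hc] at h6
    rw [← h6, hL, colDeg]
    congr 2
    refine Finset.filter_congr fun x hx => ?_
    rw [mem_nonlow]
    simp [(mem_ins.1 h2).2 x hx]
  obtain ⟨m1, m2, m3⟩ := id hr
  have h6 : n ≤ 16 * L.card := by omega
  have h7 : ∀ x ∈ L, n ≤ 8 * (cor K (sw X x y)).card := by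
    intro x hx
    have hl := (Finset.mem_filter.1 hx).2
    have h8 := card_cor K (sw X x y)
    rw [hK.card_eq _ hl.1] at h8
    have := hl.2.1
    omega
  have h8 : n ≤ 8 * (spn K X)ᶜ.card := by
    have h9 := card_spn K X
    rw [hc] at h9
    rw [Finset.card_compl]
    have := h1.2.2
    omega
  have h9 : (triples K X y).card = ∑ x ∈ L, (cor K (sw X x y)).card * (spn K X)ᶜ.card := by
    have : ∀ x ∈ L, (cor K (sw X x y)).card * (spn K X)ᶜ.card =
        (cor K (sw X x y) ×ˢ (spn K X)ᶜ).card :=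
      fun x _ => (Finset.card_product _ _).symm
    rw [Finset.sum_congr rfl this, ← Finset.card_sigma]
    refine Finset.card_bij' (fun t _ => ⟨t.1, t.2⟩) (fun t _ => (t.1, t.2)) ?_ ?_ ?_ ?_
    · rintro ⟨x, x', z⟩ h
      rw [mem_triples] at h
      simp only [Finset.mem_sigma, hL, Finset.mem_filter, Finset.mem_product,
        Finset.mem_compl]
      exact ⟨⟨h.1, h.2.1⟩, h.2.2⟩
    · rintro ⟨x, x', z⟩ h
      simp only [Finset.mem_sigma, hL, Finset.mem_filter, Finset.mem_product,
        Finset.mem_compl] at h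
      rw [mem_triples]
      exact ⟨h.1.1, h.1.2, h.2⟩
    · simp
    · simp
  have h10 : L.card * (n * n) ≤
      ∑ x ∈ L, 64 * ((cor K (sw X x y)).card * (spn K X)ᶜ.card) := by
    rw [← smul_eq_mul]
    refine Finset.card_nsmul_le_sum _ _ _ fun x hx => ?_
    nlinarith [Nat.mul_le_mul (h7 x hx) h8]
  rw [← Finset.mul_sum, ← h9] at h10
  nlinarith [Nat.mul_le_mul_right (n * n) h6]

/-- Removing x and x' from X+y leaves an (r-1)-set that acts as a basis of the hyperplane: adding e
gives a member of `K` exactly for e in the span. This set is visible in the code, so the code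
determines the span. -/
theorem spn_of_triple (hK : IsSys r K) (hr : Mid α r) {X : Finset α} {y : α} (h1 : Low K X)
    (h2 : y ∈ ins K X) {t : α × α × α} (ht : t ∈ triples K X y) :
    (sw X t.1 y).erase t.2.1 = (sw (sw X t.1 y) t.2.1 t.2.2).erase t.2.2 ∧
      ∀ e, e ∈ spn K X ↔ e ∈ (sw X t.1 y).erase t.2.1 ∨
        insert e ((sw X t.1 y).erase t.2.1) ∈ K := by
  obtain ⟨x, x', z⟩ := t
  obtain ⟨t1, t2, t3, t4⟩ := mem_triples.1 ht
  dsimp only at t1 t2 t3 t4 ⊢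
  have hsub : sw X x y ⊆ spn K X := by
    intro w hw
    rw [mem_spn]
    rcases mem_sw.1 hw with rfl | hw
    · exact Or.inr h2
    · exact Or.inl hw.2
  have hnd := hK.nondeep_of_low hr t2
  have hs := hK.spn_eq (hK.nondeep_of_low hr h1) hnd hsub
  generalize sw X x y = W at *
  have hx' := cor_subset _ _ t3
  refine ⟨?_, fun e => ⟨fun he => ?_, ?_⟩⟩
  · rw [sw, Finset.erase_insert]
    exact fun h => t4 (hsub (Finset.mem_of_mem_erase h))
  · by_cases heA : e ∈ W.erase x'
    · exact Or.inl heA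
    · refine Or.inr (hK.of_subset_spn W hnd _ ?_ ?_)
      · rw [Finset.card_insert_of_notMem heA, Finset.card_erase_of_mem hx',
          hK.card_eq _ t2.1]
        have := Finset.card_pos.2 ⟨x', hx'⟩
        rw [hK.card_eq _ t2.1] at this
        omega
      · rw [hs]
        intro w hw
        rcases Finset.mem_insert.1 hw with rfl | hw
        · exact he
        · exact hsub (Finset.mem_of_mem_erase hw)
  · rintro (he | he)
    · exact hsub (Finset.mem_of_mem_erase he)
    · by_contra heH
      exact hK.sw_notMem t2.1 t3 (y := e) (by rwa [hs]) he

theorem spn_eq_of_tripleCode (hK : IsSys r K) (hr : Mid α r) {X X' : Finset α} {y y' : α}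
    (h1 : Low K X) (h2 : y ∈ ins K X) (h1' : Low K X') (h2' : y' ∈ ins K X') {t t' : α × α × α}
    (ht : t ∈ triples K X y) (ht' : t' ∈ triples K X' y')
    (h : tripleCode X y t = tripleCode X' y' t') : spn K X = spn K X' := by
  simp only [tripleCode, Prod.mk.injEq] at h
  obtain ⟨a1, a2⟩ := hK.spn_of_triple hr h1 h2 ht
  obtain ⟨b1, b2⟩ := hK.spn_of_triple hr h1' h2' ht'
  have hA : (sw X t.1 y).erase t.2.1 = (sw X' t'.1 y').erase t'.2.1 := by
    rw [a1, b1, h.1, h.2.1]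
  ext e
  rw [a2, b2, hA]

/-- With X+y known, the code shows which pair was removed; the Boolean says which of the two came
first. -/
theorem tripleCode_injOn (hK : IsSys r K) (hr : Mid α r) {X : Finset α} {y : α}
    (h1 : Low K X) (h2 : y ∈ ins K X) :
    Set.InjOn (tripleCode X y) (triples K X y) := by
  intro t ht t' ht' h
  rw [Finset.mem_coe] at ht ht'
  obtain ⟨a1, -⟩ := hK.spn_of_triple hr h1 h2 ht
  obtain ⟨b1, -⟩ := hK.spn_of_triple hr h1 h2 ht'
  simp only [tripleCode, Prod.mk.injEq, decide_eq_decide] at h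
  obtain ⟨e1, e2, e3⟩ := h
  have hA : (sw X t.1 y).erase t.2.1 = (sw X t'.1 y).erase t'.2.1 := by
    rw [a1, b1, e1, e2]
  rw [mem_triples] at ht ht'
  obtain ⟨x, x', z⟩ := t
  obtain ⟨u, u', z'⟩ := t'
  dsimp only at *
  subst e2
  have hyX := (mem_ins.1 h2).1
  have hx' := cor_subset _ _ ht.2.2.1
  have hu' := cor_subset _ _ ht'.2.2.1
  rw [sw_insert_erase hyX ht.1, Finset.mem_erase] at hx'
  rw [sw_insert_erase hyX ht'.1, Finset.mem_erase] at hu'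
  rw [sw_insert_erase hyX ht.1, sw_insert_erase hyX ht'.1] at hA
  have hxT : x ∈ insert y X := Finset.mem_insert_of_mem ht.1
  have huT : u ∈ insert y X := Finset.mem_insert_of_mem ht'.1
  generalize insert y X = T at *
  have hA' : ∀ w ∈ T, (w = x ∨ w = x') ↔ (w = u ∨ w = u') := by
    intro w hw
    have := congrArg (w ∈ ·) hA
    simp only [Finset.mem_erase, hw, and_true, eq_iff_iff] at this
    tauto
  have c1 := (hA' x hxT).1 (Or.inl rfl)
  have c2 := (hA' x' hx'.2).1 (Or.inr rfl)
  have hfin : x = u ∧ x' = u' := by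
    rcases c1 with c1 | c1
    · exact ⟨c1, c2.resolve_left fun h => hx'.1 (h.trans c1.symm)⟩
    · exfalso
      have c5 : x' = u := c2.resolve_right fun h => hx'.1 (h.trans c1.symm)
      rw [← c1, ← c5] at e3
      have : Fintype.equivFin α x ≠ Fintype.equivFin α x' :=
        fun h => hx'.1 ((Fintype.equivFin α).injective h).symm
      rcases lt_or_gt_of_ne this with h | h
      · exact absurd (e3.1 h) (lt_asymm h)
      · exact absurd (e3.2 h) (lt_asymm h)
  rw [hfin.1, hfin.2]

/-- The spans that contain many low sets can be listed by few building blocks. -/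
theorem exists_union_spn (hK : IsSys r K) (hr : Mid α r) :
    ∃ D k, IsUnion r k D ∧ D ⊆ K ∧
      (∀ X, Low K X → ∀ y ∈ ins K X, 3 * r ≤ 4 * colDeg D X y ∨
        3 * r ≤ 4 * colDeg (nonlow K) X y) ∧
      k * Fintype.card α ^ 2 ≤ 2048 * (Fintype.card α).choose r := by
  classical
  set n := Fintype.card α with hn
  let P : Finset α → Finset α × α → Prop := fun H p =>
    Low K p.1 ∧ p.2 ∈ ins K p.1 ∧ spn K p.1 = H ∧ 4 * colDeg (nonlow K) p.1 p.2 < 3 * r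
  -- These are the spans with a column that the non-low members fail to fill to three quarters; they
  -- are listed explicitly.
  let bad : Finset (Finset α) := Finset.univ.filter fun H => ∃ p, P H p
  have hbad : ∀ H, ∃ p, H ∈ bad → P H p := by
    intro H
    by_cases h : ∃ p, P H p
    · obtain ⟨p, hp⟩ := h; exact ⟨p, fun _ => hp⟩
    · have : Nonempty α := Fintype.card_pos_iff.1 hr.2.2
      exact ⟨(∅, Classical.arbitrary α), fun h' => absurd (Finset.mem_filter.1 h').2 h⟩
  choose p hp using hbad
  refine ⟨bad.biUnion fun H => simple r (1, H), bad.card * 1,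
    isUnion_biUnion bad _ fun H _ => isUnion_simple r _, ?_, ?_, ?_⟩
  · refine Finset.biUnion_subset.2 fun H hH Y hY => ?_
    rw [mem_simple] at hY
    obtain ⟨h1, h2, h3, h4⟩ := hp H hH
    exact hK.of_subset_spn _ (hK.nondeep_of_low hr h1) Y hY.1 (by rw [h3]; simpa using hY.2)
  · intro X hX y hy
    by_cases h : 4 * colDeg (nonlow K) X y < 3 * r
    · left
      have hc := hK.card_eq X hX.1
      have hb : spn K X ∈ bad := Finset.mem_filter.2 ⟨Finset.mem_univ _, (X, y), hX, hy, rfl, h⟩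
      -- The down-set of the span contains every exchange for an element of the span, so the whole
      -- column is filled.
      have : colDeg (bad.biUnion fun H => simple r (1, H)) X y = r := by
        rw [colDeg, Finset.filter_true_of_mem, hc]
        intro x hx
        refine Finset.mem_biUnion.2 ⟨_, hb, mem_simple.2 ⟨?_, ?_⟩⟩
        · rw [sw_card hx (mem_ins.1 hy).1, hc]
        · refine Or.inr (Or.inl ⟨rfl, fun w hw => ?_⟩)
          rw [mem_spn]
          rcases mem_sw.1 hw with rfl | hw
          · exact Or.inr hy
          · exact Or.inl hw.2
      omega
    · exact Or.inr (not_lt.1 h)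
  · rw [mul_one]
    have hdisj : Set.PairwiseDisjoint (bad : Set (Finset α)) fun H =>
        (triples K (p H).1 (p H).2).image (tripleCode (p H).1 (p H).2) := by
      intro H hH H' hH' hne
      obtain ⟨h1, h2, h3, h4⟩ := hp H hH
      obtain ⟨h1', h2', h3', h4'⟩ := hp H' hH'
      rw [Function.onFun, Finset.disjoint_left]
      intro q hq hq'
      obtain ⟨t, ht, rfl⟩ := Finset.mem_image.1 hq
      obtain ⟨t', ht', h⟩ := Finset.mem_image.1 hq'
      refine hne ?_
      rw [← h3, ← h3']
      exact hK.spn_eq_of_tripleCode hr h1 h2 h1' h2' ht ht' h.symm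
    -- Each bad span owns at least n³/1024 codes, disjoint from those of the others, among
    -- 2n·binom(n,r) possible ones.
    have hcard : (bad.biUnion fun H =>
        (triples K (p H).1 (p H).2).image (tripleCode (p H).1 (p H).2)).card ≤
        ((Finset.univ.powersetCard r : Finset (Finset α)) ×ˢ
          (Finset.univ : Finset (α × Bool))).card := by
      refine Finset.card_le_card (Finset.biUnion_subset.2 fun H hH q hq => ?_)
      obtain ⟨t, ht, rfl⟩ := Finset.mem_image.1 hq
      rw [mem_triples] at ht
      obtain ⟨h1, h2, h3, h4⟩ := hp H hH
      simp only [tripleCode, Finset.mem_product, Finset.mem_univ, and_true,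
        Finset.mem_powersetCard, Finset.subset_univ, true_and]
      rw [sw_card (cor_subset _ _ ht.2.2.1), hK.card_eq _ ht.2.1.1]
      intro hz
      refine ht.2.2.2 ?_
      rw [mem_spn]
      rcases mem_sw.1 hz with hz | hz
      · exact Or.inr (hz ▸ h2)
      · exact Or.inl hz.2
    rw [Finset.card_biUnion hdisj, Finset.card_product, Finset.card_powersetCard,
      Finset.card_univ, Finset.card_univ, Fintype.card_prod, Fintype.card_bool, ← hn] at hcard
    have h1 : bad.card * n ^ 3 ≤ ∑ H ∈ bad,
        1024 * ((triples K (p H).1 (p H).2).image (tripleCode (p H).1 (p H).2)).card := by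
      rw [← smul_eq_mul]
      refine Finset.card_nsmul_le_sum _ _ _ fun H hH => ?_
      obtain ⟨h1, h2, h3, h4⟩ := hp H hH
      rw [Finset.card_image_of_injOn (hK.tripleCode_injOn hr h1 h2)]
      exact hK.card_triples hr h1 h2 h4
    rw [← Finset.mul_sum] at h1
    have hn0 : 0 < n := hr.2.2
    refine Nat.le_of_mul_le_mul_right (c := n) ?_ hn0
    calc bad.card * n ^ 2 * n = bad.card * n ^ 3 := by ring
      _ ≤ _ := h1
      _ ≤ 1024 * (n.choose r * (n * 2)) := by gcongr
      _ = _ := by ring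

/-- Every system has a container that is a union of few building blocks. -/
theorem exists_container (hK : IsSys r K) (hr : Mid α r) :
    ∃ D k, IsUnion r k D ∧ IsContainer r K D ∧
      (k : ℝ) * Fintype.card α ^ 2 ≤ 1024 * (big K).card * Real.log (Fintype.card α) +
        2 * Fintype.card α ^ 2 + 10 * (big K).card + 4096 * (Fintype.card α).choose r := by
  classical
  have hrn : r ≤ Fintype.card α := by obtain ⟨h2, h3, h4⟩ := hr; omega
  obtain ⟨D1, k1, u1, s1, p1, c1⟩ := hK.exists_union_not_low hr
  obtain ⟨D2, k2, u2, s2, p2, c2⟩ := hK.exists_union_deep hr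
  obtain ⟨D3, k3, u3, s3, p3, c3⟩ := hK.exists_union_spn hr
  obtain ⟨D4, k4, u4, s4, p4, c4⟩ := hK.dual.exists_union_spn hr.dual
  have u4' := u4.dual (Nat.sub_le _ _)
  rw [Nat.sub_sub_self hrn] at u4'
  have s4' : Johnson.dual D4 ⊆ K := by
    rw [← dual_dual K]; exact Finset.image_subset_image s4
  -- `D3` takes care of columns; `D4`, built in the dual, takes care of rows.
  refine ⟨D1 ∪ D2 ∪ D3 ∪ Johnson.dual D4, _, ((u1.union u2).union u3).union u4', ?_, ?_⟩
  · have hcol : ∀ {E : Finset (Finset α)} (X y), E ⊆ D1 ∪ D2 ∪ D3 ∪ Johnson.dual D4 →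
        colDeg E X y ≤ colDeg (D1 ∪ D2 ∪ D3 ∪ Johnson.dual D4) X y := by
      intro E X y hE
      exact Finset.card_le_card (Finset.monotone_filter_right _ fun x _ hx => hE hx)
    have hrow : ∀ {E : Finset (Finset α)} (X y), E ⊆ D1 ∪ D2 ∪ D3 ∪ Johnson.dual D4 →
        rowDeg E X y ≤ rowDeg (D1 ∪ D2 ∪ D3 ∪ Johnson.dual D4) X y := by
      intro E X y hE
      exact Finset.card_le_card (Finset.monotone_filter_right _ fun x _ hx => hE hx)
    have i1 : D1 ⊆ D1 ∪ D2 ∪ D3 ∪ Johnson.dual D4 := fun X hX => by simp [hX]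
    have i2 : D2 ⊆ D1 ∪ D2 ∪ D3 ∪ Johnson.dual D4 := fun X hX => by simp [hX]
    have i3 : D3 ⊆ D1 ∪ D2 ∪ D3 ∪ Johnson.dual D4 := fun X hX => by simp [hX]
    have i4 : Johnson.dual D4 ⊆ D1 ∪ D2 ∪ D3 ∪ Johnson.dual D4 := fun X hX => by simp [hX]
    constructor
    · exact Finset.union_subset (Finset.union_subset (Finset.union_subset s1 s2) s3) s4'
    · exact fun X hX hl => i1 (p1 X hX hl)
    · intro X hX hd
      refine (p2 X hX hd).trans (Nat.mul_le_mul_left _ (Finset.card_le_card ?_))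
      exact Finset.monotone_filter_right _ fun x _ hx => i2 hx
    · intro X hX y hy
      rcases p3 X hX y hy with h | h
      · exact h.trans (Nat.mul_le_mul_left _ (hcol X y i3))
      · refine h.trans (Nat.mul_le_mul_left _ (hcol X y fun Y hY => i1 ?_))
        have := mem_nonlow.1 hY
        exact p1 Y this.1 this.2
    · intro X hX x hx
      have hxX := outs_subset _ _ hx
      rcases p4 Xᶜ (low_dual.2 hX) x (by rwa [ins_dual]) with h | h
      · rw [← rowDeg_dual (by simpa using hxX), compl_compl] at h
        exact h.trans (Nat.mul_le_mul_left _ (hrow X x i4))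
      · rw [← rowDeg_dual (by simpa using hxX), compl_compl] at h
        refine h.trans (Nat.mul_le_mul_left _ (hrow X x fun Y hY => i1 ?_))
        have := mem_nonlow.1 (mem_dual.1 hY)
        exact p1 Y (compl_mem_dual.1 this.1) fun hl => this.2 (low_dual.2 hl)
  · have c2' : (k2 : ℝ) * Fintype.card α ^ 2 ≤ 8 * (big K).card := by exact_mod_cast c2
    have c3' : (k3 : ℝ) * Fintype.card α ^ 2 ≤ 2048 * (Fintype.card α).choose r := by
      exact_mod_cast c3
    have c4' : (k4 : ℝ) * Fintype.card α ^ 2 ≤ 2048 * (Fintype.card α).choose r := by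
      rw [← Nat.choose_symm hrn]
      exact_mod_cast c4
    push_cast
    linarith

end IsSys

end Johnson

/-! ### Shearer's inequality and counting small subsets. -/

namespace Johnson

/-- Superadditivity of the geometric mean. After normalising by the product of the sums, AM-GM
bounds x and y by the averages of b/(b+c) and c/(b+c), and these averages add up to 1. -/
theorem add_pow_le_prod {ι : Type*} (s : Finset ι) (b c : ι → ℝ) (hb : ∀ i ∈ s, 0 ≤ b i)
    (hc : ∀ i ∈ s, 0 ≤ c i) {x y M : ℝ} (hx : 0 ≤ x) (hy : 0 ≤ y) (hM : 0 ≤ M)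
    (hs : 0 < s.card)
    (h1 : x ^ s.card ≤ (∏ i ∈ s, b i) * M) (h2 : y ^ s.card ≤ (∏ i ∈ s, c i) * M) :
    (x + y) ^ s.card ≤ (∏ i ∈ s, (b i + c i)) * M := by
  have hs0 : s.card ≠ 0 := hs.ne'
  have hd : (0 : ℝ) < s.card := by exact_mod_cast hs
  by_cases h0 : ∃ i ∈ s, b i + c i = 0
  · obtain ⟨i, hi, h0⟩ := h0
    have hb0 : b i = 0 := by linarith [hb i hi, hc i hi]
    have hc0 : c i = 0 := by linarith [hb i hi, hc i hi]
    rw [Finset.prod_eq_zero hi hb0, zero_mul] at h1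
    rw [Finset.prod_eq_zero hi hc0, zero_mul] at h2
    have hx0 : x = 0 := by
      by_contra h; exact absurd h1 (not_le.2 (pow_pos (lt_of_le_of_ne hx (Ne.symm h)) _))
    have hy0 : y = 0 := by
      by_contra h; exact absurd h2 (not_le.2 (pow_pos (lt_of_le_of_ne hy (Ne.symm h)) _))
    rw [hx0, hy0, add_zero, zero_pow hs0]
    exact mul_nonneg (Finset.prod_nonneg fun i hi => add_nonneg (hb i hi) (hc i hi)) hM
  push Not at h0
  have hpos : ∀ i ∈ s, 0 < b i + c i := fun i hi =>
    lt_of_le_of_ne (add_nonneg (hb i hi) (hc i hi)) (Ne.symm (h0 i hi))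
  set S := ∏ i ∈ s, (b i + c i) with hS
  have hS0 : 0 < S := Finset.prod_pos hpos
  have key : ∀ (a : ι → ℝ) (z : ℝ), (∀ i ∈ s, 0 ≤ a i) → 0 ≤ z →
      z ^ s.card ≤ (∏ i ∈ s, a i) * M →
      z ≤ (S * M) ^ ((s.card : ℝ)⁻¹) * ∑ i ∈ s, (s.card : ℝ)⁻¹ * (a i / (b i + c i)) := by
    intro a z ha hz h
    have hq : ∀ i ∈ s, 0 ≤ a i / (b i + c i) := fun i hi => div_nonneg (ha i hi) (hpos i hi).le
    have h3 := Real.geom_mean_le_arith_mean_weighted s (fun _ => (s.card : ℝ)⁻¹)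
      (fun i => a i / (b i + c i)) (fun i _ => by positivity)
      (by rw [Finset.sum_const, nsmul_eq_mul, mul_inv_cancel₀ hd.ne']) hq
    rw [Real.finsetProd_rpow _ _ hq] at h3
    have h4 : z = (z ^ s.card) ^ ((s.card : ℝ)⁻¹) := (Real.pow_rpow_inv_natCast hz hs0).symm
    have h5 : (∏ i ∈ s, a i) * M = (S * M) * ∏ i ∈ s, a i / (b i + c i) := by
      rw [Finset.prod_div_distrib, ← hS, mul_right_comm, mul_div_cancel₀ _ hS0.ne']
    calc z = (z ^ s.card) ^ ((s.card : ℝ)⁻¹) := h4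
      _ ≤ ((S * M) * ∏ i ∈ s, a i / (b i + c i)) ^ ((s.card : ℝ)⁻¹) := by
        rw [← h5]; exact Real.rpow_le_rpow (pow_nonneg hz _) h (inv_pos.2 hd).le
      _ = (S * M) ^ ((s.card : ℝ)⁻¹) * (∏ i ∈ s, a i / (b i + c i)) ^ ((s.card : ℝ)⁻¹) :=
        Real.mul_rpow (by positivity) (Finset.prod_nonneg hq)
      _ ≤ _ := by gcongr
  have hx' := key b x hb hx h1
  have hy' := key c y hc hy h2
  have hsum : ∑ i ∈ s, (s.card : ℝ)⁻¹ * (b i / (b i + c i)) +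
      ∑ i ∈ s, (s.card : ℝ)⁻¹ * (c i / (b i + c i)) = 1 := by
    rw [← Finset.sum_add_distrib, Finset.sum_congr rfl (g := fun _ => (s.card : ℝ)⁻¹),
      Finset.sum_const, nsmul_eq_mul, mul_inv_cancel₀ hd.ne']
    · intro i hi
      have := (hpos i hi).ne'
      rw [← mul_add, ← add_div, div_self this, mul_one]
  have hxy : x + y ≤ (S * M) ^ ((s.card : ℝ)⁻¹) := by
    calc x + y ≤ _ := add_le_add hx' hy'
      _ = (S * M) ^ ((s.card : ℝ)⁻¹) * 1 := by rw [← mul_add, hsum]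
      _ = _ := mul_one _
  calc (x + y) ^ s.card ≤ ((S * M) ^ ((s.card : ℝ)⁻¹)) ^ s.card := by gcongr
    _ = S * M := Real.rpow_inv_natCast_pow (by positivity) hs0

theorem nat_add_pow_le_prod {ι : Type*} (s : Finset ι) (b c : ι → ℕ) {x y M : ℕ}
    (hs : 0 < s.card) (h1 : x ^ s.card ≤ (∏ i ∈ s, b i) * M)
    (h2 : y ^ s.card ≤ (∏ i ∈ s, c i) * M) :
    (x + y) ^ s.card ≤ (∏ i ∈ s, (b i + c i)) * M := by
  have := add_pow_le_prod s (fun i => (b i : ℝ)) (fun i => (c i : ℝ)) (fun _ _ => Nat.cast_nonneg _)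
    (fun _ _ => Nat.cast_nonneg _) (x := x) (y := y) (M := M) (Nat.cast_nonneg _)
    (Nat.cast_nonneg _) (Nat.cast_nonneg _) hs (by exact_mod_cast h1) (by exact_mod_cast h2)
  exact_mod_cast this

/-- Shearer's inequality for set families, in the case of an exact cover. -/
theorem card_pow_le_prod_traces {V ι : Type*} [DecidableEq V] [DecidableEq ι] [Fintype ι] (A : ι → Finset V)
    {d : ℕ} (hd : 0 < d) (W : Finset V) :
    (∀ v ∈ W, (Finset.univ.filter fun i => v ∈ A i).card = d) → ∀ F : Finset (Finset V),
      (∀ f ∈ F, f ⊆ W) → F.card ^ d ≤ ∏ i, (F.image (· ∩ A i)).card := by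
  induction W using Finset.induction_on with
  | empty =>
    intro _ F hF
    rcases F.eq_empty_or_nonempty with rfl | hne
    · simp [hd.ne']
    · have h1 : F.card ≤ 1 := Finset.card_le_one.2 fun a ha b hb => by
        rw [Finset.subset_empty.1 (hF a ha), Finset.subset_empty.1 (hF b hb)]
      calc F.card ^ d ≤ 1 ^ d := by gcongr
        _ = 1 := one_pow _
        _ ≤ _ := Nat.one_le_iff_ne_zero.2 <| Finset.prod_ne_zero_iff.2 fun i _ =>
          (Finset.card_pos.2 (hne.image _)).ne'
  | insert v W hv ih =>
    intro hcov F hF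
    have ih := ih fun w hw => hcov w (Finset.mem_insert_of_mem hw)
    set F0 := F.filter fun f => v ∉ f with hF0
    set F1 := (F.filter fun f => v ∈ f).image fun f => f.erase v with hF1
    have hv0 : ∀ f ∈ F0, v ∉ f := fun f hf => (Finset.mem_filter.1 hf).2
    have hv1 : ∀ f ∈ F1, v ∉ f := by
      intro f hf
      obtain ⟨g, -, rfl⟩ := Finset.mem_image.1 hf
      simp
    have hm1 : ∀ f ∈ F1, insert v f ∈ F := by
      intro f hf
      obtain ⟨g, hg, rfl⟩ := Finset.mem_image.1 hf
      rw [Finset.insert_erase (Finset.mem_filter.1 hg).2]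
      exact (Finset.mem_filter.1 hg).1
    have hcard : F.card = F0.card + F1.card := by
      rw [hF1, Finset.card_image_of_injOn, add_comm, hF0,
        Finset.card_filter_add_card_filter_not]
      intro f hf g hg h
      rw [← Finset.insert_erase (Finset.mem_filter.1 hf).2,
        ← Finset.insert_erase (Finset.mem_filter.1 hg).2]
      exact congrArg (insert v) h
    have i0 := ih F0 fun f hf w hw => (Finset.mem_insert.1
      (hF f (Finset.mem_filter.1 hf).1 hw)).resolve_left fun h => hv0 f hf (h ▸ hw)
    have i1 := ih F1 fun f hf w hw => (Finset.mem_insert.1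
      (hF _ (hm1 f hf) (Finset.mem_insert_of_mem hw))).resolve_left fun h => hv1 f hf (h ▸ hw)
    set I := Finset.univ.filter fun i => v ∈ A i with hI
    have hId : I.card = d := hcov v (Finset.mem_insert_self _ _)
    set b := fun i => (F0.image (· ∩ A i)).card with hb
    set c := fun i => (F1.image (· ∩ A i)).card with hc
    set a := fun i => (F.image (· ∩ A i)).card with ha
    -- On the `A i` that contain v, the traces of the two halves are told apart by v, so their
    -- numbers add up. On the other `A i`, each half alone has at most as many traces as `F`.
    have hbc : ∀ i ∈ I, b i + c i ≤ a i := by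
      intro i hi
      have hvi : v ∈ A i := (Finset.mem_filter.1 hi).2
      have hinj : Set.InjOn (insert v) (↑(F1.image (· ∩ A i)) : Set (Finset V)) := by
        intro f hf g hg h
        obtain ⟨f, hf', rfl⟩ := Finset.mem_image.1 hf
        obtain ⟨g, hg', rfl⟩ := Finset.mem_image.1 hg
        have h1 : v ∉ f ∩ A i := fun h => hv1 f hf' (Finset.mem_inter.1 h).1
        have h2 : v ∉ g ∩ A i := fun h => hv1 g hg' (Finset.mem_inter.1 h).1
        rw [← Finset.erase_insert h1, ← Finset.erase_insert h2]
        exact congrArg (Finset.erase · v) h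
      rw [hb, hc, ha]
      dsimp only
      rw [← Finset.card_image_of_injOn hinj, ← Finset.card_union_of_disjoint]
      · refine Finset.card_le_card (Finset.union_subset ?_ fun g hg => ?_)
        · exact Finset.image_subset_image (Finset.filter_subset _ _)
        · obtain ⟨g', hg', rfl⟩ := Finset.mem_image.1 hg
          obtain ⟨f, hf, rfl⟩ := Finset.mem_image.1 hg'
          refine Finset.mem_image.2 ⟨_, hm1 f hf, ?_⟩
          exact Finset.insert_inter_of_mem hvi
      · rw [Finset.disjoint_left]
        intro g hg hg'
        obtain ⟨f, hf, rfl⟩ := Finset.mem_image.1 hg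
        obtain ⟨f', hf', h⟩ := Finset.mem_image.1 hg'
        refine hv0 f hf (Finset.mem_inter.1 (h ▸ Finset.mem_insert_self v f')).1
    have hba : ∀ i, b i ≤ a i := fun i =>
      Finset.card_le_card (Finset.image_subset_image (Finset.filter_subset _ _))
    have hca : ∀ i ∉ I, c i ≤ a i := by
      intro i hi
      have hvi : v ∉ A i := fun h => hi (Finset.mem_filter.2 ⟨Finset.mem_univ _, h⟩)
      refine Finset.card_le_card fun g hg => ?_
      obtain ⟨f, hf, rfl⟩ := Finset.mem_image.1 hg
      exact Finset.mem_image.2 ⟨_, hm1 f hf, Finset.insert_inter_of_notMem hvi⟩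
    have hprod : ∀ g : ι → ℕ, ∏ i, g i = (∏ i ∈ I, g i) * ∏ i ∈ Iᶜ, g i := by
      intro g
      exact (Finset.prod_mul_prod_compl I g).symm
    have hM0 : ∏ i ∈ Iᶜ, b i ≤ ∏ i ∈ Iᶜ, a i := Finset.prod_le_prod' fun i _ => hba i
    have hM1 : ∏ i ∈ Iᶜ, c i ≤ ∏ i ∈ Iᶜ, a i :=
      Finset.prod_le_prod' fun i hi => hca i (Finset.mem_compl.1 hi)
    have r0 : F0.card ^ d ≤ (∏ i ∈ I, b i) * ∏ i ∈ Iᶜ, a i := by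
      refine i0.trans ?_
      rw [hprod]
      gcongr
    have r1 : F1.card ^ d ≤ (∏ i ∈ I, c i) * ∏ i ∈ Iᶜ, a i := by
      refine i1.trans ?_
      rw [hprod]
      gcongr
    have h3 : F.card ^ d ≤ (∏ i ∈ I, (b i + c i)) * ∏ i ∈ Iᶜ, a i := by
      rw [hcard]
      rw [← hId] at r0 r1 hd ⊢
      exact nat_add_pow_le_prod I b c hd r0 r1
    refine h3.trans ?_
    rw [hprod]
    gcongr with i hi
    exact hbc i hi

/-- Give Z the weight x^|Z|: the total weight is (1+x)^|V|, and sets of size at most k weigh at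
least x^k. -/
theorem card_filter_card_le {β : Type*} (V : Finset β) (k : ℕ) {x : ℝ} (hx : 0 < x)
    (hx1 : x ≤ 1) :
    ((V.powerset.filter fun Z => Z.card ≤ k).card : ℝ) * x ^ k ≤ (1 + x) ^ V.card := by
  have h := Finset.sum_pow_mul_eq_add_pow x 1 V
  simp only [one_pow, mul_one] at h
  rw [add_comm, ← h, ← nsmul_eq_mul]
  calc _ ≤ ∑ Z ∈ V.powerset.filter fun Z => Z.card ≤ k, x ^ Z.card :=
        Finset.card_nsmul_le_sum _ _ _ fun Z hZ =>
          pow_le_pow_of_le_one hx.le hx1 (Finset.mem_filter.1 hZ).2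
    _ ≤ _ := Finset.sum_le_sum_of_subset_of_nonneg (Finset.filter_subset _ _)
        fun _ _ _ => by positivity

/-- The number of subsets of size at most `k`, in a form suited to small `k`. -/
theorem card_filter_le_rpow {β : Type*} (V : Finset β) (k : ℕ) {c : ℝ} (hc : 0 ≤ c) :
    ((V.powerset.filter fun Z => Z.card ≤ k).card : ℝ) ≤
      2 ^ (2 * (2 : ℝ) ^ (-c) * V.card + c * k) := by
  have hx : (0 : ℝ) < 2 ^ (-c) := by positivity
  have h := card_filter_card_le V k hx (Real.rpow_le_one_of_one_le_of_nonpos (by norm_num)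
    (neg_nonpos.2 hc))
  have h1 : (1 + (2 : ℝ) ^ (-c)) ^ V.card ≤ 2 ^ (2 * (2 : ℝ) ^ (-c) * V.card) := by
    have h2 : 1 + (2 : ℝ) ^ (-c) ≤ Real.exp (2 ^ (-c)) := by
      rw [add_comm]; exact Real.add_one_le_exp _
    have h3 : ∀ x : ℝ, 0 ≤ x → Real.exp x ≤ 2 ^ (2 * x) := by
      intro x hx
      rw [Real.rpow_def_of_pos (by norm_num), Real.exp_le_exp]
      nlinarith [Real.log_two_gt_d9]
    rw [Real.rpow_mul (by norm_num), Real.rpow_natCast]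
    exact pow_le_pow_left₀ (by positivity) (h2.trans (h3 _ hx.le)) _
  rw [Real.rpow_add (by norm_num)]
  have h4 : ((2 : ℝ) ^ (-c)) ^ k * 2 ^ (c * k) = 1 := by
    rw [← Real.rpow_natCast, ← Real.rpow_mul (by norm_num), ← Real.rpow_add (by norm_num)]
    simp
  calc ((V.powerset.filter fun Z => Z.card ≤ k).card : ℝ)
      = (V.powerset.filter fun Z => Z.card ≤ k).card * ((2 : ℝ) ^ (-c)) ^ k * 2 ^ (c * k) := by
        rw [mul_assoc, h4, mul_one]
    _ ≤ _ := by gcongr; exact h.trans h1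

/-! ### Stable families and their proportional share in a subfamily. -/

variable {α : Type*} [DecidableEq α]

open Classical in
/-- The stable subfamilies of `V`. -/
noncomputable def stables (V : Finset (Finset α)) : Finset (Finset (Finset α)) :=
  V.powerset.filter Stable

theorem mem_stables {V I : Finset (Finset α)} : I ∈ stables V ↔ I ⊆ V ∧ Stable I := by
  simp [stables]

theorem empty_mem_stables (V : Finset (Finset α)) : ∅ ∈ stables V :=
  mem_stables.2 ⟨Finset.empty_subset _, by simp [Stable]⟩

theorem Adj.image {X Y : Finset α} (π : Equiv.Perm α) (h : Adj X Y) :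
    Adj (X.image π) (Y.image π) := by
  obtain ⟨x, hx, y, hy, rfl⟩ := h
  refine ⟨π x, Finset.mem_image_of_mem _ hx, π y, ?_, ?_⟩
  · intro h
    obtain ⟨z, hz, h⟩ := Finset.mem_image.1 h
    exact hy (π.injective h ▸ hz)
  · rw [sw, sw, Finset.image_insert, Finset.image_erase π.injective]

theorem image_image_symm (π : Equiv.Perm α) (X : Finset α) : (X.image π).image π.symm = X := by
  rw [Finset.image_image, Equiv.symm_comp_self, Finset.image_id]

theorem card_stables_pos (V : Finset (Finset α)) : 0 < (stables V).card :=
  Finset.card_pos.2 ⟨_, empty_mem_stables V⟩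

variable [Fintype α]

variable (α) in
/-- The number of stable families of `r`-sets. -/
noncomputable def numStable (r : ℕ) : ℕ :=
  (stables (Finset.univ.powersetCard r : Finset (Finset α))).card

theorem numStable_pos (r : ℕ) : 0 < numStable α r := card_stables_pos _

theorem exists_perm_image {X Y : Finset α} (h : X.card = Y.card) :
    ∃ π : Equiv.Perm α, X.image π = Y := by
  let e : {x // x ∈ X} ≃ {x // x ∈ Y} := Finset.equivOfCardEq h
  refine ⟨e.extendSubtype, ?_⟩
  refine Finset.eq_of_subset_of_card_le (fun y hy => ?_) ?_
  · obtain ⟨x, hx, rfl⟩ := Finset.mem_image.1 hy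
    exact e.extendSubtype_mem x hx
  · rw [Finset.card_image_of_injective _ (Equiv.injective _), h]

/-- The symmetric group is transitive on sets of a given size, so the translates of `U` cover all
r-sets equally often. -/
theorem card_perm_image_mem (U : Finset (Finset α)) {X Y : Finset α} (h : X.card = Y.card) :
    (Finset.univ.filter fun π : Equiv.Perm α => X.image π ∈ U).card =
      (Finset.univ.filter fun π : Equiv.Perm α => Y.image π ∈ U).card := by
  obtain ⟨σ, rfl⟩ := exists_perm_image h
  refine Finset.card_bij' (fun π _ => σ.symm.trans π) (fun π _ => σ.trans π) ?_ ?_ ?_ ?_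
  · intro π hπ
    rw [Finset.mem_filter] at hπ ⊢
    refine ⟨Finset.mem_univ _, ?_⟩
    rw [Equiv.coe_trans, ← Finset.image_image, image_image_symm]
    exact hπ.2
  · intro π hπ
    rw [Finset.mem_filter] at hπ ⊢
    refine ⟨Finset.mem_univ _, ?_⟩
    rw [Equiv.coe_trans, ← Finset.image_image]
    exact hπ.2
  · intro π _; ext; simp
  · intro π _; ext; simp

theorem sum_card_perm_image_mem {r : ℕ} {U : Finset (Finset α)} (hU : ∀ X ∈ U, X.card = r) :
    ∑ X ∈ Finset.univ.powersetCard r,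
      (Finset.univ.filter fun π : Equiv.Perm α => X.image π ∈ U).card =
        (Fintype.card α).factorial * U.card := by
  simp only [Finset.card_filter]
  rw [Finset.sum_comm]
  have : ∀ π : Equiv.Perm α, ∑ X ∈ Finset.univ.powersetCard r,
      (if X.image π ∈ U then 1 else 0) = U.card := by
    intro π
    rw [← Finset.card_filter]
    refine Finset.card_bij' (fun X _ => X.image π) (fun X _ => X.image π.symm) ?_ ?_ ?_ ?_
    · intro X hX; exact (Finset.mem_filter.1 hX).2
    · intro X hX
      rw [Finset.mem_filter, Finset.mem_powersetCard,
        Finset.card_image_of_injective _ π.symm.injective]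
      refine ⟨⟨Finset.subset_univ _, hU X hX⟩, ?_⟩
      have := image_image_symm π.symm X
      rw [Equiv.symm_symm] at this
      rwa [this]
    · intro X _; exact image_image_symm π X
    · intro X _
      have := image_image_symm π.symm X
      rwa [Equiv.symm_symm] at this
  rw [Finset.sum_congr rfl fun π _ => this π, Finset.sum_const, Finset.card_univ,
    Fintype.card_perm, smul_eq_mul]

/-- A family of `r`-sets contains at least its proportional share of stable families. -/
theorem numStable_pow_le {r : ℕ} {U : Finset (Finset α)} (hU : ∀ X ∈ U, X.card = r) :
    numStable α r ^ U.card ≤ (stables U).card ^ (Fintype.card α).choose r := by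
  rcases U.eq_empty_or_nonempty with rfl | ⟨X0, hX0⟩
  · simpa using Nat.one_le_pow _ _ (card_stables_pos (∅ : Finset (Finset α)))
  set d := (Finset.univ.filter fun π : Equiv.Perm α => X0.image π ∈ U).card with hd
  have hd0 : 0 < d := Finset.card_pos.2 ⟨1, by simpa using hX0⟩
  have hcov : ∀ X ∈ (Finset.univ.powersetCard r : Finset (Finset α)),
      (Finset.univ.filter fun π : Equiv.Perm α => X.image π ∈ U).card = d := by
    intro X hX
    exact card_perm_image_mem U ((Finset.mem_powersetCard.1 hX).2.trans (hU _ hX0).symm)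
  have hdN : (Fintype.card α).choose r * d = (Fintype.card α).factorial * U.card := by
    rw [← sum_card_perm_image_mem hU, Finset.sum_congr rfl hcov, Finset.sum_const,
      Finset.card_powersetCard, Finset.card_univ, smul_eq_mul]
  -- Shearer is applied to the preimages of `U` under all permutations; each trace is carried by its
  -- permutation to a stable subfamily of `U`.
  have h := card_pow_le_prod_traces
    (fun π : Equiv.Perm α => Finset.univ.filter fun X : Finset α => X.image π ∈ U) hd0
    (Finset.univ.powersetCard r) (fun X hX => by simpa using hcov X hX)
    (stables (Finset.univ.powersetCard r)) (fun I hI => (mem_stables.1 hI).1)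
  have h1 : ∀ π : Equiv.Perm α, ((stables (Finset.univ.powersetCard r)).image
      (· ∩ Finset.univ.filter fun X : Finset α => X.image π ∈ U)).card ≤ (stables U).card := by
    intro π
    refine Finset.card_le_card_of_injOn (fun I => I.image fun X => X.image π) ?_ ?_
    · intro J hJ
      obtain ⟨I, hI, rfl⟩ := Finset.mem_image.1 hJ
      refine mem_stables.2 ⟨fun Y hY => ?_, ?_⟩
      · obtain ⟨X, hX, rfl⟩ := Finset.mem_image.1 hY
        exact (Finset.mem_filter.1 (Finset.mem_inter.1 hX).2).2
      · intro Y hY Y' hY'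
        obtain ⟨X, hX, rfl⟩ := Finset.mem_image.1 hY
        obtain ⟨X', hX', rfl⟩ := Finset.mem_image.1 hY'
        intro hA
        have := hA.image π.symm
        rw [image_image_symm, image_image_symm] at this
        exact (mem_stables.1 hI).2 X (Finset.mem_inter.1 hX).1 X' (Finset.mem_inter.1 hX').1 this
    · exact (Finset.image_injective (Finset.image_injective π.injective)).injOn
  have h2 : numStable α r ^ d ≤ (stables U).card ^ (Fintype.card α).factorial := by
    refine h.trans ((Finset.prod_le_prod' fun π _ => h1 π).trans_eq ?_)
    rw [Finset.prod_const, Finset.card_univ, Fintype.card_perm]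
  have h3 : (numStable α r ^ U.card) ^ (Fintype.card α).factorial ≤
      ((stables U).card ^ (Fintype.card α).choose r) ^ (Fintype.card α).factorial := by
    calc _ = (numStable α r ^ d) ^ (Fintype.card α).choose r := by
          rw [← pow_mul, ← pow_mul, mul_comm U.card, ← hdN, mul_comm]
      _ ≤ _ := Nat.pow_le_pow_left h2 _
      _ = _ := by rw [← pow_mul, ← pow_mul, mul_comm]
  exact (Nat.pow_le_pow_iff_left (Nat.factorial_ne_zero _)).1 h3

end Johnson

/-! ### Counting systems. -/

namespace Johnson

variable {α : Type*} [DecidableEq α] [Fintype α]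

open Classical in
variable (α) in
/-- The families that are unions of at most `k` building blocks. -/
noncomputable def unions (r k : ℕ) : Finset (Finset (Finset α)) :=
  Finset.univ.filter (IsUnion r k)

theorem mem_unions {r k : ℕ} {D : Finset (Finset α)} : D ∈ unions α r k ↔ IsUnion r k D := by
  simp [unions]

theorem card_unions_le (r k : ℕ) :
    (unions α r k).card ≤
      ((Finset.univ : Finset (Fin 3 × Finset α)).powerset.filter fun Z => Z.card ≤ k).card := by
  have : unions α r k ⊆ ((Finset.univ : Finset (Fin 3 × Finset α)).powerset.filter fun Z =>
      Z.card ≤ k).image fun Z => Z.biUnion (simple r) := by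
    intro D hD
    obtain ⟨Z, hZ, h⟩ := mem_unions.1 hD
    exact Finset.mem_image.2 ⟨Z, Finset.mem_filter.2 ⟨by simp, hZ⟩, h⟩
  exact (Finset.card_le_card this).trans Finset.card_image_le

/-- Families with a given set `U` of non-isolated members combine with the stable subfamilies
of `U`. -/
theorem card_mul_card_stables_le {r : ℕ} (hr : Mid α r) (U : Finset (Finset α))
    (𝒦 : Finset (Finset (Finset α))) (h : ∀ K ∈ 𝒦, IsSys r K ∧ big K = U) :
    𝒦.card * (stables U).card ≤ numStable α r := by
  rw [← Finset.card_product]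
  have hUK : ∀ K ∈ 𝒦, U ⊆ K := by
    intro K hK
    rw [← (h K hK).2]
    exact Finset.filter_subset _ _
  refine Finset.card_le_card_of_injOn (fun p => (p.1 \ U) ∪ p.2) ?_ ?_
  · rintro ⟨K, I⟩ hp
    obtain ⟨hK, hI⟩ := Finset.mem_product.1 hp
    obtain ⟨hI, hst⟩ := mem_stables.1 hI
    obtain ⟨hs, hU⟩ := h K hK
    dsimp only at *
    have hiso : ∀ X ∈ K \ U, ∀ Y ∈ K, ¬ Adj X Y := by
      intro X hX Y hY hXY
      rw [Finset.mem_sdiff, ← hU, hs.mem_big_iff hr] at hX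
      exact hX.2 ⟨hX.1, Y, hY, hXY⟩
    have hsub : (K \ U) ∪ I ⊆ K :=
      Finset.union_subset Finset.sdiff_subset (hI.trans (hUK K hK))
    refine mem_stables.2 ⟨fun X hX => ?_, fun X hX Y hY hXY => ?_⟩
    · exact Finset.mem_powersetCard.2 ⟨Finset.subset_univ _, hs.card_eq X (hsub hX)⟩
    · rcases Finset.mem_union.1 hX with hX' | hX'
      · exact hiso X hX' Y (hsub hY) hXY
      · rcases Finset.mem_union.1 hY with hY' | hY'
        · exact hiso Y hY' X (hsub hX) hXY.symm
        · exact hst X hX' Y hY' hXY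
  · rintro ⟨K, I⟩ hp ⟨K', I'⟩ hp' heq
    obtain ⟨hK, hI⟩ := Finset.mem_product.1 hp
    obtain ⟨hK', hI'⟩ := Finset.mem_product.1 hp'
    obtain ⟨hI, -⟩ := mem_stables.1 hI
    obtain ⟨hI', -⟩ := mem_stables.1 hI'
    have h1 := hUK K hK
    have h1' := hUK K' hK'
    dsimp only at *
    -- Since `I` lies in `U`, the part outside `U` recovers `K` and the part inside recovers `I`.
    have h2 : ∀ X, (X ∈ K ∧ X ∉ U ∨ X ∈ I) ↔ (X ∈ K' ∧ X ∉ U ∨ X ∈ I') := by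
      intro X
      simpa using congrArg (X ∈ ·) heq
    refine Prod.ext (Finset.ext fun X => ?_) (Finset.ext fun X => ?_)
    · have a1 := h2 X
      have a2 := @h1 X
      have a3 := @h1' X
      have a4 := @hI X
      have a5 := @hI' X
      dsimp only; tauto
    · have a1 := h2 X
      have a4 := @hI X
      have a5 := @hI' X
      dsimp only; tauto

/-- Counting the systems for which few representatives are not isolated. -/
theorem card_few_reps_le {r : ℕ} (hr : Mid α r) {m k j : ℕ} (𝒦 : Finset (Finset (Finset α)))
    (h : ∀ K ∈ 𝒦, IsSys r K ∧ (big K).card = m ∧ ∃ D R, IsUnion r k D ∧ IsContainer r K D ∧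
      IsReps K D R ∧ (R ∩ big K).card ≤ j) :
    (𝒦.card : ℝ) * (numStable α r : ℝ) ^ ((m : ℝ) / (Fintype.card α).choose r) ≤
      (unions α r k).card * (((Finset.univ.powersetCard r : Finset (Finset α)).powerset.filter
        fun J => J.card ≤ j).card : ℝ) * numStable α r := by
  classical
  have : Nonempty α := Fintype.card_pos_iff.1 hr.2.2
  -- Any element serves: no representative is in `D`, so `e` never matters.
  let e : α := Classical.arbitrary α
  have hN : 0 < (Fintype.card α).choose r :=
    Nat.choose_pos (by obtain ⟨h1, h2, h3⟩ := hr; omega)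
  set Js := (Finset.univ.powersetCard r : Finset (Finset α)).powerset.filter
    fun J => J.card ≤ j with hJs
  have hs1 : (1 : ℝ) ≤ numStable α r := by exact_mod_cast numStable_pos r
  have himg : (𝒦.image big).card ≤ (unions α r k).card * Js.card := by
    rw [← Finset.card_product]
    have : 𝒦.image big ⊆ (unions α r k ×ˢ Js).image fun p =>
        Finset.univ.filter fun X => Der r p.1 p.2 e X ∧ ∃ Y, Der r p.1 p.2 e Y ∧ Adj X Y := by
      intro U hU
      obtain ⟨K, hK, rfl⟩ := Finset.mem_image.1 hU
      obtain ⟨hs, hm, D, R, h1, h2, h3, h4⟩ := h K hK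
      refine Finset.mem_image.2 ⟨(D, R ∩ big K), Finset.mem_product.2
        ⟨mem_unions.2 h1, Finset.mem_filter.2 ⟨Finset.mem_powerset.2 fun X hX => ?_, h4⟩⟩, ?_⟩
      · exact Finset.mem_powersetCard.2 ⟨Finset.subset_univ _, hs.card_eq X
          (mem_big.1 (Finset.mem_inter.1 hX).2).1⟩
      · ext X
        rw [mem_big_iff_der hs hr h2 h3 e, Finset.mem_filter]
        simp
    exact (Finset.card_le_card this).trans Finset.card_image_le
  have hfib : ∀ U ∈ 𝒦.image big, (((𝒦.filter fun K => big K = U).card : ℕ) : ℝ) *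
      (numStable α r : ℝ) ^ ((m : ℝ) / (Fintype.card α).choose r) ≤ numStable α r := by
    intro U hU
    obtain ⟨K, hK, rfl⟩ := Finset.mem_image.1 hU
    have h1 := card_mul_card_stables_le hr (big K) (𝒦.filter fun K' => big K' = big K)
      fun K' hK' => ⟨(h K' (Finset.mem_filter.1 hK').1).1, (Finset.mem_filter.1 hK').2⟩
    have h2 := numStable_pow_le (U := big K) fun X hX => (h K hK).1.card_eq X (mem_big.1 hX).1
    rw [(h K hK).2.1] at h2
    -- Shearer's lower bound for the stable subfamilies of `big K`, after taking binom(n,r)-th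
    -- roots.
    have h3 : (numStable α r : ℝ) ^ ((m : ℝ) / (Fintype.card α).choose r) ≤
        (stables (big K)).card := by
      have hN' : (0 : ℝ) < (Fintype.card α).choose r := by exact_mod_cast hN
      rw [div_eq_mul_inv, Real.rpow_mul (by positivity), Real.rpow_natCast]
      refine (Real.rpow_le_rpow (by positivity)
        (by exact_mod_cast h2 : (numStable α r : ℝ) ^ m ≤
          ((stables (big K)).card : ℝ) ^ (Fintype.card α).choose r) (by positivity)).trans_eq ?_
      exact Real.pow_rpow_inv_natCast (by positivity) hN.ne'
    calc _ ≤ (((𝒦.filter fun K' => big K' = big K).card : ℕ) : ℝ) * (stables (big K)).card := by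
          gcongr
      _ ≤ _ := by exact_mod_cast h1
  have hsum : (𝒦.card : ℝ) = ∑ U ∈ 𝒦.image big, ((𝒦.filter fun K => big K = U).card : ℝ) := by
    exact_mod_cast Finset.card_eq_sum_card_image big 𝒦
  rw [hsum, Finset.sum_mul]
  refine (Finset.sum_le_card_nsmul _ _ _ hfib).trans ?_
  rw [nsmul_eq_mul]
  gcongr
  exact_mod_cast himg

/-- Counting the systems for which many representatives have nontrivial span. -/
theorem card_many_ins_le {r : ℕ} (hr : Mid α r) {k q : ℕ} (𝒦 : Finset (Finset (Finset α)))
    (h : ∀ K ∈ 𝒦, IsSys r K ∧ ∃ D R, IsUnion r k D ∧ IsContainer r K D ∧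
      IsReps K D R ∧ 8 * q ≤ (R.filter fun X => (ins K X).Nonempty).card) :
    𝒦.card * 2 ^ q ≤ (unions α r k).card * Fintype.card α * numStable α r := by
  classical
  have : Nonempty α := Fintype.card_pos_iff.1 hr.2.2
  have hdata : ∀ K, ∃ (D : Finset (Finset α)) (R : Finset (Finset α)) (f : Finset α → α) (e : α)
      (T : Finset (Finset α)), K ∈ 𝒦 → IsUnion r k D ∧ IsContainer r K D ∧ IsReps K D R ∧
        T ⊆ active K D R f e ∧ T.card = q := by
    intro K
    by_cases hK : K ∈ 𝒦
    · obtain ⟨hs, D, R, h1, h2, h3, h4⟩ := h K hK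
      have hf : ∀ X, ∃ y, (ins K X).Nonempty → y ∈ ins K X := by
        intro X
        by_cases hX : (ins K X).Nonempty
        · obtain ⟨y, hy⟩ := hX; exact ⟨y, fun _ => hy⟩
        · exact ⟨Classical.arbitrary α, fun h => absurd h hX⟩
      choose f hf using hf
      obtain ⟨e, he⟩ := exists_card_active hr h2 h3 (f := f) fun X _ => hf X
      obtain ⟨T, hT, hTq⟩ := Finset.exists_subset_card_eq (s := active K D R f e) (n := q)
        (by omega)
      exact ⟨D, R, f, e, T, fun _ => ⟨h1, h2, h3, hT, hTq⟩⟩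
    · exact ⟨∅, ∅, fun _ => Classical.arbitrary α, Classical.arbitrary α, ∅, fun h => absurd h hK⟩
  choose D R f e T hd using hdata
  have hder : ∀ K ∈ 𝒦, ∀ S ⊆ T K, ∀ X,
      Der r (D K) (moved (R K) S (f K) (e K)) (e K) X ↔ X ∈ K := by
    intro K hK S hS X
    obtain ⟨h1, h2, h3, h4, h5⟩ := hd K hK
    exact der_moved_iff (h K hK).1 hr h2 h3 (hS.trans h4) X
  have hcard : 𝒦.card * 2 ^ q = (𝒦.sigma fun K => (T K).powerset).card := by
    rw [Finset.card_sigma, Finset.sum_congr rfl (g := fun _ => 2 ^ q), Finset.sum_const,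
      smul_eq_mul]
    intro K hK
    rw [Finset.card_powerset, (hd K hK).2.2.2.2]
  have hcard' : (unions α r k).card * Fintype.card α * numStable α r =
      (unions α r k ×ˢ (Finset.univ : Finset α) ×ˢ
        stables (Finset.univ.powersetCard r : Finset (Finset α))).card := by
    rw [Finset.card_product, Finset.card_product, Finset.card_univ, numStable, mul_assoc]
  rw [hcard, hcard']
  -- The code (D, e, moved family) yields `K` by derivation; knowing `K`, the part of the moved
  -- family in `D` yields the chosen subset of moves.
  refine Finset.card_le_card_of_injOn
    (fun p => (D p.1, e p.1, moved (R p.1) p.2 (f p.1) (e p.1))) ?_ ?_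
  · rintro ⟨K, S⟩ hp
    obtain ⟨hK, hS⟩ := Finset.mem_sigma.1 hp
    rw [Finset.mem_powerset] at hS
    dsimp only at hK hS ⊢
    obtain ⟨h1, h2, h3, h4, h5⟩ := hd K hK
    refine Finset.mem_product.2 ⟨mem_unions.2 h1, Finset.mem_product.2 ⟨Finset.mem_univ _,
      mem_stables.2 ⟨fun X hX => ?_, stable_moved (h K hK).1 hr h3 (hS.trans h4)⟩⟩⟩
    exact Finset.mem_powersetCard.2 ⟨Finset.subset_univ _, (h K hK).1.card_eq X
      ((hder K hK S hS X).1 (.of_mem_right hX))⟩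
  · rintro ⟨K, S⟩ hp ⟨K', S'⟩ hp' heq
    obtain ⟨hK, hS⟩ := Finset.mem_sigma.1 hp
    obtain ⟨hK', hS'⟩ := Finset.mem_sigma.1 hp'
    rw [Finset.mem_powerset] at hS hS'
    dsimp only at hK hS hK' hS'
    simp only [Prod.mk.injEq] at heq
    obtain ⟨e1, e2, e3⟩ := heq
    have hKK : K = K' := by
      ext X
      rw [← hder K hK S hS X, ← hder K' hK' S' hS' X, e3, e1, e2]
    subst hKK
    obtain ⟨h1, h2, h3, h4, h5⟩ := hd K hK
    rw [moved_injective (h K hK).1 hr h3 (hS.trans h4) (hS'.trans h4) e3]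

theorem unions_dual_card {r : ℕ} (hr : r ≤ Fintype.card α) (k : ℕ) :
    (unions α (Fintype.card α - r) k).card = (unions α r k).card := by
  refine Finset.card_bij' (fun D _ => dual D) (fun D _ => dual D) ?_ ?_ ?_ ?_
  · intro D hD
    have := (mem_unions.1 hD).dual (Nat.sub_le _ _)
    rw [Nat.sub_sub_self hr] at this
    exact mem_unions.2 this
  · exact fun D hD => mem_unions.2 ((mem_unions.1 hD).dual hr)
  · exact fun D _ => dual_dual D
  · exact fun D _ => dual_dual D

theorem numStable_dual {r : ℕ} (hr : r ≤ Fintype.card α) :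
    numStable α (Fintype.card α - r) = numStable α r := by
  have key : ∀ r ≤ Fintype.card α, ∀ I ∈ stables (Finset.univ.powersetCard r : Finset (Finset α)),
      dual I ∈ stables (Finset.univ.powersetCard (Fintype.card α - r) : Finset (Finset α)) := by
    intro r hr I hI
    obtain ⟨h1, h2⟩ := mem_stables.1 hI
    refine mem_stables.2 ⟨fun X hX => ?_, fun X hX Y hY hXY => ?_⟩
    · have := (Finset.mem_powersetCard.1 (h1 (mem_dual.1 hX))).2
      rw [Finset.card_compl] at this
      have := Finset.card_le_univ X
      exact Finset.mem_powersetCard.2 ⟨Finset.subset_univ _, by omega⟩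
    · exact h2 _ (mem_dual.1 hX) _ (mem_dual.1 hY) (adj_compl hXY)
  refine Finset.card_bij' (fun D _ => dual D) (fun D _ => dual D) ?_ (key r hr) ?_ ?_
  · intro I hI
    have := key _ (Nat.sub_le _ _) I hI
    rwa [Nat.sub_sub_self hr] at this
  · exact fun D _ => dual_dual D
  · exact fun D _ => dual_dual D

/-- Counting the systems for which many representatives have nontrivial core. -/
theorem card_many_outs_le {r : ℕ} (hr : Mid α r) {k q : ℕ} (𝒦 : Finset (Finset (Finset α)))
    (h : ∀ K ∈ 𝒦, IsSys r K ∧ ∃ D R, IsUnion r k D ∧ IsContainer r K D ∧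
      IsReps K D R ∧ 8 * q ≤ (R.filter fun X => (outs K X).Nonempty).card) :
    𝒦.card * 2 ^ q ≤ (unions α r k).card * Fintype.card α * numStable α r := by
  have hrn : r ≤ Fintype.card α := by obtain ⟨h2, h3, h4⟩ := hr; omega
  have := card_many_ins_le hr.dual (k := k) (q := q) (𝒦.image dual) (by
    intro K' hK'
    obtain ⟨K, hK, rfl⟩ := Finset.mem_image.1 hK'
    obtain ⟨hs, D, R, h1, h2, h3, h4⟩ := h K hK
    refine ⟨hs.dual, dual D, dual R, h1.dual hrn, h2.dual hrn, h3.dual, h4.trans ?_⟩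
    refine Finset.card_le_card_of_injOn compl ?_ compl_injective.injOn
    intro X hX
    rw [Finset.mem_coe, Finset.mem_filter] at hX ⊢
    rw [compl_mem_dual, ins_dual]
    exact hX)
  rwa [Finset.card_image_of_injective _ dual_injective, unions_dual_card hrn,
    numStable_dual hrn] at this

/-- The systems with `m` non-isolated members are few compared to the stable families. -/
theorem card_systems_le {r : ℕ} (hr : Mid α r) (m k q : ℕ)
    (hk : 1024 * (m : ℝ) * Real.log (Fintype.card α) + 2 * (Fintype.card α : ℝ) ^ 2 + 10 * m +
      4096 * (Fintype.card α).choose r ≤ k * (Fintype.card α : ℝ) ^ 2)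
    (𝒦 : Finset (Finset (Finset α))) (h : ∀ K ∈ 𝒦, IsSys r K ∧ (big K).card = m) :
    (𝒦.card : ℝ) ≤ (unions α r k).card * numStable α r *
      ((((Finset.univ.powersetCard r : Finset (Finset α)).powerset.filter
        fun J => J.card ≤ 16 * q).card : ℝ) /
          (numStable α r : ℝ) ^ ((m : ℝ) / (Fintype.card α).choose r) +
        2 * Fintype.card α / 2 ^ q) := by
  classical
  have hdata : ∀ K, ∃ D R : Finset (Finset α), K ∈ 𝒦 → IsUnion r k D ∧ IsContainer r K D ∧
      IsReps K D R := by
    intro K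
    by_cases hK : K ∈ 𝒦
    · obtain ⟨D, k', h1, h2, h3⟩ := (h K hK).1.exists_container hr
      obtain ⟨R, hR⟩ := exists_isReps K D
      refine ⟨D, R, fun _ => ⟨h1.mono ?_, h2, hR⟩⟩
      rw [(h K hK).2] at h3
      have hn : (0 : ℝ) < (Fintype.card α : ℝ) ^ 2 := by
        have : (0 : ℝ) < Fintype.card α := by exact_mod_cast hr.2.2
        positivity
      exact_mod_cast le_of_mul_le_mul_right (h3.trans hk) hn
    · exact ⟨∅, ∅, fun h => absurd h hK⟩
  choose D R hd using hdata
  set 𝒜 := 𝒦.filter fun K => (R K ∩ big K).card ≤ 16 * q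
  set ℬ := 𝒦.filter fun K => 8 * q ≤ ((R K).filter fun X => (ins K X).Nonempty).card
  set 𝒞 := 𝒦.filter fun K => 8 * q ≤ ((R K).filter fun X => (outs K X).Nonempty).card
  -- More than 16q representatives in `big K` force at least 8q with nonempty `ins` or at least 8q
  -- with nonempty `outs`.
  have hsub : 𝒦 ⊆ 𝒜 ∪ (ℬ ∪ 𝒞) := by
    intro K hK
    by_contra hc
    simp only [𝒜, ℬ, 𝒞, Finset.mem_union, Finset.mem_filter, hK, true_and, not_or, not_le] at hc
    obtain ⟨c1, c2, c3⟩ := hc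
    have : R K ∩ big K ⊆ ((R K).filter fun X => (ins K X).Nonempty) ∪
        ((R K).filter fun X => (outs K X).Nonempty) := by
      intro X hX
      obtain ⟨h1, h2⟩ := Finset.mem_inter.1 hX
      rw [Finset.mem_union, Finset.mem_filter, Finset.mem_filter]
      rcases (mem_big.1 h2).2 with h | h
      · exact Or.inr ⟨h1, h⟩
      · exact Or.inl ⟨h1, h⟩
    have := (Finset.card_le_card this).trans (Finset.card_union_le _ _)
    omega
  have h1 := card_few_reps_le hr (m := m) (k := k) (j := 16 * q) 𝒜 (fun K hK => by
    obtain ⟨hK, hq⟩ := Finset.mem_filter.1 hK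
    exact ⟨(h K hK).1, (h K hK).2, D K, R K, (hd K hK).1, (hd K hK).2.1, (hd K hK).2.2, hq⟩)
  have h2 := card_many_ins_le hr (k := k) (q := q) ℬ (fun K hK => by
    obtain ⟨hK, hq⟩ := Finset.mem_filter.1 hK
    exact ⟨(h K hK).1, D K, R K, (hd K hK).1, (hd K hK).2.1, (hd K hK).2.2, hq⟩)
  have h3 := card_many_outs_le hr (k := k) (q := q) 𝒞 (fun K hK => by
    obtain ⟨hK, hq⟩ := Finset.mem_filter.1 hK
    exact ⟨(h K hK).1, D K, R K, (hd K hK).1, (hd K hK).2.1, (hd K hK).2.2, hq⟩)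
  have h4 : (𝒦.card : ℝ) ≤ 𝒜.card + (ℬ.card + 𝒞.card) := by
    exact_mod_cast (Finset.card_le_card hsub).trans ((Finset.card_union_le _ _).trans
      (Nat.add_le_add_left (Finset.card_union_le _ _) _))
  have hs0 : (0 : ℝ) < numStable α r := by exact_mod_cast numStable_pos r
  have h2' : (ℬ.card : ℝ) ≤ (unions α r k).card * Fintype.card α * numStable α r / 2 ^ q := by
    rw [le_div_iff₀ (by positivity)]; exact_mod_cast h2
  have h3' : (𝒞.card : ℝ) ≤ (unions α r k).card * Fintype.card α * numStable α r / 2 ^ q := by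
    rw [le_div_iff₀ (by positivity)]; exact_mod_cast h3
  rw [← le_div_iff₀ (by positivity)] at h1
  refine (h4.trans (add_le_add h1 (add_le_add h2' h3'))).trans_eq ?_
  ring

end Johnson

/-! ### Nonbases of matroids as systems. -/

namespace Johnson

variable {α : Type*}

theorem card_of_isBase {M : Matroid α} {r : ℕ} (hr : M.eRank = r) {X : Finset α} (h : M.IsBase (X : Set α)) :
    X.card = r := by
  have := h.encard_eq_eRank
  rw [hr, Set.encard_coe_eq_coe_finsetCard] at this
  exact_mod_cast this

section Nonbases

variable [Fintype α]

open Classical in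
/-- The `r`-element sets that are not bases. -/
noncomputable def nonbaseFinset (M : Matroid α) (r : ℕ) : Finset (Finset α) :=
  (Finset.univ.powersetCard r).filter fun X => ¬ M.IsBase (X : Set α)

theorem mem_nonbaseFinset {M : Matroid α} {r : ℕ} {X : Finset α} :
    X ∈ nonbaseFinset M r ↔ X.card = r ∧ ¬ M.IsBase (X : Set α) := by
  simp [nonbaseFinset, Finset.mem_powersetCard]

theorem isBase_of_indep {M : Matroid α} {r : ℕ} (hr : M.eRank = r) {X : Finset α} (h : M.Indep (X : Set α))
    (hX : X.card = r) : M.IsBase (X : Set α) := by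
  obtain ⟨B, hB, hXB⟩ := h.exists_isBase_superset
  lift B to Finset α using B.toFinite
  have h1 := card_of_isBase hr hB
  have h2 : X = B := Finset.eq_of_subset_of_card_le (by exact_mod_cast hXB) (by omega)
  rwa [h2]

theorem rank_le_card {M : Matroid α} {r : ℕ} (hr : M.eRank = r) : r ≤ Fintype.card α := by
  obtain ⟨B, hB⟩ := M.exists_isBase
  lift B to Finset α using B.toFinite
  rw [← card_of_isBase hr hB]
  exact Finset.card_le_univ B

theorem eRank_dual_of {M : Matroid α} {r : ℕ} (hE : M.E = Set.univ) (hr : M.eRank = r) :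
    M✶.eRank = (Fintype.card α - r : ℕ) := by
  have h := M.eRank_add_eRank_dual
  have h1 := rank_le_card hr
  have h2 : (Set.univ : Set α).encard = (Fintype.card α : ℕ) := by
    rw [Set.encard_univ, ENat.card_eq_coe_fintype_card]
  rw [hE, h2, hr] at h
  have h3 : (Fintype.card α : ℕ∞) = (r : ℕ∞) + (Fintype.card α - r : ℕ) := by
    rw [← Nat.cast_add, Nat.add_sub_cancel' h1]
  rw [h3] at h
  exact ENat.add_right_injective_of_ne_top (ENat.natCast_ne_top r) h

theorem nonbaseFinset_injective {M N : Matroid α} {r : ℕ} (hM : M.E = Set.univ) (hN : N.E = Set.univ)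
    (hr : M.eRank = r) (hr' : N.eRank = r) (h : nonbaseFinset M r = nonbaseFinset N r) :
    M = N := by
  refine Matroid.ext_isBase (hM.trans hN.symm) fun B _ => ?_
  lift B to Finset α using B.toFinite
  have h1 : B ∈ nonbaseFinset M r ↔ B ∈ nonbaseFinset N r := by rw [h]
  rw [mem_nonbaseFinset, mem_nonbaseFinset] at h1
  constructor
  · intro hB
    by_contra hc
    exact (h1.2 ⟨card_of_isBase hr hB, hc⟩).2 hB
  · intro hB
    by_contra hc
    exact (h1.1 ⟨card_of_isBase hr' hB, hc⟩).2 hB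

end Nonbases

variable [DecidableEq α]

/-- For two candidates y, z in B' \ B the sets B-a+y and B-a+z are adjacent, so they are not both in
`I`. If there is only one candidate, the exchange produces B' itself. -/
theorem Stable.exchange {r : ℕ} {I : Finset (Finset α)} (hI : Stable I) {B B' : Finset α}
    (hB : B.card = r) (hB' : B'.card = r) (hBI' : B' ∉ I) {a : α} (ha : a ∈ B)
    (ha' : a ∉ B') : ∃ b ∈ B', b ∉ B ∧ sw B a b ∉ I := by
  have h1 : (B' \ B).card = (B \ B').card := Finset.card_sdiff_comm (by omega)
  have h2 : 0 < (B \ B').card := Finset.card_pos.2 ⟨a, Finset.mem_sdiff.2 ⟨ha, ha'⟩⟩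
  rcases Nat.lt_or_ge 1 (B' \ B).card with h3 | h3
  · obtain ⟨y, hy, z, hz, hyz⟩ := Finset.one_lt_card.1 h3
    rw [Finset.mem_sdiff] at hy hz
    by_cases h : sw B a y ∈ I
    · refine ⟨z, hz.1, hz.2, fun h' => hI _ h _ h' ⟨y, ?_, z, ?_, ?_⟩⟩
      · rw [mem_sw]; exact Or.inl rfl
      · rw [mem_sw, not_or]; exact ⟨hyz.symm, fun h => hz.2 h.2⟩
      · rw [sw, sw, sw, Finset.erase_insert fun h => hy.2 (Finset.mem_of_mem_erase h)]
    · exact ⟨y, hy.1, hy.2, h⟩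
  · obtain ⟨b, hb⟩ := Finset.card_eq_one.1 (by omega : (B' \ B).card = 1)
    have hb' : b ∈ B' \ B := by rw [hb]; exact Finset.mem_singleton_self _
    rw [Finset.mem_sdiff] at hb'
    refine ⟨b, hb'.1, hb'.2, ?_⟩
    have : B' = sw B a b := by
      refine Finset.eq_of_subset_of_card_le (fun w hw => ?_) (by rw [sw_card ha hb'.2]; omega)
      rw [mem_sw]
      by_cases hwB : w ∈ B
      · exact Or.inr ⟨fun h => ha' (h ▸ hw), hwB⟩
      · left
        have : w ∈ B' \ B := Finset.mem_sdiff.2 ⟨hw, hwB⟩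
        rwa [hb, Finset.mem_singleton] at this
    rwa [← this]

variable [Fintype α]

section Rank

variable {M : Matroid α} {r : ℕ}

theorem exists_isBase_insert (hr : M.eRank = r) {I B : Finset α} (hI : M.Indep (I : Set α))
    (hIr : I.card + 1 = r) (hB : M.IsBase (B : Set α)) :
    ∃ z ∈ B, z ∉ I ∧ M.IsBase (insert z I : Finset α) := by
  have h1 : ¬ M.IsBase (I : Set α) := fun h => by have := card_of_isBase hr h; omega
  obtain ⟨z, hz, h⟩ := hI.exists_insert_of_not_isBase h1 hB
  have h2 : z ∉ I := by simpa using hz.2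
  refine ⟨z, by simpa using hz.1, h2, isBase_of_indep hr (by simpa using h) ?_⟩
  rw [Finset.card_insert_of_notMem h2, hIr]

theorem isBase_sw (hX : X ∈ nonbaseFinset M r) {x y : α} (hx : x ∈ X) (hy : y ∉ X)
    (h : sw X x y ∉ nonbaseFinset M r) : M.IsBase (sw X x y : Set α) := by
  rw [mem_nonbaseFinset, not_and, not_not] at h
  exact h (by rw [sw_card hx hy, (mem_nonbaseFinset.1 hX).1])

theorem exists_isBase_insert_erase (hr : M.eRank = r) {X B : Finset α}
    (hX : X ∈ nonbaseFinset M r) {x y : α} (hx : x ∈ X) (hy : M.IsBase (sw X x y : Set α))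
    (hB : M.IsBase (B : Set α)) : ∃ z ∈ B, z ∉ X ∧ M.IsBase (sw X x z : Set α) := by
  obtain ⟨hXr, hXb⟩ := mem_nonbaseFinset.1 hX
  have hI : M.Indep (X.erase x : Set α) := hy.indep.subset (by
    exact_mod_cast Finset.subset_insert _ _)
  have := Finset.card_pos.2 ⟨x, hx⟩
  obtain ⟨z, hz, hzI, h⟩ := exists_isBase_insert hr hI
    (by rw [Finset.card_erase_of_mem hx]; omega) hB
  refine ⟨z, hz, fun hzX => ?_, h⟩
  have hzx : z = x := by
    by_contra hne
    exact hzI (Finset.mem_erase.2 ⟨hne, hzX⟩)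
  rw [hzx, Finset.insert_erase hx] at h
  exact hXb h

/-- Otherwise X-x+y' and X-x'+y are bases for some x', y'. Then X-x is independent and is augmented
from X-x'+y by an element outside `X`, which can only be y; so X-x+y would be a basis. -/
theorem nonbaseFinset_mem_or (hr : M.eRank = r) (X : Finset α) (hX : X ∈ nonbaseFinset M r)
    (x : α) (hx : x ∈ X) (y : α) (hy : y ∉ X) (h : sw X x y ∈ nonbaseFinset M r) :
    x ∈ outs (nonbaseFinset M r) X ∨ y ∈ ins (nonbaseFinset M r) X := by
  by_contra! hc
  simp only [mem_outs, mem_ins, hx, hy, true_and, not_forall, not_false_eq_true] at hc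
  obtain ⟨⟨y', hy', h1⟩, x', hx', h2⟩ := hc
  obtain ⟨z, hz, hzX, hb⟩ := exists_isBase_insert_erase hr hX hx (isBase_sw hX hx hy' h1)
    (isBase_sw hX hx' hy h2)
  rcases mem_sw.1 hz with rfl | hz
  · exact (mem_nonbaseFinset.1 h).2 hb
  · exact hzX hz.2

/-- A basis inside the span would augment some independent X-x by an element of `ins`, contrary to
the definition of `ins`. -/
theorem nonbaseFinset_of_subset_spn (hr : M.eRank = r) (X : Finset α)
    (hX : Nondeep (nonbaseFinset M r) X) (Y : Finset α) (hY : Y.card = r)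
    (hYX : Y ⊆ spn (nonbaseFinset M r) X) : Y ∈ nonbaseFinset M r := by
  obtain ⟨hX, x, hx, y, hy, h⟩ := hX
  by_contra hc
  rw [mem_nonbaseFinset, not_and, not_not] at hc
  obtain ⟨z, hz, hzX, hb⟩ := exists_isBase_insert_erase hr hX hx (isBase_sw hX hx hy h) (hc hY)
  have := (mem_spn.1 (hYX hz)).resolve_left hzX
  exact (mem_nonbaseFinset.1 ((mem_ins.1 this).2 x hx)).2 hb

theorem isBase_dual_compl (hE : M.E = Set.univ) {X : Finset α} :
    M✶.IsBase ((Xᶜ : Finset α) : Set α) ↔ M.IsBase (X : Set α) := by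
  rw [Matroid.dual_isBase_iff (by simp [hE]), hE, Finset.coe_compl, ← Set.compl_eq_univ_sdiff,
    compl_compl]

theorem nonbaseFinset_dual (hE : M.E = Set.univ) (hr : M.eRank = r) :
    nonbaseFinset M✶ (Fintype.card α - r) = dual (nonbaseFinset M r) := by
  ext X
  rw [mem_dual, mem_nonbaseFinset, mem_nonbaseFinset, ← isBase_dual_compl hE, compl_compl,
    Finset.card_compl]
  have := rank_le_card hr
  have := Finset.card_le_univ X
  refine and_congr_left fun _ => ?_
  omega

/-- The nonbases of a matroid form a system. -/
theorem isSys_nonbaseFinset (hE : M.E = Set.univ) (hr : M.eRank = r) :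
    IsSys r (nonbaseFinset M r) where
  card_eq X hX := (mem_nonbaseFinset.1 hX).1
  mem_or := nonbaseFinset_mem_or hr
  of_subset_spn := nonbaseFinset_of_subset_spn hr
  of_cor_subset X hX Y hY hXY := by
    have h := nonbaseFinset_of_subset_spn (eRank_dual_of hE hr) Xᶜ (by
      rw [nonbaseFinset_dual hE hr]; exact hX.dual) Yᶜ (by rw [Finset.card_compl, hY]) (by
      rw [nonbaseFinset_dual hE hr, spn_dual]
      exact Finset.compl_subset_compl.2 hXY)
    rwa [nonbaseFinset_dual hE hr, compl_mem_dual] at h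

/-- For a circuit-hyperplane, X-x is independent and any y outside is not in its closure, so all
neighbours are bases. Conversely, if all neighbours are bases then all X-x are independent, and a
further element in the closure would make `X` spanning and hence a basis. -/
theorem isCircuitHyperplane_iff (hE : M.E = Set.univ) (hr : M.eRank = r) (hm : Mid α r)
    {X : Finset α} (hX : X ∈ nonbaseFinset M r) :
    M.IsCircuitHyperplane (X : Set α) ↔ ∀ Y ∈ nonbaseFinset M r, ¬ Adj X Y := by
  obtain ⟨hXr, hXb⟩ := mem_nonbaseFinset.1 hX
  obtain ⟨m1, m2, m3⟩ := hm
  constructor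
  · rintro ⟨hC, hF, -⟩ Y hY ⟨x, hx, y, hy, rfl⟩
    have hI : M.Indep ((X.erase x : Finset α) : Set α) := by
      rw [Finset.coe_erase]
      exact hC.sdiff_singleton_indep (by exact_mod_cast hx)
    have hyI : y ∉ M.closure ((X.erase x : Finset α) : Set α) := by
      intro h
      have h1 := M.closure_subset_closure
        (show ((X.erase x : Finset α) : Set α) ⊆ X by exact_mod_cast Finset.erase_subset _ _) h
      rw [hF.closure] at h1
      exact hy (by exact_mod_cast h1)
    refine (mem_nonbaseFinset.1 hY).2 (isBase_of_indep hr ?_ (mem_nonbaseFinset.1 hY).1)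
    rw [sw, Finset.coe_insert, hI.insert_indep_iff]
    exact Or.inl ⟨by simp [hE], hyI⟩
  · intro h
    have hb : ∀ x ∈ X, ∀ y, y ∉ X → M.IsBase (sw X x y : Set α) := fun x hx y hy =>
      isBase_sw hX hx hy fun hY => h _ hY ⟨x, hx, y, hy, rfl⟩
    obtain ⟨y₀, hy₀⟩ : ∃ y, y ∉ X := by
      by_contra! hc
      rw [Finset.eq_univ_iff_forall.2 hc, Finset.card_univ] at hXr
      omega
    obtain ⟨x₀, hx₀⟩ : X.Nonempty := Finset.card_pos.1 (by omega)
    have hd : M.Dep (X : Set α) := by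
      rw [Matroid.dep_iff]
      exact ⟨fun hi => hXb (isBase_of_indep hr hi hXr), by simp [hE]⟩
    have hC : M.IsCircuit (X : Set α) := by
      rw [Matroid.isCircuit_iff_dep_forall_sdiff_singleton_indep]
      refine ⟨hd, fun x hx => ?_⟩
      have hx : x ∈ X := by exact_mod_cast hx
      rw [← Finset.coe_erase]
      exact (hb x hx y₀ hy₀).indep.subset (by exact_mod_cast Finset.subset_insert _ _)
    refine ⟨hC, ?_, ?_⟩
    · rw [Matroid.isFlat_iff_closure_eq]
      refine subset_antisymm (fun y hy => ?_) (M.subset_closure _ (by simp [hE]))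
      by_contra hyX
      have hyX : y ∉ X := by exact_mod_cast hyX
      have hB := hb x₀ hx₀ y hyX
      have hBX : (sw X x₀ y : Set α) ⊆ M.closure X := by
        intro w hw
        rcases mem_sw.1 (by exact_mod_cast hw : w ∈ sw X x₀ y) with rfl | hw
        · exact hy
        · exact M.subset_closure _ (by simp [hE]) (by exact_mod_cast hw.2)
      have hsp : M.Spanning (X : Set α) := by
        rw [Matroid.spanning_iff_ground_subset_closure (by simp [hE]), ← hB.closure_eq]
        exact M.closure_subset_closure_of_subset_closure hBX
      obtain ⟨B, hB', hBX'⟩ := hsp.exists_isBase_subset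
      lift B to Finset α using B.toFinite
      have h1 := card_of_isBase hr hB'
      have h2 : B = X := Finset.eq_of_subset_of_card_le (by exact_mod_cast hBX') (by omega)
      exact hXb (h2 ▸ hB')
    · have h1 := (hC.sdiff_singleton_isBasis (e := x₀) (by exact_mod_cast hx₀)).eRk_eq_encard
      rw [h1, ← Finset.coe_erase, Set.encard_coe_eq_coe_finsetCard, Finset.card_erase_of_mem hx₀,
        hr, hXr]
      have : r - 1 + 1 = r := by omega
      exact_mod_cast congrArg (Nat.cast : ℕ → ℕ∞) this

theorem bigNonbases_eq (hE : M.E = Set.univ) (hr : M.eRank = r) (hm : Mid α r) :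
    M.bigNonbases = (fun X : Finset α => (X : Set α)) '' (big (nonbaseFinset M r)) := by
  have key : ∀ X : Finset α, (X : Set α) ∈ M.bigNonbases ↔ X ∈ big (nonbaseFinset M r) := by
    intro X
    have h1 : (X : Set α) ∈ M.nonbases ↔ X ∈ nonbaseFinset M r := by
      rw [mem_nonbaseFinset]
      simp only [Matroid.nonbases, Set.mem_ofPred_eq, hE, Set.subset_univ, true_and, hr,
        Set.encard_coe_eq_coe_finsetCard, Nat.cast_inj]
    rw [Matroid.bigNonbases, Set.mem_sdiff, h1, (isSys_nonbaseFinset hE hr).mem_big_iff hm]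
    refine and_congr_right fun hX => ?_
    rw [Matroid.circuitHyperplanes, Set.mem_ofPred_eq, isCircuitHyperplane_iff hE hr hm hX]
    push Not
    rfl
  ext X
  lift X to Finset α using X.toFinite
  rw [key]
  simp

theorem ncard_bigNonbases (hE : M.E = Set.univ) (hr : M.eRank = r) (hm : Mid α r) :
    M.bigNonbases.ncard = (big (nonbaseFinset M r)).card := by
  rw [bigNonbases_eq hE hr hm, Set.ncard_image_of_injective _ Finset.coe_injective,
    Set.ncard_coe_finset]

end Rank

/-! ### Sparse paving matroids from stable families. -/

/-- Enlarge `A` to an (r-1)-set T; two sets T+y and T+z are adjacent and cannot both be in `I`. This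
makes all sets of fewer than r elements independent, which gives paving for the matroid and, by
complements, for its dual. -/
theorem exists_notMem_of_subset {r : ℕ} {I : Finset (Finset α)} (hI : Stable I) (hr0 : 0 < r)
    (hr1 : r < Fintype.card α) {A : Finset α} (hA : A.card + 1 ≤ r) :
    ∃ B, A ⊆ B ∧ B.card = r ∧ B ∉ I := by
  obtain ⟨T, hT, -, hTr⟩ := Finset.exists_subsuperset_card_eq (Finset.subset_univ A)
    (n := r - 1) (by omega) (by rw [Finset.card_univ]; omega)
  have h1 : 1 < Tᶜ.card := by rw [Finset.card_compl]; omega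
  obtain ⟨y, hy, z, hz, hyz⟩ := Finset.one_lt_card.1 h1
  rw [Finset.mem_compl] at hy hz
  have hins : ∀ w, w ∉ T → (insert w T).card = r := fun w hw => by
    rw [Finset.card_insert_of_notMem hw]; omega
  by_cases h : insert y T ∈ I
  · refine ⟨insert z T, hT.trans (Finset.subset_insert _ _), hins z hz, fun h' => ?_⟩
    refine hI _ h _ h' ⟨y, Finset.mem_insert_self _ _, z, ?_, ?_⟩
    · rw [Finset.mem_insert, not_or]; exact ⟨hyz.symm, hz⟩
    · rw [sw, Finset.erase_insert hy]
  · exact ⟨insert y T, hT.trans (Finset.subset_insert _ _), hins y hy, h⟩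

/-- The stable families of `r`-sets are the sets of nonbases of sparse paving matroids. -/
theorem exists_sparsePaving {r : ℕ} (hr0 : 0 < r) (hr1 : r < Fintype.card α)
    {I : Finset (Finset α)} (hI : I ∈ stables (Finset.univ.powersetCard r : Finset (Finset α))) :
    ∃ M : Matroid α, M.E = Set.univ ∧ M.IsSparsePaving ∧ nonbaseFinset M r = I ∧
      M.eRank = r := by
  obtain ⟨hIr, hst⟩ := mem_stables.1 hI
  let P : Set α → Prop := fun X => ∃ B : Finset α, (B : Set α) = X ∧ B.card = r ∧ B ∉ I
  have hP : ∀ B : Finset α, P B ↔ B.card = r ∧ B ∉ I := by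
    intro B
    constructor
    · rintro ⟨B', h, h1⟩
      rwa [← Finset.coe_injective h]
    · exact fun h => ⟨B, rfl, h⟩
  obtain ⟨B₀, -, h0, h0'⟩ := exists_notMem_of_subset hst hr0 hr1 (A := ∅)
    (by rw [Finset.card_empty]; omega)
  let M : Matroid α := Matroid.ofIsBaseOfFinite (E := Set.univ) Set.finite_univ P
    ⟨B₀, (hP B₀).2 ⟨h0, h0'⟩⟩ (by
      rintro _ _ ⟨B, rfl, h1, h2⟩ ⟨B', rfl, h1', h2'⟩ a ha
      obtain ⟨b, hb, hb', h⟩ := hst.exchange h1 h1' h2' (a := a) (by simpa using ha.1)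
        (by simpa using ha.2)
      refine ⟨b, by simp [hb, hb'], sw B a b, ?_, ?_, h⟩
      · simp [sw]
      · rw [sw_card (by simpa using ha.1) hb', h1]) (fun _ _ => Set.subset_univ _)
  have hM : ∀ B : Finset α, M.IsBase B ↔ B.card = r ∧ B ∉ I := hP
  have hE : M.E = Set.univ := rfl
  have hrank : M.eRank = r := by
    rw [← ((hM B₀).2 ⟨h0, h0'⟩).encard_eq_eRank, Set.encard_coe_eq_coe_finsetCard, h0]
  refine ⟨M, hE, ⟨?_, ?_⟩, ?_, hrank⟩
  · intro C hC
    lift C to Finset α using C.toFinite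
    rw [hrank, Set.encard_coe_eq_coe_finsetCard]
    by_contra! hlt
    have hlt : C.card < r := by exact_mod_cast hlt
    obtain ⟨B, h1, h2, h3⟩ := exists_notMem_of_subset hst hr0 hr1 (A := C) (by omega)
    exact hC.not_indep (((hM B).2 ⟨h2, h3⟩).indep.subset (by exact_mod_cast h1))
  · intro C hC
    lift C to Finset α using C.toFinite
    rw [eRank_dual_of hE hrank, Set.encard_coe_eq_coe_finsetCard]
    by_contra! hlt
    have hlt : C.card < Fintype.card α - r := by exact_mod_cast hlt
    have hst' : Stable (dual I) := fun X hX Y hY hXY =>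
      hst _ (mem_dual.1 hX) _ (mem_dual.1 hY) (adj_compl hXY)
    obtain ⟨B, h1, h2, h3⟩ := exists_notMem_of_subset hst' (r := Fintype.card α - r) (by omega)
      (by omega) (A := C) (by omega)
    refine hC.not_indep (Matroid.IsBase.indep (B := (B : Set α)) ?_ |>.subset
      (by exact_mod_cast h1))
    rw [← compl_compl B, isBase_dual_compl hE, hM, Finset.card_compl, h2]
    exact ⟨by omega, fun h => h3 (mem_dual.2 h)⟩
  · ext X
    rw [mem_nonbaseFinset, hM]
    constructor
    · rintro ⟨h1, h2⟩
      by_contra h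
      exact h2 ⟨h1, h⟩
    · exact fun h => ⟨(Finset.mem_powersetCard.1 (hIr h)).2, fun h' => h'.2 h⟩

theorem numStable_le_numSparsePaving {n r : ℕ} (hr0 : 0 < r) (hr1 : r < n) :
    numStable (Fin n) r ≤ numSparsePaving n := by
  have h : ∀ I : Finset (Finset (Fin n)), ∃ M : Matroid (Fin n),
      I ∈ stables (Finset.univ.powersetCard r : Finset (Finset (Fin n))) →
        M.E = Set.univ ∧ M.IsSparsePaving ∧ nonbaseFinset M r = I ∧ M.eRank = r := by
    intro I
    by_cases hI : I ∈ stables (Finset.univ.powersetCard r : Finset (Finset (Fin n)))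
    · obtain ⟨M, hM⟩ := exists_sparsePaving hr0 (by rwa [Fintype.card_fin]) hI
      exact ⟨M, fun _ => hM⟩
    · exact ⟨Matroid.emptyOn _, fun h => absurd h hI⟩
  choose M hM using h
  rw [numStable, numSparsePaving, ← Set.ncard_coe_finset]
  refine Set.ncard_le_ncard_of_injOn M ?_ ?_ ((matroidsOn_finite n).subset fun _ h => h.1)
  · intro I hI
    obtain ⟨h1, h2, -⟩ := hM I hI
    exact ⟨h1, h2⟩
  · intro I hI J hJ h
    obtain ⟨-, -, h1, -⟩ := hM I hI
    obtain ⟨-, -, h2, -⟩ := hM J hJ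
    rw [← h1, ← h2, h]

/-- Sets with equal element sums modulo `n` form a stable family. -/
theorem exists_stable_card {n : ℕ} (hn : 0 < n) (r : ℕ) :
    ∃ I : Finset (Finset (Fin n)), I ⊆ Finset.univ.powersetCard r ∧ Stable I ∧
      n.choose r ≤ n * I.card := by
  have : NeZero n := ⟨hn.ne'⟩
  let f : Finset (Fin n) → Fin n := fun X => ∑ i ∈ X, i
  by_contra! hc
  -- Exchanging x for y changes the sum modulo n by y-x, which is nonzero.
  have hst : ∀ c, Stable ((Finset.univ.powersetCard r).filter fun X => f X = c) := by
    rintro c X hX Y hY ⟨x, hx, y, hy, rfl⟩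
    have h1 := (Finset.mem_filter.1 hX).2
    have h2 := (Finset.mem_filter.1 hY).2
    have h3 : y ∉ X.erase x := fun h => hy (Finset.mem_of_mem_erase h)
    simp only [f] at h1 h2
    rw [sw, Finset.sum_insert h3, ← h1, ← Finset.add_sum_erase X (fun i => i) hx] at h2
    exact hy (add_right_cancel h2 ▸ hx)
  have h1 := fun c => hc _ (Finset.filter_subset _ _) (hst c)
  have h2 : (Finset.univ.powersetCard r : Finset (Finset (Fin n))).card =
      ∑ c, ((Finset.univ.powersetCard r).filter fun X => f X = c).card :=
    Finset.card_eq_sum_card_fiberwise fun _ _ => Finset.mem_univ _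
  rw [Finset.card_powersetCard, Finset.card_univ, Fintype.card_fin] at h2
  have h3 : ∑ c : Fin n, n * ((Finset.univ.powersetCard r).filter fun X => f X = c).card <
      ∑ c : Fin n, n.choose r :=
    Finset.sum_lt_sum_of_nonempty ⟨⟨0, hn⟩, Finset.mem_univ _⟩ fun c _ => h1 c
  rw [← Finset.mul_sum, ← h2, Finset.sum_const, Finset.card_univ, Fintype.card_fin,
    smul_eq_mul] at h3
  exact lt_irrefl _ h3

theorem choose_le_logb_numSparsePaving {n r : ℕ} (hr0 : 0 < r) (hr1 : r < n) :
    (n.choose r : ℝ) / n ≤ Real.logb 2 (numSparsePaving n) := by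
  have hn : 0 < n := by omega
  obtain ⟨I, h1, h2, h3⟩ := exists_stable_card hn r
  have h4 : 2 ^ I.card ≤ numSparsePaving n := by
    refine le_trans ?_ (numStable_le_numSparsePaving hr0 hr1)
    rw [← Finset.card_powerset]
    exact Finset.card_le_card fun J hJ => mem_stables.2
      ⟨(Finset.mem_powerset.1 hJ).trans h1, h2.mono (Finset.mem_powerset.1 hJ)⟩
  have hn' : (0 : ℝ) < n := by exact_mod_cast hn
  have h5 : (0 : ℝ) < numSparsePaving n := by
    exact_mod_cast lt_of_lt_of_le (by positivity) h4
  rw [Real.le_logb_iff_rpow_le (by norm_num) h5]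
  calc (2 : ℝ) ^ ((n.choose r : ℝ) / n) ≤ (2 : ℝ) ^ (I.card : ℝ) := by
        refine Real.rpow_le_rpow_of_exponent_le (by norm_num) ?_
        rw [div_le_iff₀ hn', mul_comm]
        exact_mod_cast h3
    _ ≤ _ := by rw [Real.rpow_natCast]; exact_mod_cast h4

end Johnson

/-! ### Numerical estimates for large n. -/

namespace Johnson

/-- The number `n` is so large that all estimates below are valid. -/
structure Large (n : ℕ) : Prop where
  logb_ge : (2 : ℝ) ^ 16 ≤ Real.logb 2 n
  logb_pow_le : 2 ^ 22 * Real.logb 2 n ^ 3 ≤ n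
  pow_le : (4 * n) ^ 12 ≤ 2 ^ n

theorem eventually_large : ∀ᶠ n : ℕ in atTop, Large n := by
  have h1 : Tendsto (fun n : ℕ => Real.logb 2 (n : ℝ)) atTop atTop :=
    (Real.tendsto_logb_atTop (by norm_num)).comp tendsto_natCast_atTop_atTop
  have h2 : ∀ᶠ n : ℕ in atTop, 2 ^ 22 * Real.logb 2 (n : ℝ) ^ 3 ≤ n := by
    have h := (Real.isLittleO_pow_log_id_atTop (n := 3)).comp_tendsto tendsto_natCast_atTop_atTop
    have hc : (0 : ℝ) < Real.log 2 ^ 3 / 2 ^ 22 := by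
      have := Real.log_pos (by norm_num : (1 : ℝ) < 2)
      positivity
    filter_upwards [h.bound hc, eventually_ge_atTop 1] with n hn hn1
    have hn1 : (1 : ℝ) ≤ n := by exact_mod_cast hn1
    have hl := Real.log_nonneg hn1
    have hl2 := Real.log_pos (by norm_num : (1 : ℝ) < 2)
    simp only [Function.comp, id, norm_pow, Real.norm_eq_abs, abs_of_nonneg hl, Nat.abs_cast] at hn
    rw [Real.logb, div_pow, ← mul_div_assoc, div_le_iff₀ (by positivity)]
    rw [div_mul_eq_mul_div, le_div_iff₀ (by norm_num)] at hn
    linarith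
  have h3 : ∀ᶠ n : ℕ in atTop, (4 * n) ^ 12 ≤ 2 ^ n := by
    have h := tendsto_pow_const_mul_const_pow_of_abs_lt_one 12
      (by norm_num [abs_of_pos] : |(1 / 2 : ℝ)| < 1)
    have hc : (0 : ℝ) < 1 / 4 ^ 12 := by positivity
    filter_upwards [h.eventually_lt_const hc] with n hn
    have h2 : (0 : ℝ) < 2 ^ n := by positivity
    have : ((4 * n : ℕ) : ℝ) ^ 12 ≤ 2 ^ n := by
      push_cast
      rw [div_pow, one_pow, mul_one_div, div_lt_div_iff₀ h2 (by positivity), one_mul] at hn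
      rw [mul_pow, mul_comm]
      exact hn.le
    exact_mod_cast this
  filter_upwards [h1.eventually_ge_atTop _, h2, h3] with n a b c
  exact ⟨a, b, c⟩

/-- Up to n/3, consecutive binomial coefficients at least double. -/
theorem two_pow_mul_choose_le {n r j : ℕ} (h : 3 * (r + j) ≤ n) :
    2 ^ j * n.choose r ≤ n.choose (r + j) := by
  induction j with
  | zero => simp
  | succ j ih =>
    have ih := ih (by omega)
    have h1 := Nat.choose_succ_right_eq n (r + j)
    have h2 : 2 * (r + j + 1) ≤ n - (r + j) := by omega
    refine Nat.le_of_mul_le_mul_right (c := r + j + 1) ?_ (by omega)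
    calc 2 ^ (j + 1) * n.choose r * (r + j + 1)
        = (2 ^ j * n.choose r) * (2 * (r + j + 1)) := by ring
      _ ≤ n.choose (r + j) * (n - (r + j)) := Nat.mul_le_mul ih h2
      _ = _ := h1.symm

namespace Large

variable {n : ℕ}

theorem large_real (h : Large n) : (2 : ℝ) ^ 70 ≤ n := by
  have h1 : ((2 : ℝ) ^ 16) ^ 3 ≤ Real.logb 2 n ^ 3 :=
    pow_le_pow_left₀ (by positivity) h.logb_ge 3
  calc (2 : ℝ) ^ 70 = 2 ^ 22 * (2 ^ 16) ^ 3 := by norm_num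
    _ ≤ 2 ^ 22 * Real.logb 2 n ^ 3 := by gcongr
    _ ≤ n := h.logb_pow_le

theorem large_nat (h : Large n) : 2 ^ 70 ≤ n := by exact_mod_cast h.large_real

theorem two_pow_le (n : ℕ) : 2 ^ n ≤ (n + 1) * n.choose (n / 2) := by
  rw [← Nat.sum_range_choose]
  calc _ ≤ ∑ _i ∈ Finset.range (n + 1), n.choose (n / 2) :=
        Finset.sum_le_sum fun i _ => Nat.choose_le_middle i n
    _ = _ := by simp

theorem pow_four_le (h : Large n) : n ^ 4 ≤ n.choose (n / 2) := by
  have h1 := two_pow_le n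
  have h2 := h.pow_le
  have h3 := h.large_nat
  refine Nat.le_of_mul_le_mul_left (c := n + 1) ?_ (by omega)
  calc (n + 1) * n ^ 4 ≤ (4 * n) * (4 * n) ^ 4 :=
        Nat.mul_le_mul (by omega) (Nat.pow_le_pow_left (by omega) 4)
    _ = (4 * n) ^ 5 := by ring
    _ ≤ (4 * n) ^ 12 := Nat.pow_le_pow_right (by omega) (by norm_num)
    _ ≤ _ := h2.trans h1

/-- From r < n/4 there is room for ⌊n/12⌋ doublings, and 2^⌊n/12⌋ ≥ 2n. High ranks follow by
symmetry. -/
theorem choose_outer_le (h : Large n) {r : ℕ} (hr : 4 * r < n ∨ 3 * n < 4 * r) :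
    2 * n * n.choose r ≤ n.choose (n / 2) := by
  have key : ∀ r, 4 * r < n → 2 * n * n.choose r ≤ n.choose (n / 2) := by
    intro r hr
    have h1 : 2 * n ≤ 2 ^ (n / 12) := by
      refine (Nat.pow_le_pow_iff_left (n := 12) (by norm_num)).1 ?_
      -- The spare factor 2^12 pays for rounding n/12 down.
      refine Nat.le_of_mul_le_mul_right (c := 2 ^ 12) ?_ (by norm_num)
      calc (2 * n) ^ 12 * 2 ^ 12 = (4 * n) ^ 12 := by ring
        _ ≤ 2 ^ n := h.pow_le
        _ ≤ 2 ^ (n / 12 * 12 + 12) := Nat.pow_le_pow_right (by norm_num) (by omega)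
        _ = _ := by rw [pow_add, pow_mul]
    calc 2 * n * n.choose r ≤ 2 ^ (n / 12) * n.choose r := by gcongr
      _ ≤ n.choose (r + n / 12) := two_pow_mul_choose_le (by omega)
      _ ≤ _ := Nat.choose_le_middle _ _
  rcases hr with hr | hr
  · exact key r hr
  · rcases Nat.lt_or_ge n r with h1 | h1
    · rw [Nat.choose_eq_zero_of_lt h1]; simp
    · rw [← Nat.choose_symm h1]
      exact key _ (by omega)

theorem choose_le_logb (h : Large n) :
    (n.choose (n / 2) : ℝ) / n ≤ Real.logb 2 (numSparsePaving n) := by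
  have := h.large_nat
  exact choose_le_logb_numSparsePaving (by omega) (by omega)

theorem choose_pos : (0 : ℝ) < n.choose (n / 2) := by
  exact_mod_cast Nat.choose_pos (Nat.div_le_self _ _)

theorem numSparsePaving_pos (h : Large n) : (0 : ℝ) < numSparsePaving n := by
  have h1 := h.choose_le_logb
  have h2 : (0 : ℝ) < n := lt_of_lt_of_le (by positivity) h.large_real
  have h3 := choose_pos (n := n)
  rcases Nat.eq_zero_or_pos (numSparsePaving n) with h0 | h0
  · rw [h0, Nat.cast_zero, Real.logb_zero] at h1
    exact absurd (by positivity : (0 : ℝ) < n.choose (n / 2) / n) (not_lt.2 h1)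
  · exact_mod_cast h0

/-- The exponents in the count of matroids of rank `r` with `m` large nonbases: here `N` and `B` are
the binomial coefficients for rank `r` and the middle rank, and `w` is the saved exponent. -/
theorem exponent_bounds (h : Large n) {m k q N B w : ℝ}
    (hB : (n : ℝ) ^ 4 ≤ B) (hN0 : 0 ≤ N) (hNB : N ≤ B) (hm : 0 ≤ m) (hw1 : m ≤ w * n)
    (hw2 : 285 * Real.logb 2 n ^ 3 * B ≤ w * n ^ 2)
    (hk : (k - 3) * n ^ 2 ≤ 1034 * m * Real.logb 2 n + 4096 * B)
    (hq : w ≤ q * (128 * Real.logb 2 n)) (hq' : (q - 1) * (128 * Real.logb 2 n) ≤ w) :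
    (12 * B / n ^ 2 + 3 * Real.logb 2 n * k) + (2 * N / n ^ 2 + 2 * Real.logb 2 n * (16 * q)) - w
      ≤ -(2 * n) - 1 ∧
    (12 * B / n ^ 2 + 3 * Real.logb 2 n * k) + (1 + Real.logb 2 n) - q ≤ -(2 * n) - 1 := by
  have hn := h.large_real
  have hL := h.logb_ge
  have hLn := h.logb_pow_le
  set L := Real.logb 2 n with hLdef
  clear_value L
  generalize (n : ℝ) = x at *
  have hx : 0 < x := lt_of_lt_of_le (by positivity) hn
  have hL0 : 0 < L := lt_of_lt_of_le (by positivity) hL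
  -- Normalisation: t = w/L is the scale of q, and b = B/x² is that of the container size. The
  -- hypothesis then reads 285 L² b ≤ t.
  obtain ⟨t, rfl⟩ : ∃ t, w = t * L := ⟨w / L, by field_simp⟩
  obtain ⟨b, rfl⟩ : ∃ b, B = b * x ^ 2 := ⟨B / x ^ 2, by field_simp⟩
  obtain ⟨c, rfl⟩ : ∃ c, N = c * x ^ 2 := ⟨N / x ^ 2, by field_simp⟩
  have hx2 : 0 < x ^ 2 := by positivity
  have hcb : c ≤ b := le_of_mul_le_mul_right hNB hx2
  have hb : x ^ 2 ≤ b := by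
    refine le_of_mul_le_mul_right ?_ hx2
    linarith
  have hb0 : 0 < b := lt_of_lt_of_le hx2 hb
  have ht : 285 * L ^ 2 * b ≤ t := by
    refine le_of_mul_le_mul_right ?_ (mul_pos hL0 hx2)
    calc 285 * L ^ 2 * b * (L * x ^ 2) = 285 * L ^ 3 * (b * x ^ 2) := by ring
      _ ≤ _ := hw2
      _ = _ := by ring
  have hL1 : 1 ≤ L := le_trans (by norm_num) hL
  have hLx : L ≤ x := by
    have : L ≤ 2 ^ 22 * L ^ 3 := by
      have h1 : 1 ≤ L ^ 2 := one_le_pow₀ hL1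
      nlinarith
    linarith
  have ht0 : 0 < t := lt_of_lt_of_le (by positivity) ht
  have hLb : L * b ≤ L ^ 2 * b := by
    have : L ≤ L ^ 2 := by nlinarith
    gcongr
  have hLLb : 2 ^ 16 * (L * b) ≤ L ^ 2 * b := by
    have : 2 ^ 16 * L ≤ L ^ 2 := by nlinarith
    nlinarith
  have hbLb : 2 ^ 16 * b ≤ L * b := by gcongr
  have hxb : 2 ^ 70 * x ≤ b := by nlinarith
  have hkk : 3 * L * k ≤ 3102 * (t * L ^ 3) / x + 12288 * (L * b) + 9 * L := by
    have h1 : k - 3 ≤ 1034 * m * L / x ^ 2 + 4096 * b := by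
      refine le_of_mul_le_mul_right (hk.trans_eq ?_) hx2
      field_simp
    have h2 : m / x ≤ t * L := by rwa [div_le_iff₀ hx]
    have h3 : 1034 * m * L / x ^ 2 ≤ 1034 * (t * L) * L / x := by
      have : 1034 * m * L / x ^ 2 = 1034 * (m / x) * L / x := by field_simp
      rw [this]
      gcongr
    have h4 : 3 * L * (1034 * (t * L) * L / x) = 3102 * (t * L ^ 3) / x := by ring
    nlinarith
  -- This is where 2²² L³ ≤ n enters.
  have hd1 : 3102 * (t * L ^ 3) / x ≤ t / 1024 := by
    rw [div_le_iff₀ hx]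
    nlinarith
  have e1 : 12 * (b * x ^ 2) / x ^ 2 = 12 * b := by field_simp
  have e2 : 2 * (c * x ^ 2) / x ^ 2 = 2 * c := by field_simp
  rw [e1, e2]
  -- All remaining terms are at most of order L·b, smaller than L²·b by the factor L ≥ 2^16.
  have hd : 12 * b + 3 * L * k ≤ t / 256 := by nlinarith
  have hq1 : t ≤ q * 128 := by
    refine le_of_mul_le_mul_right ?_ hL0
    linarith
  -- So the list of 16q representatives costs 32Lq ≤ w/4 + 32L, well below the gain w.
  have hq2 : L * q ≤ t * L / 128 + L := by linarith
  have htL : 2 ^ 16 * t ≤ t * L := by nlinarith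
  constructor
  · nlinarith
  · nlinarith

end Large

end Johnson

namespace Johnson

namespace Large

variable {n : ℕ}

theorem pos (h : Large n) : (0 : ℝ) < n := lt_of_lt_of_le (by positivity) h.large_real

theorem logb_pos (h : Large n) : 0 < Real.logb 2 (n : ℝ) :=
  lt_of_lt_of_le (by positivity) h.logb_ge

theorem logb_numSparsePaving_pos (h : Large n) : 0 < Real.logb 2 (numSparsePaving n : ℝ) := by
  refine lt_of_lt_of_le ?_ h.choose_le_logb
  have := h.pos
  have := choose_pos (n := n)
  positivity

theorem bigUpsilon_eq (n : ℕ) :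
    bigUpsilon n = 285 * Real.logb 2 (n : ℝ) ^ 3 * n.choose (n / 2) / (n : ℝ) ^ 2 := by
  rw [bigUpsilon, zetaBound]
  ring

theorem bigUpsilon_le (h : Large n) {u : ℝ} (hu : smallUpsilon n < u) :
    285 * Real.logb 2 (n : ℝ) ^ 3 * n.choose (n / 2) ≤
      u * Real.logb 2 (numSparsePaving n) * (n : ℝ) ^ 2 := by
  have hn := h.pos
  rw [smallUpsilon, div_lt_iff₀ h.logb_numSparsePaving_pos, bigUpsilon_eq] at hu
  have h1 : 0 ≤ Real.logb 2 ((n : ℝ) + 1) := Real.logb_nonneg (by norm_num) (by linarith)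
  rw [← div_le_iff₀ (by positivity)]
  linarith

/-- With weight n⁻³ per block, the 3·2^n available blocks contribute only 12·binom(n,⌊n/2⌋)/n² to
the exponent. -/
theorem card_unions_le_rpow (h : Large n) (r k : ℕ) :
    ((unions (Fin n) r k).card : ℝ) ≤
      2 ^ (12 * (n.choose (n / 2) : ℝ) / (n : ℝ) ^ 2 + 3 * Real.logb 2 (n : ℝ) * k) := by
  have hn := h.pos
  have hL := h.logb_pos
  have h1 := card_filter_le_rpow (Finset.univ : Finset (Fin 3 × Finset (Fin n))) k
    (c := 3 * Real.logb 2 (n : ℝ)) (by positivity)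
  have h2 : (2 : ℝ) ^ (-(3 * Real.logb 2 (n : ℝ))) = ((n : ℝ) ^ 3)⁻¹ := by
    rw [Real.rpow_neg (by norm_num), mul_comm, Real.rpow_mul (by norm_num),
      Real.rpow_logb (by norm_num) (by norm_num) hn]
    norm_cast
  have h3 : ((Finset.univ : Finset (Fin 3 × Finset (Fin n))).card : ℝ) = 3 * 2 ^ n := by
    simp
  have h4 : (2 : ℝ) ^ n ≤ 2 * n * n.choose (n / 2) := by
    have h5 := two_pow_le n
    have h6 := h.large_nat
    have h7 : 2 ^ n ≤ 2 * n * n.choose (n / 2) :=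
      h5.trans (Nat.mul_le_mul_right _ (by omega))
    exact_mod_cast h7
  refine (Nat.cast_le.2 (card_unions_le r k)).trans (h1.trans ?_)
  refine Real.rpow_le_rpow_of_exponent_le (by norm_num) ?_
  rw [h2, h3]
  gcongr
  calc 2 * ((n : ℝ) ^ 3)⁻¹ * (3 * 2 ^ n)
      ≤ 2 * ((n : ℝ) ^ 3)⁻¹ * (3 * (2 * n * n.choose (n / 2))) := by gcongr
    _ = _ := by field_simp; ring

theorem card_filter_le_rpow_choose (h : Large n) (r j : ℕ) :
    (((Finset.univ.powersetCard r : Finset (Finset (Fin n))).powerset.filter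
      fun J => J.card ≤ j).card : ℝ) ≤
        2 ^ (2 * (n.choose r : ℝ) / (n : ℝ) ^ 2 + 2 * Real.logb 2 (n : ℝ) * j) := by
  have hn := h.pos
  have hL := h.logb_pos
  have h1 := card_filter_le_rpow (Finset.univ.powersetCard r : Finset (Finset (Fin n))) j
    (c := 2 * Real.logb 2 (n : ℝ)) (by positivity)
  have h2 : (2 : ℝ) ^ (-(2 * Real.logb 2 (n : ℝ))) = ((n : ℝ) ^ 2)⁻¹ := by
    rw [Real.rpow_neg (by norm_num), mul_comm, Real.rpow_mul (by norm_num),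
      Real.rpow_logb (by norm_num) (by norm_num) hn]
    norm_cast
  rw [h2, Finset.card_powersetCard, Finset.card_univ, Fintype.card_fin] at h1
  refine h1.trans_eq ?_
  congr 2
  ring

/-- Systems of middle rank with many non-isolated members are rare. -/
theorem card_systems_le_rpow (h : Large n) {r m : ℕ} (hr : Mid (Fin n) r)
    (hm : m ≤ n.choose r) (hu : smallUpsilon n < (m : ℝ) / n.choose r)
    (𝒦 : Finset (Finset (Finset (Fin n)))) (h𝒦 : ∀ K ∈ 𝒦, IsSys r K ∧ (big K).card = m) :
    (𝒦.card : ℝ) ≤ numSparsePaving n * (2 : ℝ) ^ (-(2 * n : ℝ)) := by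
  have hn := h.pos
  have hL := h.logb_pos
  have hL1 : 1 ≤ Real.logb 2 (n : ℝ) := le_trans (by norm_num) h.logb_ge
  have hΛ := h.logb_numSparsePaving_pos
  have hs := h.numSparsePaving_pos
  obtain ⟨m1, m2, m3⟩ := id hr
  rw [Fintype.card_fin] at m1 m2 m3
  have hN : (0 : ℝ) < n.choose r := by exact_mod_cast Nat.choose_pos (by omega)
  have hNB : (n.choose r : ℝ) ≤ n.choose (n / 2) := by exact_mod_cast Nat.choose_le_middle r n
  have hB : (n : ℝ) ^ 4 ≤ n.choose (n / 2) := by exact_mod_cast h.pow_four_le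
  have hΛB := h.choose_le_logb
  have hmN : (m : ℝ) ≤ n.choose r := by exact_mod_cast hm
  set w := (m : ℝ) / n.choose r * Real.logb 2 (numSparsePaving n) with hw
  have hw0 : 0 ≤ w := by positivity
  have hw1 : (m : ℝ) ≤ w * n := by
    rw [div_le_iff₀ hn] at hΛB
    calc (m : ℝ) = m / n.choose r * n.choose r := by field_simp
      _ ≤ m / n.choose r * (Real.logb 2 (numSparsePaving n) * n) := by
        gcongr; exact hNB.trans hΛB
      _ = w * n := by rw [hw]; ring
  have hw2 := h.bigUpsilon_le hu
  rw [← hw] at hw2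
  have hlog : Real.log n ≤ Real.logb 2 (n : ℝ) := by
    have h1 : 0 ≤ Real.log n := Real.log_nonneg (by
      exact_mod_cast (by have := h.large_nat; omega : 1 ≤ n))
    rw [Real.logb, le_div_iff₀ (Real.log_pos (by norm_num))]
    nlinarith [Real.log_two_lt_d9]
  have hlog0 : 0 ≤ Real.log n := Real.log_nonneg (by
    exact_mod_cast (by have := h.large_nat; omega : 1 ≤ n))
  set Q := 1024 * (m : ℝ) * Real.log n + 2 * (n : ℝ) ^ 2 + 10 * m + 4096 * n.choose r with hQ
  have hQ0 : 0 ≤ Q := by positivity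
  set k := ⌈Q / (n : ℝ) ^ 2⌉₊ with hk
  -- This balances the cases: listing 16q representatives costs a quarter of w, while 2^q still
  -- outweighs the containers.
  set q := ⌈w / (128 * Real.logb 2 (n : ℝ))⌉₊ with hq
  have hn2 : (0 : ℝ) < (n : ℝ) ^ 2 := by positivity
  have hk1 : Q ≤ k * (n : ℝ) ^ 2 := by
    rw [← div_le_iff₀ hn2]; exact Nat.le_ceil _
  have hk2 : ((k : ℝ) - 3) * (n : ℝ) ^ 2 ≤
      1034 * m * Real.logb 2 (n : ℝ) + 4096 * n.choose (n / 2) := by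
    have h1 : (k : ℝ) < Q / (n : ℝ) ^ 2 + 1 := Nat.ceil_lt_add_one (by positivity)
    have h2 : ((k : ℝ) - 1) * (n : ℝ) ^ 2 ≤ Q := by
      rw [← le_div_iff₀ hn2]; linarith
    have h3 : (m : ℝ) * Real.log n ≤ m * Real.logb 2 (n : ℝ) := by gcongr
    have h4 : (m : ℝ) * 1 ≤ m * Real.logb 2 (n : ℝ) := by gcongr
    linarith
  have hL128 : 0 < 128 * Real.logb 2 (n : ℝ) := by positivity
  have hq1 : w ≤ q * (128 * Real.logb 2 (n : ℝ)) := by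
    rw [← div_le_iff₀ hL128]; exact Nat.le_ceil _
  have hq2 : ((q : ℝ) - 1) * (128 * Real.logb 2 (n : ℝ)) ≤ w := by
    have h1 : (q : ℝ) < w / (128 * Real.logb 2 (n : ℝ)) + 1 :=
      Nat.ceil_lt_add_one (by positivity)
    rw [← le_div_iff₀ hL128]; linarith
  obtain ⟨b1, b2⟩ := h.exponent_bounds hB hN.le hNB (Nat.cast_nonneg m) hw1 hw2 hk2 hq1 hq2
  have hcount := card_systems_le hr m k q (by rw [Fintype.card_fin]; exact hk1) 𝒦 h𝒦
  rw [Fintype.card_fin] at hcount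
  have hD := h.card_unions_le_rpow r k
  have hJ := h.card_filter_le_rpow_choose r (16 * q)
  push_cast at hJ
  have hι : (numStable (Fin n) r : ℝ) ≤ numSparsePaving n := by
    exact_mod_cast numStable_le_numSparsePaving (by omega) (by omega)
  have hι0 : (0 : ℝ) < numStable (Fin n) r := by exact_mod_cast numStable_pos r
  set a := (m : ℝ) / n.choose r with ha
  have ha1 : a ≤ 1 := by rw [ha, div_le_one hN]; exact hmN
  -- The map x ↦ x^(1-a) is increasing because a ≤ 1, so the count for one rank may be replaced by
  -- s(n).
  have hι' : (numStable (Fin n) r : ℝ) / (numStable (Fin n) r : ℝ) ^ a ≤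
      numSparsePaving n * (2 : ℝ) ^ (-w) := by
    have h1 : ∀ x : ℝ, 0 < x → x / x ^ a = x ^ (1 - a) := fun x hx => by
      rw [Real.rpow_sub hx, Real.rpow_one]
    have h2 : (2 : ℝ) ^ w = (numSparsePaving n : ℝ) ^ a := by
      rw [hw, mul_comm, Real.rpow_mul (by norm_num), Real.rpow_logb (by norm_num) (by norm_num) hs]
    rw [Real.rpow_neg (by norm_num), h2, ← div_eq_mul_inv, h1 _ hι0, h1 _ hs]
    exact Real.rpow_le_rpow hι0.le hι (by linarith)
  have hq3 : 2 * (n : ℝ) / 2 ^ q = 2 ^ (1 + Real.logb 2 (n : ℝ) - q) := by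
    rw [Real.rpow_sub (by norm_num), Real.rpow_add (by norm_num), Real.rpow_one,
      Real.rpow_logb (by norm_num) (by norm_num) hn, Real.rpow_natCast]
  set D : ℝ := ((unions (Fin n) r k).card : ℝ)
  set J : ℝ := (((Finset.univ.powersetCard r : Finset (Finset (Fin n))).powerset.filter
      fun J => J.card ≤ 16 * q).card : ℝ)
  set d := 12 * (n.choose (n / 2) : ℝ) / (n : ℝ) ^ 2 + 3 * Real.logb 2 (n : ℝ) * k
  set j := 2 * (n.choose r : ℝ) / (n : ℝ) ^ 2 + 2 * Real.logb 2 (n : ℝ) * (16 * q)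
  clear_value d j
  have hA : D * J * (numSparsePaving n * (2 : ℝ) ^ (-w)) ≤
      numSparsePaving n * 2 ^ (-(2 * n : ℝ) - 1) := by
    calc D * J * (numSparsePaving n * (2 : ℝ) ^ (-w))
        ≤ 2 ^ d * 2 ^ j * (numSparsePaving n * (2 : ℝ) ^ (-w)) := by gcongr
      _ = numSparsePaving n * 2 ^ (d + j - w) := by
        rw [sub_eq_add_neg, Real.rpow_add (by norm_num), Real.rpow_add (by norm_num)]; ring
      _ ≤ _ := by
        gcongr
        norm_num
  have hC : D * (numSparsePaving n * (2 * (n : ℝ) / 2 ^ q)) ≤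
      numSparsePaving n * 2 ^ (-(2 * n : ℝ) - 1) := by
    rw [hq3]
    calc D * (numSparsePaving n * (2 : ℝ) ^ (1 + Real.logb 2 (n : ℝ) - q))
        ≤ 2 ^ d * (numSparsePaving n * (2 : ℝ) ^ (1 + Real.logb 2 (n : ℝ) - q)) := by gcongr
      _ = numSparsePaving n * 2 ^ (d + (1 + Real.logb 2 (n : ℝ)) - q) := by
        rw [add_sub_assoc d, Real.rpow_add (by norm_num) d, mul_left_comm]
      _ ≤ _ := by
        gcongr
        norm_num
  calc (𝒦.card : ℝ) ≤ _ := hcount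
    _ = D * J * (numStable (Fin n) r / (numStable (Fin n) r : ℝ) ^ a) +
        D * (numStable (Fin n) r * (2 * (n : ℝ) / 2 ^ q)) := by ring
    _ ≤ D * J * (numSparsePaving n * (2 : ℝ) ^ (-w)) +
        D * (numSparsePaving n * (2 * (n : ℝ) / 2 ^ q)) := by gcongr
    _ ≤ _ := add_le_add hA hC
    _ = numSparsePaving n * (2 : ℝ) ^ (-(2 * n : ℝ)) := by
      rw [Real.rpow_sub (by norm_num), Real.rpow_one]; ring

end Large

end Johnson

/-! ### Summation over ranks and conclusion. -/

namespace Johnson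

theorem ncard_le_card_mul {β γ : Type*} {S : Set β} (hS : S.Finite) (f : β → γ)
    (T : Finset γ) (hf : ∀ x ∈ S, f x ∈ T) (c : ℝ)
    (hc : ∀ t ∈ T, ({x ∈ S | f x = t}.ncard : ℝ) ≤ c) : (S.ncard : ℝ) ≤ T.card * c := by
  classical
  lift S to Finset β using hS
  have h : ∀ t, {x ∈ (S : Set β) | f x = t}.ncard = (S.filter fun x => f x = t).card := by
    intro t
    rw [← Set.ncard_coe_finset, Finset.coe_filter]
    rfl
  rw [Set.ncard_coe_finset, Finset.card_eq_sum_card_fiberwise (f := f) (t := T) fun x hx => hf x hx]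
  push_cast
  refine (Finset.sum_le_card_nsmul _ _ c fun t ht => ?_).trans_eq (nsmul_eq_mul _ _)
  rw [← h]
  exact hc t ht

theorem exists_eRank_eq {n : ℕ} {M : Matroid (Fin n)} :
    ∃ r ≤ n, M.eRank = r ∧ M.eRank.toNat = r := by
  obtain ⟨B, hB⟩ := M.exists_isBase
  lift B to Finset (Fin n) using B.toFinite
  have h := hB.encard_eq_eRank
  rw [Set.encard_coe_eq_coe_finsetCard] at h
  refine ⟨B.card, (Finset.card_le_univ B).trans_eq (Fintype.card_fin n), h.symm, ?_⟩
  rw [← h, ENat.toNat_natCast]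

theorem bigNonbaseDensity_eq {n r : ℕ} {M : Matroid (Fin n)} (hE : M.E = Set.univ)
    (hr : M.eRank = r) :
    M.bigNonbaseDensity = (M.bigNonbases.ncard : ℝ) / n.choose r := by
  rw [Matroid.bigNonbaseDensity, hE, hr, ENat.toNat_natCast, Set.ncard_univ, Nat.card_fin]

namespace Large

variable {n : ℕ}

/-- There are few matroids whose rank is far from the middle. -/
theorem ncard_outer_le (h : Large n) {r : ℕ} (hr : ¬ Mid (Fin n) r) :
    ({M ∈ matroidsOn n | M.eRank = r}.ncard : ℝ) ≤
      numSparsePaving n * (2 : ℝ) ^ (-(n : ℝ)) := by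
  have hn := h.pos
  have h0 := h.large_nat
  have hout : 4 * r < n ∨ 3 * n < 4 * r := by
    rw [Mid, Fintype.card_fin] at hr
    omega
  have h1 : {M ∈ matroidsOn n | M.eRank = r}.ncard ≤ 2 ^ n.choose r := by
    have : 2 ^ n.choose r =
        (Finset.univ.powersetCard r : Finset (Finset (Fin n))).powerset.card := by
      rw [Finset.card_powerset, Finset.card_powersetCard, Finset.card_univ, Fintype.card_fin]
    rw [this, ← Set.ncard_coe_finset]
    refine Set.ncard_le_ncard_of_injOn (fun M => nonbaseFinset M r) ?_ ?_ (Finset.finite_toSet _)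
    · intro M _
      simp only [Finset.mem_coe, Finset.mem_powerset]
      exact fun X hX => Finset.mem_powersetCard.2
        ⟨Finset.subset_univ _, (mem_nonbaseFinset.1 hX).1⟩
    · rintro M ⟨hM, hMr⟩ N ⟨hN, hNr⟩ hMN
      exact nonbaseFinset_injective hM hN hMr hNr hMN
  have h2 : (2 * n * n.choose r : ℝ) ≤ n.choose (n / 2) := by exact_mod_cast h.choose_outer_le hout
  have h3 : (2 * n * n : ℝ) ≤ n.choose (n / 2) := by
    have : 2 * n * n ≤ n.choose (n / 2) := by
      refine le_trans ?_ h.pow_four_le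
      calc 2 * n * n ≤ n * n * n * n := by gcongr; nlinarith
        _ = n ^ 4 := by ring
    exact_mod_cast this
  -- Both summands are at most the middle binomial divided by 2n.
  have h4 : (n.choose r : ℝ) + n ≤ Real.logb 2 (numSparsePaving n) := by
    refine le_trans ?_ h.choose_le_logb
    rw [le_div_iff₀ hn]
    linarith
  have h5 := h.numSparsePaving_pos
  rw [Real.rpow_neg (by norm_num), ← div_eq_mul_inv, le_div_iff₀ (by positivity)]
  rw [Real.le_logb_iff_rpow_le (by norm_num) h5, Real.rpow_add (by norm_num),
    Real.rpow_natCast] at h4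
  refine le_trans ?_ h4
  gcongr
  exact_mod_cast h1

/-- There are few matroids of middle rank that violate the bound on the number of large nonbases. -/
theorem ncard_middle_le (h : Large n) {r : ℕ} (hr : Mid (Fin n) r) :
    ({M ∈ matroidsOn n | M.eRank = r ∧ ¬ M.bigNonbaseDensity ≤ smallUpsilon n}.ncard : ℝ) ≤
      2 * (numSparsePaving n * (2 : ℝ) ^ (-(n : ℝ))) := by
  classical
  have hcard : (n.choose r + 1 : ℝ) ≤ 2 * 2 ^ n := by
    have h1 : n.choose r ≤ 2 ^ n := Nat.choose_le_two_pow n r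
    have h2 : 1 ≤ 2 ^ n := Nat.one_le_two_pow
    exact_mod_cast (by omega : n.choose r + 1 ≤ 2 * 2 ^ n)
  have key := ncard_le_card_mul
    (S := {M ∈ matroidsOn n | M.eRank = r ∧ ¬ M.bigNonbaseDensity ≤ smallUpsilon n})
    ((matroidsOn_finite n).subset fun _ h => h.1) (fun M => M.bigNonbases.ncard)
    (Finset.range (n.choose r + 1)) (by
      rintro M ⟨hM, hMr, -⟩
      rw [Finset.mem_range, Nat.lt_succ_iff, ncard_bigNonbases hM hMr hr]
      have : (Finset.univ.powersetCard r : Finset (Finset (Fin n))).card = n.choose r := by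
        rw [Finset.card_powersetCard, Finset.card_univ, Fintype.card_fin]
      rw [← this]
      exact Finset.card_le_card fun X hX => Finset.mem_powersetCard.2
        ⟨Finset.subset_univ _, (mem_nonbaseFinset.1 (mem_big.1 hX).1).1⟩)
    -- The saving 2^(-2n) leaves room for the at most 2·2^n values of m.
    (numSparsePaving n * (2 : ℝ) ^ (-(2 * n : ℝ))) (by
      intro m hm
      rw [Finset.mem_range, Nat.lt_succ_iff] at hm
      by_cases hu : smallUpsilon n < (m : ℝ) / n.choose r
      · refine le_trans ?_ (h.card_systems_le_rpow hr hm hu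
          (Finset.univ.filter fun K => IsSys r K ∧ (big K).card = m) (by simp))
        rw [Nat.cast_le, ← Set.ncard_coe_finset]
        refine Set.ncard_le_ncard_of_injOn (fun M => nonbaseFinset M r) ?_ ?_
          (Finset.finite_toSet _)
        · rintro M ⟨⟨hM, hMr, -⟩, hMm⟩
          simp only [Finset.mem_coe, Finset.mem_filter, Finset.mem_univ, true_and]
          exact ⟨isSys_nonbaseFinset hM hMr, by rw [← ncard_bigNonbases hM hMr hr, hMm]⟩
        · rintro M ⟨⟨hM, hMr, -⟩, -⟩ N ⟨⟨hN, hNr, -⟩, -⟩ hMN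
          exact nonbaseFinset_injective hM hN hMr hNr hMN
      · have : {M | M ∈ {M ∈ matroidsOn n | M.eRank = r ∧
            ¬ M.bigNonbaseDensity ≤ smallUpsilon n} ∧ M.bigNonbases.ncard = m} = ∅ := by
          rw [Set.eq_empty_iff_forall_notMem]
          rintro M ⟨⟨hM, hMr, hMu⟩, hMm⟩
          rw [bigNonbaseDensity_eq hM hMr, hMm] at hMu
          exact hMu (not_lt.1 hu)
        rw [this, Set.ncard_empty, Nat.cast_zero]
        positivity)
  refine key.trans ?_
  rw [Finset.card_range]
  push_cast
  calc ((n.choose r : ℝ) + 1) * (numSparsePaving n * (2 : ℝ) ^ (-(2 * n : ℝ)))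
      ≤ 2 * 2 ^ n * (numSparsePaving n * (2 : ℝ) ^ (-(2 * n : ℝ))) := by gcongr
    _ = 2 * (numSparsePaving n * ((2 : ℝ) ^ (n : ℝ) * (2 : ℝ) ^ (-(2 * n : ℝ)))) := by
      rw [Real.rpow_natCast]; ring
    _ = _ := by
      rw [← Real.rpow_add (by norm_num)]
      congr 3
      ring

theorem ncard_exceptional_le (h : Large n) :
    ({M ∈ matroidsOn n | ¬ M.bigNonbaseDensity ≤ smallUpsilon n}.ncard : ℝ) ≤
      (n + 1) * (2 * (numSparsePaving n * (2 : ℝ) ^ (-(n : ℝ)))) := by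
  have key := ncard_le_card_mul
    (S := {M ∈ matroidsOn n | ¬ M.bigNonbaseDensity ≤ smallUpsilon n})
    ((matroidsOn_finite n).subset fun _ h => h.1) (fun M => M.eRank.toNat)
    (Finset.range (n + 1)) (by
      intro M _
      obtain ⟨r, hr, -, h2⟩ := exists_eRank_eq (M := M)
      rw [Finset.mem_range, h2]
      omega) (2 * (numSparsePaving n * (2 : ℝ) ^ (-(n : ℝ)))) (by
      intro r _
      have hfin : ∀ P : Matroid (Fin n) → Prop, {M ∈ matroidsOn n | P M}.Finite :=
        fun P => (matroidsOn_finite n).subset fun _ h => h.1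
      have hrank : ∀ M : Matroid (Fin n), M.eRank.toNat = r → M.eRank = r := by
        intro M hM
        obtain ⟨r', -, h1, h2⟩ := exists_eRank_eq (M := M)
        rw [h1, ← h2, hM]
      by_cases hm : Mid (Fin n) r
      · refine le_trans (Nat.cast_le.2 (Set.ncard_le_ncard ?_ (hfin _))) (h.ncard_middle_le hm)
        rintro M ⟨⟨hM, hMu⟩, hMr⟩
        exact ⟨hM, hrank M hMr, hMu⟩
      · have h1 : ({M | M ∈ {M ∈ matroidsOn n | ¬ M.bigNonbaseDensity ≤ smallUpsilon n} ∧
            M.eRank.toNat = r}.ncard : ℝ) ≤ numSparsePaving n * (2 : ℝ) ^ (-(n : ℝ)) := by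
          refine le_trans (Nat.cast_le.2 (Set.ncard_le_ncard ?_ (hfin _))) (h.ncard_outer_le hm)
          rintro M ⟨⟨hM, -⟩, hMr⟩
          exact ⟨hM, hrank M hMr⟩
        have h2 : (0 : ℝ) ≤ numSparsePaving n * (2 : ℝ) ^ (-(n : ℝ)) := by positivity
        linarith)
  rw [Finset.card_range] at key
  exact_mod_cast key

theorem one_sub_le (h : Large n) :
    1 - (n + 1) * (2 * (1 / 2 : ℝ) ^ n) ≤
      ({M ∈ matroidsOn n | M.bigNonbaseDensity ≤ smallUpsilon n}.ncard : ℝ) /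
        (matroidsOn n).ncard := by
  have hfin := matroidsOn_finite n
  have hs : (numSparsePaving n : ℝ) ≤ (matroidsOn n).ncard := by
    rw [Nat.cast_le]
    exact Set.ncard_le_ncard (fun _ h => h.1) hfin
  have hs0 := h.numSparsePaving_pos
  have hm0 : (0 : ℝ) < (matroidsOn n).ncard := lt_of_lt_of_le hs0 hs
  have h1 := h.ncard_exceptional_le
  have h2 : (matroidsOn n).ncard ≤
      {M ∈ matroidsOn n | M.bigNonbaseDensity ≤ smallUpsilon n}.ncard +
      {M ∈ matroidsOn n | ¬ M.bigNonbaseDensity ≤ smallUpsilon n}.ncard := by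
    refine le_trans (Set.ncard_le_ncard ?_ ?_) (Set.ncard_union_le _ _)
    · intro M hM
      by_cases hu : M.bigNonbaseDensity ≤ smallUpsilon n
      · exact Or.inl ⟨hM, hu⟩
      · exact Or.inr ⟨hM, hu⟩
    · exact (hfin.subset fun _ h => h.1).union (hfin.subset fun _ h => h.1)
  have h2 : ((matroidsOn n).ncard : ℝ) ≤
      {M ∈ matroidsOn n | M.bigNonbaseDensity ≤ smallUpsilon n}.ncard +
      {M ∈ matroidsOn n | ¬ M.bigNonbaseDensity ≤ smallUpsilon n}.ncard := by exact_mod_cast h2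
  have h3 : (2 : ℝ) ^ (-(n : ℝ)) = (1 / 2) ^ n := by
    rw [Real.rpow_neg (by norm_num), Real.rpow_natCast, one_div, inv_pow]
  rw [h3] at h1
  rw [le_div_iff₀ hm0]
  have h4 : ((n : ℝ) + 1) * (2 * (numSparsePaving n * (1 / 2) ^ n)) ≤
      (n + 1) * (2 * ((matroidsOn n).ncard * (1 / 2) ^ n)) := by gcongr
  linarith

/-- The denominator is at least the middle binomial divided by n; the term 2 log(n+1) is absorbed by
raising 285 to 289. -/
theorem smallUpsilon_le (h : Large n) :
    ‖smallUpsilon n‖ ≤ 289 * ‖Real.logb 2 (n : ℝ) ^ 3 / (n : ℝ)‖ := by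
  have hn := h.pos
  have hn1 : (1 : ℝ) ≤ n := le_trans (by norm_num) h.large_real
  have hL := h.logb_pos
  have hL1 : 1 ≤ Real.logb 2 (n : ℝ) := le_trans (by norm_num) h.logb_ge
  have hΛ := h.logb_numSparsePaving_pos
  have hB := choose_pos (n := n)
  have hlog : 0 ≤ Real.logb 2 ((n : ℝ) + 1) := Real.logb_nonneg (by norm_num) (by linarith)
  have hlog' : Real.logb 2 ((n : ℝ) + 1) ≤ 2 * Real.logb 2 n := by
    have : (n : ℝ) + 1 ≤ n * n := by nlinarith [h.large_real]
    calc Real.logb 2 ((n : ℝ) + 1) ≤ Real.logb 2 (n * n) :=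
          Real.logb_le_logb_of_le (by norm_num) (by linarith) this
      _ = _ := by rw [Real.logb_mul hn.ne' hn.ne']; ring
  have hnum : 0 ≤ bigUpsilon n + 2 * Real.logb 2 ((n : ℝ) + 1) := by
    rw [bigUpsilon_eq]; positivity
  have h4 : (n : ℝ) ^ 2 ≤ n.choose (n / 2) := by
    refine le_trans ?_ (by exact_mod_cast h.pow_four_le : (n : ℝ) ^ 4 ≤ n.choose (n / 2))
    exact pow_le_pow_right₀ hn1 (by norm_num)
  rw [smallUpsilon, Real.norm_of_nonneg (div_nonneg hnum hΛ.le),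
    Real.norm_of_nonneg (by positivity), div_le_iff₀ hΛ]
  set L := Real.logb 2 (n : ℝ)
  have hL3 : L ≤ L ^ 3 := by
    calc L = L ^ 1 := (pow_one _).symm
      _ ≤ L ^ 3 := pow_le_pow_right₀ hL1 (by norm_num)
  calc bigUpsilon n + 2 * Real.logb 2 ((n : ℝ) + 1)
      ≤ 285 * L ^ 3 * n.choose (n / 2) / (n : ℝ) ^ 2 +
        4 * L ^ 3 * n.choose (n / 2) / (n : ℝ) ^ 2 := by
        rw [bigUpsilon_eq]
        refine add_le_add le_rfl ?_
        rw [le_div_iff₀ (by positivity)]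
        calc 2 * Real.logb 2 ((n : ℝ) + 1) * (n : ℝ) ^ 2 ≤ 4 * L ^ 3 * (n : ℝ) ^ 2 := by
              gcongr ?_ * _; linarith
          _ ≤ _ := by gcongr
    _ = 289 * (L ^ 3 / n) * (n.choose (n / 2) / n) := by field_simp; ring
    _ ≤ _ := by gcongr; exact h.choose_le_logb

end Large

end Johnson

theorem theorem4p5 :
    AlmostAllMatroids (fun n M => M.bigNonbaseDensity ≤ smallUpsilon n) ∧
      smallUpsilon =O[atTop] (fun n : ℕ => Real.logb 2 (n : ℝ) ^ 3 / (n : ℝ)) := by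
  constructor
  · have h1 : Tendsto (fun n : ℕ => 1 - ((n : ℝ) + 1) * (2 * (1 / 2 : ℝ) ^ n)) atTop (𝓝 1) := by
      have h2 : Tendsto (fun n : ℕ => (n : ℝ) * (1 / 2 : ℝ) ^ n) atTop (𝓝 0) :=
        tendsto_self_mul_const_pow_of_lt_one (by norm_num) (by norm_num)
      have h3 : Tendsto (fun n : ℕ => (1 / 2 : ℝ) ^ n) atTop (𝓝 0) :=
        tendsto_pow_atTop_nhds_zero_of_lt_one (by norm_num) (by norm_num)
      have h4 := ((h2.add h3).const_mul 2).const_sub 1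
      simp only [add_zero, mul_zero, sub_zero] at h4
      refine h4.congr fun n => ?_
      ring
    refine tendsto_of_tendsto_of_tendsto_of_le_of_le' h1 tendsto_const_nhds ?_ ?_
    · filter_upwards [Johnson.eventually_large] with n hn
      exact hn.one_sub_le
    · refine Eventually.of_forall fun n => div_le_one_of_le₀ ?_ (Nat.cast_nonneg _)
      exact Nat.cast_le.2 (Set.ncard_le_ncard (fun _ h => h.1) (matroidsOn_finite n))
  · refine IsBigO.of_bound 289 ?_
    filter_upwards [Johnson.eventually_large] with n hn
    exact hn.smallUpsilon_le
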